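/- **Conventions.** $\Delta_k$ denotes the coefficient of $\lambda^k$ in a formal Laurent series in $\lambda^{-1}$, and $(\cdot)_+$ the part polynomial in $\lambda$. All quantities are real, and $I\subseteq\mathbb R$ is an open set of values of $x$, subscripts $x$ being derivatives. Put $$B^\lambda(w_1,w_2)=w_{1xx}w_2+w_1w_{2xx}-w_{1x}w_{2x}+(4u-\lambda)w_1w_2 .$$ Let $n\ge 1$, $v(\lambda)=1+\sum_{k=1}^n v_k\lambda^{-k}$, $v^{(k)}=(\lambda^kv)_+$ and $p_{jk}=\Delta_{-j}\,B^\lambda(v,v^{(k)})$ (the Gelfand–Dickey polynomials), and fix parameters $a_0,\dots,a_{n-1}$. With $u=\frac{v_1}{2}+\frac{a_0}{4}$, the $P_0$-system (with parameter $a_n$) and the $P_1$-system (with parameter $a_{2n}$) for $v_1,\dots,v_n$ are $$P_0:\ p_{0k}-v_{k+1}=a_k\ (1\le k\le n-1),\ p_{0n}=a_n;\qquad P_1:\ p_{0k}-v_{k+1}=a_k\ (1\le k\le n-1),\ p_{nn}=a_{2n}.$$ Coordinates: $r_k=\Delta_{-k}\sqrt{v(\lambda)}$ $(1\le k\le n)$;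 $q_k=r_k$ $(1\le k\le n-1)$ and $q_n=\sqrt{-v_n}$ (where $v_n<0$). Momenta: $s_{n+1-k}=r_{kx}$ $(1\le k\le n)$; $p_{n-k}=q_{kx}$ $(1\le k\le n-1)$, $p_n=q_{nx}$. Put $a(\lambda)=-\lambda+\sum_j a_j\lambda^{-j}$, $r(\lambda)=1+\sum_{k=1}^{n}r_k\lambda^{-k}$, $q(\lambda)=1+\sum_{k=1}^{n-1}q_k\lambda^{-k}$, $s(\lambda)=\sum_{k=1}^n s_k\lambda^{-k}$, $p(\lambda)=\sum_{k=1}^n p_k\lambda^{-k}$, and $$\mathcal L(w)=\tfrac12w_x^2-\mathcal V(w),\quad \mathcal H(w,z)=\tfrac12z^2+\mathcal V(w),\quad \mathcal V(w)=\tfrac12\Big(w_1+\frac{a_0-\lambda}{4}\Big)w^2+\frac{a(\lambda)}{8w^2},$$ $$L^{(0)}_n=\Delta_{-(n+1)}\mathcal L(r),\qquad H^{(0)}_n=\Delta_{-(n+1)}\mathcal H(r,s),$$ $$L^{(1)}_n=\Delta_{-n}\mathcal L(q)+\tfrac12q_{nx}^2-\tfrac12\Big(q_1+\frac{a_0}4\Big)q_n^2-\frac{a_{2n}}{8q_n^2},\qquad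 H^{(1)}_n=\Delta_{-n}\mathcal H(q,p)+\tfrac12p_n^2+\tfrac12\Big(q_1+\frac{a_0}4\Big)q_n^2+\frac{a_{2n}}{8q_n^2},$$ where the additive constants (in $a_{n+1}$, respectively $a_n$) are dropped, so that the functions $\cdot^{(0)}$ depend on the parameters $a_0,\dots,a_n$ and the functions $\cdot^{(1)}$ on $a_0,\dots,a_{n-1},a_{2n}$. The symbol $|_Y$ (respectively $|_X$) means that $v_k,v_{kx},v_{kxx}$ are expressed through $(r,s)$ (respectively $(q,p)$), the $x$-derivatives of the momenta being eliminated by the canonical equations of $H_n^{(0)}$ (respectively $H_n^{(1)}$). Put $K_j=-\frac18p_{jn}|_Y$ and $H_j=-\frac18p_{jn}|_X$. **Proposition.** The statements about $P_0$ hold for every $n\ge1$; the statements about $P_1$ and $\Phi$ hold for every $n\ge2$. 1. *(Stationary flow.)* Let $\bar v(\lambda)=\sum_{j\ge0}\bar v_j\lambda^{-j}$, $\bar v_0=1$, be the basis solution of $B^\lambda(\bar v,\bar v)=-\lambda$ for a smooth $u$, let $\bar X_k=\frac{d}{dx}\bar v_{k+1}$, let $c_1,\dots,c_n\in\mathbb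 R$, $c(\lambda)=1+\sum_{j=1}^nc_j\lambda^{-j}$, and $a_k=\Delta_{-k}(-\lambda c(\lambda)^2)$ for $k<n$. On an open interval, a function $u$ is a smooth solution of the Lax–Novikov equation $\bar X_n+\sum_{j=1}^nc_j\bar X_{n-j}=0$ if and only if $u=\frac{v_1}2+\frac{a_0}4$ for some smooth solution $v$ of the $P_0$-system with some constant $a_n$. The set of these $u$ is the extended phase space $M_n$. 2. *(Lagrangian form.)* $L^{(0)}_n$ (for all $r$) and $L^{(1)}_n$ (for $q_n\ne0$) are natural Lagrangians, that is, smooth potential subtracted from a kinetic energy that is a nondegenerate quadratic form in the velocities. A $C^2$ curve $v$ solves the $P_0$-system on $I$ if and only if $r$ solves the Euler–Lagrange equations of $L^{(0)}_n$; a $C^2$ curve $v$ with $v_n<0$ solves the $P_1$-system on $I$ if and only if $q$ solves those of $L^{(1)}_n$. 3. *(Hamiltonian form.)* $s$ and $p$ are the canonical momenta of $L^{(0)}_n$ and $L^{(1)}_n$, and $H^{(0)}_n$ and $H^{(1)}_n$ are their Hamiltonians (Legendre transforms). The $P_0$-system is equivalent to $r_{kx}=\partial H^{(0)}_n/\partial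 s_k$, $s_{kx}=-\partial H^{(0)}_n/\partial r_k$, and, where $v_n<0$, the $P_1$-system to $q_{kx}=\partial H^{(1)}_n/\partial p_k$, $p_{kx}=-\partial H^{(1)}_n/\partial q_k$. 4. *(Integrals of motion.)* Along every solution of the first canonical system on an open interval the Gelfand–Dickey polynomials $p_{jn}$ are equal to constants $a_{n+j}$, and $K_j=-\frac18p_{jn}|_Y=-\frac18a_{n+j}$ $(j=1,\dots,n)$. Along every solution, with $q_n\neq0$, of the second one on an open interval they are equal to constants $a_{n+j}$, and $H_j=-\frac18p_{jn}|_X=-\frac18a_{n+j}$ $(j=0,\dots,n-1)$. These integrals are independent: $dK_1,\dots,dK_n$ are linearly independent on an open dense set of points $(r,s)$, and $dH_0,\dots,dH_{n-1}$ on an open dense subset of $\{q_n\ne0\}$. 5. *(The map $\Phi$.)* With $a_n$ and $a_{2n}$ as additional dynamical variables, let $\Phi:(r,s,a_n)\mapsto(q,p,a_{2n})$ be the map defined through the common variables $(v_k,v_{kx})$ and $a_{2n}=p_{nn}|_Y$. It is a smooth diffeomorphism from $\{v_n<0\}\subset\mathbb R^{2n+1}$ onto $\{q_n>0\}\subset\mathbb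 R^{2n+1}$. Every $C^2$ solution $v$ of the $P_0$-system with $v_n<0$ on an open interval solves the $P_1$-system for some constant $a_{2n}$, and $\Phi$ maps its point $(r,s,a_n)$ to its point $(q,p,a_{2n})$. Moreover $H_j\circ\Phi=K_j$ for $0\le j\le n$, and $\Phi_*$ maps the Hamiltonian vector field of $H^{(0)}_n$ to that of $H^{(1)}_n$ (both extended by $0$ in the last component). Let $\tilde E$ be the extended canonical tensor, $\tilde E\,dF=(\partial F/\partial p,-\partial F/\partial q,0)$, in either chart. Then $\Phi_*\tilde E\,\Phi^*$ is a Poisson tensor on $\{q_n>0\}$, and it is a second one: it differs from the tensor $\tilde E$ of the chart $(q,p,a_{2n})$ at the points of a dense subset. -/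

import Mathlib

open Set

open scoped ContDiff

noncomputable section

namespace StationaryKdV

/-! ### Laurent series in `λ`

A formal series `∑ c_j λ^{-j}` is an element of `LaurentSeries ℝ` whose variable is `λ⁻¹`. -/

/-- `Δ_k(f)`: the coefficient of `λ^k` in `f`. -/
def Del (k : ℤ) (f : LaurentSeries ℝ) : ℝ := f.coeff (-k)

/-- The element `λ`. -/
def lam : LaurentSeries ℝ := HahnSeries.single (-1 : ℤ) (1 : ℝ)

/-- A constant series. -/
def cst (x : ℝ) : LaurentSeries ℝ := HahnSeries.C x

/-- `f_+`: the purely polynomial part in `λ` (the exponents of `λ⁻¹` that are `< 1`). -/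
def plusPart (f : LaurentSeries ℝ) : LaurentSeries ℝ := HahnSeries.truncLT (1 : ℤ) f

/-- Coordinates of vectors of `ℝⁿ` are numbered `1, …, n`: `comp x k = x_k`, and `0` for any
other `k`. -/
def comp {n : ℕ} (x : Fin n → ℝ) (k : ℕ) : ℝ :=
  if h : 1 ≤ k ∧ k ≤ n then x ⟨k - 1, by omega⟩ else 0

/-- `c₀ + ∑_{k=1}^m x_k λ^{-k}`. -/
def serTo {n : ℕ} (m : ℕ) (c₀ : ℝ) (x : Fin n → ℝ) : LaurentSeries ℝ :=
  cst c₀ + ∑ k ∈ Finset.Icc 1 m, HahnSeries.single (k : ℤ) (comp x k)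

/-- `c₀ + ∑_{k=1}^n x_k λ^{-k}`. -/
def ser {n : ℕ} (c₀ : ℝ) (x : Fin n → ℝ) : LaurentSeries ℝ := serTo n c₀ x

/-- `-λ + ∑_{j=0}^{m-1} a_j λ^{-j}`. -/
def aSer (a : ℕ → ℝ) (m : ℕ) : LaurentSeries ℝ :=
  -lam + ∑ j ∈ Finset.range m, HahnSeries.single (j : ℤ) (a j)

/-! ### The generating function and the Gelfand--Dickey polynomials -/

/-- The second order jet `(w, w_x, w_xx)`, at a point, of a series whose coefficients are functions
of `x`. -/
structure Jet where
  val : LaurentSeries ℝ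
  d1 : LaurentSeries ℝ
  d2 : LaurentSeries ℝ

/-- The jet of `w^{(k)} = (λ^k w)_+`. -/
def Jet.proj (k : ℕ) (w : Jet) : Jet where
  val := plusPart (lam ^ k * w.val)
  d1 := plusPart (lam ^ k * w.d1)
  d2 := plusPart (lam ^ k * w.d2)

/-- `B^λ(w₁, w₂) = w₁ₓₓ w₂ + w₁ w₂ₓₓ - w₁ₓ w₂ₓ + (4u - λ) w₁ w₂`. -/
def bilB (u : ℝ) (w₁ w₂ : Jet) : LaurentSeries ℝ :=
  w₁.d2 * w₂.val + w₁.val * w₂.d2 - w₁.d1 * w₂.d1 + (cst (4 * u) - lam) * w₁.val * w₂.val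

/-- The polynomial `p_{jk}`: the coefficient of `λ^{-j}` in `B^λ(v, v^{(k)})`. -/
def gd (u : ℝ) (v : Jet) (j k : ℕ) : ℝ := Del (-(j : ℤ)) (bilB u v (v.proj k))

/-- The jet of `v(λ) = 1 + ∑_{k=1}^n v_k λ^{-k}` with the given values of `v_k, v_{kx}, v_{kxx}`. -/
def vJet {n : ℕ} (v vx vxx : Fin n → ℝ) : Jet := ⟨ser 1 v, ser 0 vx, ser 0 vxx⟩

/-- `u = v₁/2 + a₀/4`. -/
def uOf {n : ℕ} (a : ℕ → ℝ) (v : Fin n → ℝ) : ℝ := comp v 1 / 2 + a 0 / 4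

/-- `p_{jk}` evaluated along the curve `x ↦ v(x)`, with `u = v₁/2 + a₀/4`. -/
def gdAlong {n : ℕ} (a : ℕ → ℝ) (v : ℝ → Fin n → ℝ) (x : ℝ) (j k : ℕ) : ℝ :=
  gd (uOf a (v x)) (vJet (v x) (deriv v x) (deriv (deriv v) x)) j k

/-- The `P₀`-system with parameters `a₀, …, a_{n-1}` and `a_n = α`, on `I`. -/
def P0System {n : ℕ} (a : ℕ → ℝ) (α : ℝ) (I : Set ℝ) (v : ℝ → Fin n → ℝ) : Prop :=
  ∀ x ∈ I, (∀ k ∈ Finset.Icc 1 (n - 1), gdAlong a v x 0 k - comp (v x) (k + 1) = a k) ∧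
    gdAlong a v x 0 n = α

/-- The `P₁`-system with parameters `a₀, …, a_{n-1}` and `a_{2n} = β`, on `I`. -/
def P1System {n : ℕ} (a : ℕ → ℝ) (β : ℝ) (I : Set ℝ) (v : ℝ → Fin n → ℝ) : Prop :=
  ∀ x ∈ I, (∀ k ∈ Finset.Icc 1 (n - 1), gdAlong a v x 0 k - comp (v x) (k + 1) = a k) ∧
    gdAlong a v x n n = β

/-! ### The stationary flow -/

/-- The jet at `x` of `∑_{k ≥ 0} w_k λ^{-k}`. -/
def fullJet (w : ℕ → ℝ → ℝ) (x : ℝ) : Jet where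
  val := HahnSeries.ofPowerSeries ℤ ℝ (PowerSeries.mk fun k => w k x)
  d1 := HahnSeries.ofPowerSeries ℤ ℝ (PowerSeries.mk fun k => deriv (w k) x)
  d2 := HahnSeries.ofPowerSeries ℤ ℝ (PowerSeries.mk fun k => deriv (deriv (w k)) x)

/-- `v̄₀, v̄₁, …` is the basis solution: smooth functions on `I` with `v̄₀ = 1` and
`B^λ(v̄(λ), v̄(λ)) = -λ`, where `v̄(λ) = ∑_{j ≥ 0} v̄_j λ^{-j}`. -/
def IsBasisSolution (I : Set ℝ) (u : ℝ → ℝ) (w : ℕ → ℝ → ℝ) : Prop :=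
  (∀ k, ContDiffOn ℝ ∞ (w k) I) ∧ (∀ x ∈ I, w 0 x = 1) ∧
    ∀ x ∈ I, bilB (u x) (fullJet w x) (fullJet w x) = -lam

/-- The solutions `u` on `I` of the Lax--Novikov equation `X̄_n + ∑_{j=1}^n c_j X̄_{n-j} = 0`, where
`X̄_k = P₀ v̄_{k+1} = d v̄_{k+1}/dx` are the vector fields of the KdV hierarchy. -/
def LaxNovikov (n : ℕ) (c : ℕ → ℝ) (I : Set ℝ) : Set (ℝ → ℝ) :=
  {u | ContDiffOn ℝ ∞ u I ∧ ∃ w, IsBasisSolution I u w ∧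
    ∀ x ∈ I, deriv (w (n + 1)) x + ∑ j ∈ Finset.Icc 1 n, c j * deriv (w (n - j + 1)) x = 0}

/-- The parameter `a_k`: the coefficient of `λ^{-k}` in `-λ c(λ)²`,
`c(λ) = 1 + ∑_{j=1}^n c_j λ^{-j}`. -/
def aOfC (n : ℕ) (c : ℕ → ℝ) (k : ℕ) : ℝ :=
  Del (-(k : ℤ)) (-lam * (1 + ∑ j ∈ Finset.Icc 1 n, HahnSeries.single (j : ℤ) (c j)) ^ 2)

/-! ### The coordinates -/

/-- The coefficients of the square root, with constant term `1`, of a series with constant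
term `1`. -/
def sqrtCoeff (f : ℕ → ℝ) : ℕ → ℝ
  | 0 => 1
  | k + 1 => (f (k + 1) - ∑ i : Fin k, sqrtCoeff f (i.val + 1) * sqrtCoeff f (k - i.val)) / 2
termination_by k => k
decreasing_by all_goals omega

theorem sqrtCoeff_sq (f : ℕ → ℝ) (hf : f 0 = 1) :
    PowerSeries.mk (sqrtCoeff f) ^ 2 = PowerSeries.mk f := by
  ext m
  rw [pow_two, PowerSeries.coeff_mul]
  simp only [PowerSeries.coeff_mk]
  rw [Finset.Nat.sum_antidiagonal_eq_sum_range_succ (fun i j => sqrtCoeff f i * sqrtCoeff f j)]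
  cases m with
  | zero => simp [sqrtCoeff, hf]
  | succ k =>
    rw [Finset.sum_range_succ, Finset.sum_range_succ']
    have h : ∑ i ∈ Finset.range k, sqrtCoeff f (i + 1) * sqrtCoeff f (k + 1 - (i + 1)) =
        ∑ i : Fin k, sqrtCoeff f (i.val + 1) * sqrtCoeff f (k - i.val) := by
      rw [Finset.sum_range]
      refine Finset.sum_congr rfl fun i _ => ?_
      rw [Nat.add_sub_add_right]
    rw [h]
    have h0 : sqrtCoeff f 0 = 1 := by rw [sqrtCoeff]
    have h1 : sqrtCoeff f (k + 1) = (f (k + 1) -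
        ∑ i : Fin k, sqrtCoeff f (i.val + 1) * sqrtCoeff f (k - i.val)) / 2 := by
      rw [sqrtCoeff]
    simp only [Nat.sub_zero, Nat.sub_self, h0]
    rw [h1]
    ring

/-- The coordinates `r_k = Δ_{-k}(√v(λ))`, `k = 1, …, n`. -/
def rCoord {n : ℕ} (v : Fin n → ℝ) : Fin n → ℝ :=
  fun i => sqrtCoeff (fun k => (ser 1 v).coeff (k : ℤ)) (i.val + 1)

/-- The coordinates `q_k = r_k` for `k < n`, and `q_n = √(-v_n)`. -/
def qCoord {n : ℕ} (v : Fin n → ℝ) : Fin n → ℝ :=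
  fun i => if i.val + 1 = n then √(-v i) else rCoord v i

/-- `v_k`, `k = 1, …, n`, in terms of `r`: the coefficients of `r(λ)²`. -/
def vOfR {n : ℕ} (r : Fin n → ℝ) : Fin n → ℝ :=
  fun i => Del (-((i.val + 1 : ℕ) : ℤ)) (ser 1 r ^ 2)

/-- `v_{kx}` in terms of `r` and `r_x`. -/
def vxOfR {n : ℕ} (r rx : Fin n → ℝ) : Fin n → ℝ :=
  fun i => Del (-((i.val + 1 : ℕ) : ℤ)) (2 * (ser 1 r * ser 0 rx))

/-- `v_{kxx}` in terms of `r`, `r_x` and `r_xx`. -/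
def vxxOfR {n : ℕ} (r rx rxx : Fin n → ℝ) : Fin n → ℝ :=
  fun i => Del (-((i.val + 1 : ℕ) : ℤ)) (2 * (ser 0 rx ^ 2 + ser 1 r * ser 0 rxx))

/-- `v_k` in terms of `q`: for `k < n` the coefficients of `(1 + ∑_{j<n} q_j λ^{-j})²`, and
`v_n = -q_n²`. -/
def vOfQ {n : ℕ} (q : Fin n → ℝ) : Fin n → ℝ :=
  fun i => if i.val + 1 = n then -q i ^ 2
    else Del (-((i.val + 1 : ℕ) : ℤ)) (serTo (n - 1) 1 q ^ 2)

/-- `v_{kx}` in terms of `q` and `q_x`. -/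
def vxOfQ {n : ℕ} (q qx : Fin n → ℝ) : Fin n → ℝ :=
  fun i => if i.val + 1 = n then -(2 * (q i * qx i))
    else Del (-((i.val + 1 : ℕ) : ℤ)) (2 * (serTo (n - 1) 1 q * serTo (n - 1) 0 qx))

/-- `v_{kxx}` in terms of `q`, `q_x` and `q_xx`. -/
def vxxOfQ {n : ℕ} (q qx qxx : Fin n → ℝ) : Fin n → ℝ :=
  fun i => if i.val + 1 = n then -(2 * (qx i ^ 2 + q i * qxx i))
    else Del (-((i.val + 1 : ℕ) : ℤ))
      (2 * (serTo (n - 1) 0 qx ^ 2 + serTo (n - 1) 1 q * serTo (n - 1) 0 qxx))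

/-! ### Mechanics -/

/-- The partial derivative `∂f/∂x_k`. -/
def pd {n : ℕ} (f : (Fin n → ℝ) → ℝ) (x : Fin n → ℝ) (k : Fin n) : ℝ :=
  fderiv ℝ f x (Pi.single k 1)

/-- The Euler--Lagrange equations `∂L/∂q_k - (d/dx) ∂L/∂q_{kx} = 0` on `I`. -/
def EulerLagrange {n : ℕ} (L : (Fin n → ℝ) → (Fin n → ℝ) → ℝ) (I : Set ℝ)
    (q : ℝ → Fin n → ℝ) : Prop :=
  ∀ x ∈ I, ∀ k, pd (fun y => L y (deriv q x)) (q x) k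
    - deriv (fun t => pd (L (q t)) (deriv q t) k) x = 0

/-- Hamilton's canonical equations on `I`. -/
def HamiltonEqs {n : ℕ} (H : (Fin n → ℝ) → (Fin n → ℝ) → ℝ) (I : Set ℝ)
    (q p : ℝ → Fin n → ℝ) : Prop :=
  ∀ x ∈ I, HasDerivAt q (fun k => pd (H (q x)) (p x) k) x ∧
    HasDerivAt p (fun k => -pd (fun y => H y (p x)) (q x) k) x

/-- A natural Lagrangian on the configuration domain `U`: kinetic energy of a (pseudo-Riemannian)
metric minus a potential. -/
def IsNaturalLagrangian {n : ℕ} (L : (Fin n → ℝ) → (Fin n → ℝ) → ℝ) (U : Set (Fin n → ℝ)) : Prop :=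
  ∃ (g : (Fin n → ℝ) → Matrix (Fin n) (Fin n) ℝ) (V : (Fin n → ℝ) → ℝ),
    (∀ i j, ContDiffOn ℝ ∞ (fun q => g q i j) U) ∧ ContDiffOn ℝ ∞ V U ∧
    ∀ q ∈ U, (g q).IsSymm ∧ (g q).det ≠ 0 ∧
      ∀ w, L q w = (1 / 2) * ∑ i, ∑ j, g q i j * w i * w j - V q

/-- `p` are the canonical momenta of `L`, as a function of the velocities (for positions in `U`), and
`H` is the Hamiltonian of `L`: `p_k = ∂L/∂q_{kx}` and `H = ∑ p_k q_{kx} - L`. -/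
def IsCanonicalForm {n : ℕ} (L H : (Fin n → ℝ) → (Fin n → ℝ) → ℝ)
    (p : (Fin n → ℝ) → (Fin n → ℝ)) (U : Set (Fin n → ℝ)) : Prop :=
  Function.Bijective p ∧ ∀ q ∈ U, ∀ w, (∀ k, pd (L q) w k = p w k) ∧
    H q (p w) = ∑ k, p w k * w k - L q w

/-- `𝓛(λ; w) = w_x²/2 - (w₁ + (a₀-λ)/4) w²/2 - a/(8w²)`. -/
def scrL (a₀ : ℝ) (A w wx : LaurentSeries ℝ) : LaurentSeries ℝ :=
  cst (1 / 2) * wx ^ 2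
    - cst (1 / 2) * (cst (Del (-1) w) + cst (1 / 4) * (cst a₀ - lam)) * w ^ 2
    - A / (8 * w ^ 2)

/-- `𝓗(λ; w, z) = z²/2 + (w₁ + (a₀-λ)/4) w²/2 + a/(8w²)`. -/
def scrH (a₀ : ℝ) (A w z : LaurentSeries ℝ) : LaurentSeries ℝ :=
  cst (1 / 2) * z ^ 2
    + cst (1 / 2) * (cst (Del (-1) w) + cst (1 / 4) * (cst a₀ - lam)) * w ^ 2
    + A / (8 * w ^ 2)

/-! The higher parameters `a_j` of `a(λ)` enter the coefficients below only through an additive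
constant; this constant is normalized to `0`, so that the functions depend on `a₀, …, a_{n-1}, a_n`,
respectively on `a₀, …, a_{n-1}, a_{2n}`, only. -/

/-- `L_n^{(0)}`, with `a_n = α`. -/
def L0 (n : ℕ) (a : ℕ → ℝ) (α : ℝ) (r rx : Fin n → ℝ) : ℝ :=
  Del (-((n + 1 : ℕ) : ℤ))
    (scrL (a 0) (aSer a n + HahnSeries.single (n : ℤ) α) (ser 1 r) (ser 0 rx))

/-- `H_n^{(0)}`, with `a_n = α`. -/
def H0 (n : ℕ) (a : ℕ → ℝ) (α : ℝ) (r s : Fin n → ℝ) : ℝ :=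
  Del (-((n + 1 : ℕ) : ℤ))
    (scrH (a 0) (aSer a n + HahnSeries.single (n : ℤ) α) (ser 1 r) (ser 0 s))

/-- `L_n^{(1)}`, with `a_{2n} = β`; here `q(λ) = 1 + ∑_{j<n} q_j λ^{-j}`. -/
def L1 (n : ℕ) (a : ℕ → ℝ) (β : ℝ) (q qx : Fin n → ℝ) : ℝ :=
  Del (-(n : ℤ)) (scrL (a 0) (aSer a n) (serTo (n - 1) 1 q) (serTo (n - 1) 0 qx))
    + (1 / 2) * comp qx n ^ 2 - (1 / 2) * (comp q 1 + a 0 / 4) * comp q n ^ 2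
    - β / (8 * comp q n ^ 2)

/-- `H_n^{(1)}`, with `a_{2n} = β`; here `q(λ) = 1 + ∑_{j<n} q_j λ^{-j}`. -/
def H1 (n : ℕ) (a : ℕ → ℝ) (β : ℝ) (q p : Fin n → ℝ) : ℝ :=
  Del (-(n : ℤ)) (scrH (a 0) (aSer a n) (serTo (n - 1) 1 q) (ser 0 p))
    + (1 / 2) * comp p n ^ 2 + (1 / 2) * (comp q 1 + a 0 / 4) * comp q n ^ 2
    + β / (8 * comp q n ^ 2)

/-- `s_{n+1-k} = r_{kx}`, `k = 1, …, n` (an involution: also `r_x` in terms of `s`). -/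
def mom0 {n : ℕ} (w : Fin n → ℝ) : Fin n → ℝ := fun i => w i.rev

/-- `p_{n-k} = q_{kx}` for `k = 1, …, n-1` and `p_n = q_{nx}` (an involution: also `q_x` in terms of
`p`). -/
def mom1 {n : ℕ} (w : Fin n → ℝ) : Fin n → ℝ :=
  fun i => if i.val + 1 = n then w i else comp w (n - (i.val + 1))

/-- `-p_{jn}|_Y / 8`: in `-p_{jn}/8` the variables `v_k, v_{kx}` are replaced by the canonical
coordinates `(r, s)`, and the `x`-derivatives of the momenta by Hamilton's equations. -/
def redY (n : ℕ) (a : ℕ → ℝ) (α : ℝ) (j : ℕ) (r s : Fin n → ℝ) : ℝ :=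
  let rx := mom0 s
  let sx : Fin n → ℝ := fun k => -pd (fun y => H0 n a α y s) r k
  let rxx := mom0 sx
  (-1 / 8) * gd (uOf a (vOfR r)) (vJet (vOfR r) (vxOfR r rx) (vxxOfR r rx rxx)) j n

/-- `-p_{jn}|_X / 8`: in `-p_{jn}/8` the variables `v_k, v_{kx}` are replaced by the canonical
coordinates `(q, p)`, and the `x`-derivatives of the momenta by Hamilton's equations. -/
def redX (n : ℕ) (a : ℕ → ℝ) (β : ℝ) (j : ℕ) (q p : Fin n → ℝ) : ℝ :=
  let qx := mom1 p
  let px : Fin n → ℝ := fun k => -pd (fun y => H1 n a β y p) q k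
  let qxx := mom1 px
  (-1 / 8) * gd (uOf a (vOfQ q)) (vJet (vOfQ q) (vxOfQ q qx) (vxxOfQ q qx qxx)) j n

/-- The points `(r, s)` at which the differentials of the functions `-p_{jn}|_Y / 8`, `j = 1, …, n`,
are linearly independent. -/
def independentY (n : ℕ) (a : ℕ → ℝ) (α : ℝ) : Set ((Fin n → ℝ) × (Fin n → ℝ)) :=
  {z | LinearIndependent ℝ (fun j : Fin n =>
    fderiv ℝ (fun y : (Fin n → ℝ) × (Fin n → ℝ) => redY n a α (j.val + 1) y.1 y.2) z)}

/-- The points `(q, p)` with `q_n ≠ 0` at which the differentials of the functions `-p_{jn}|_X / 8`,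
`j = 0, …, n-1`, are linearly independent. -/
def independentX (n : ℕ) (a : ℕ → ℝ) (β : ℝ) : Set ((Fin n → ℝ) × (Fin n → ℝ)) :=
  {z | comp z.1 n ≠ 0 ∧ LinearIndependent ℝ (fun j : Fin n =>
    fderiv ℝ (fun y : (Fin n → ℝ) × (Fin n → ℝ) => redX n a β j.val y.1 y.2) z)}

/-! ### Poisson tensors and the extended phase space -/

/-- The bracket `{f, g} = ⟨df, P dg⟩`. -/
def bracket {X : Type*} [NormedAddCommGroup X] [NormedSpace ℝ X]
    (P : X → ((X →L[ℝ] ℝ) →ₗ[ℝ] X)) (f g : X → ℝ) : X → ℝ :=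
  fun x => fderiv ℝ f x (P x (fderiv ℝ g x))

/-- A Poisson tensor on the open set `U`: a smooth field of skew-symmetric maps from covectors to
vectors whose bracket `{f, g} = ⟨df, P dg⟩` satisfies the Jacobi identity. -/
def IsPoissonTensorOn {X : Type*} [NormedAddCommGroup X] [NormedSpace ℝ X] (U : Set X)
    (P : X → ((X →L[ℝ] ℝ) →ₗ[ℝ] X)) : Prop :=
  (∀ φ, ContDiffOn ℝ ∞ (fun x => P x φ) U) ∧
  (∀ x ∈ U, ∀ φ ψ : X →L[ℝ] ℝ, φ (P x ψ) = -ψ (P x φ)) ∧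
  ∀ f g h : X → ℝ, ContDiffOn ℝ ∞ f U → ContDiffOn ℝ ∞ g U → ContDiffOn ℝ ∞ h U →
    ∀ x ∈ U, bracket P f (bracket P g h) x + bracket P g (bracket P h f) x +
      bracket P h (bracket P f g) x = 0

/-- The coordinate space of the extended phase space: points `(r, s, a_n)` or `(q, p, a_{2n})`. -/
abbrev Ext (n : ℕ) : Type := (Fin n → ℝ) × (Fin n → ℝ) × ℝ

/-- The (constant) trivial extension of the canonical Poisson tensor:
`dF ↦ (∂F/∂p, -∂F/∂q, 0)`. -/
def canTensor (n : ℕ) : (Ext n →L[ℝ] ℝ) →ₗ[ℝ] Ext n where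
  toFun φ := (fun k => φ (0, Pi.single k 1, 0), fun k => -φ (Pi.single k 1, 0, 0), 0)
  map_add' φ ψ := by
    ext <;> simp [add_comm]
  map_smul' c φ := by
    ext <;> simp

/-- The part `v_n < 0` of the chart `(r, s, a_n)`, where the chart `(q, p, a_{2n})` is defined too. -/
def dom0 (n : ℕ) : Set (Ext n) := {m | comp (vOfR m.1) n < 0}

/-- The part `q_n > 0` of the chart `(q, p, a_{2n})`. -/
def dom1 (n : ℕ) : Set (Ext n) := {m | 0 < comp m.1 n}

/-- The map `Φ : (r, s, a_n) ↦ (q, p, a_{2n})`. Through the variables `(v_k, v_{kx})` one has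
`q_k = r_k` and `q_{kx} = r_{kx}` for `k < n`, `q_n = √(-v_n)` and `q_{nx} = -v_{nx}/(2 q_n)`, and
`a_{2n} = p_{nn}|_Y`. -/
def Phi (n : ℕ) (a : ℕ → ℝ) (m : Ext n) : Ext n :=
  let q := qCoord (vOfR m.1)
  let rx := mom0 m.2.1
  let qx : Fin n → ℝ := fun i =>
    if i.val + 1 = n then -(vxOfR m.1 rx i) / (2 * q i) else rx i
  (q, mom1 qx, -8 * redY n a m.2.2 n m.1 m.2.1)

/-- `K̃_j = -p_{jn}|_Y / 8` on the extended phase space. -/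
def Kext (n : ℕ) (a : ℕ → ℝ) (j : ℕ) (m : Ext n) : ℝ := redY n a m.2.2 j m.1 m.2.1

/-- `H̃_j = -p_{jn}|_X / 8` on the extended phase space. -/
def Hext (n : ℕ) (a : ℕ → ℝ) (j : ℕ) (m : Ext n) : ℝ := redX n a m.2.2 j m.1 m.2.1

/-- `H_n^{(0)}` on the extended phase space. -/
def H0ext (n : ℕ) (a : ℕ → ℝ) (m : Ext n) : ℝ := H0 n a m.2.2 m.1 m.2.1

/-- `H_n^{(1)}` on the extended phase space. -/
def H1ext (n : ℕ) (a : ℕ → ℝ) (m : Ext n) : ℝ := H1 n a m.2.2 m.1 m.2.1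

end StationaryKdV

end

/-!
Everything is read off from the single generating function `B^λ(v, v)`. In the variable `t = λ⁻¹` the
series become power series, and all the polynomials `p_{jk}` that occur are coefficients of
`t B^λ(v, v)` (`gd_zero`, `gd_top`): the `P₀`-system prescribes those of `λ^{-1}, …, λ^{-n}`, the
`P₁`-system those of `λ^{-1}, …, λ^{-(n-1)}` and of `λ^{-2n}`.

*Mechanics.* For `v = ρ²` one has `B^λ(v, v) = 4 ρ³ (ρ_{xx} + (u - λ/4) ρ)`, so that the equation
`B^λ(v, v) = a(λ)` becomes, order by order in `t`, Newton's equation for the coefficients of `ρ`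
(`genB_coeff_iff`), with a force that has the coefficient of `𝒱` as its potential (`hasDerivAt_pot`).
The kinetic energy is a constant quadratic form whose matrix is a permutation, so the Euler--Lagrange
and the canonical equations both reduce to Newton's equation (`mechanics_iff`). In the coordinates `q`
the series `v(λ)` agrees with a square only up to order `λ^{-(n-1)}`, and the equation `p_{nn} = a_{2n}`
supplies the motion of `q_n` (`p0System_equiv`, `p1System_equiv`).

*Conservation.* `d/dx B^λ(v, v) = 2 v Q`, where `Q` has no terms beyond `λ^{-n}`. If the coefficients
of `B^λ(v, v)` up to that of `λ^{-n}` are constant, then `Q = 0`, and so all the others are constant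
too; the last of these conditions can be replaced by the constancy of the coefficient of `λ^{-2n}` if
`v_n ≠ 0` (`hasDerivAt_coeff_genBv_zero`). In particular `v(λ)` divided by the constant series
`√(-t B^λ(v, v))` is the basis solution, while conversely the truncation of `c(λ) v̄(λ)` solves the
`P₀`-system, which is the statement on the stationary flow (`mem_laxNovikov_iff`).

*Independence.* A variation `(g, η)` of `(v_x, v_{xx})` at fixed `v` changes `B^λ(v, v)` by
`2 (v η - v_x g)`. If all coefficients are stationary and the polynomials `λ^n v(λ)` and `λ^n v_x(λ)`
are coprime, then `λ^n v(λ)` divides `λ^n g(λ)`, which is of lower degree, so `g = 0`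
(`eq_zero_of_genBv_variation`). A small shift of the top velocity makes the polynomials coprime
(`eventually_isCoprime`).

*The map `Φ`.* The two charts share `v` and `v_x`, and the equations determine `v_{xx}` from these and
either of `a_n`, `a_{2n}` (`IsP0Jet.unique`, `IsP1Jet.unique`); thus they share the jet of `v` and
hence the integrals, and `a_n = p_{0n}` gives the inverse `PhiInv`. Comparing the derivatives of the
shared `v` and `v_x` identifies the Hamiltonian vector fields (`fderiv_Phi_canTensor`). The image of
the constant tensor `Ẽ` is Poisson by the chain rule (`isPoissonTensorOn_pushTensor`). It annihilates
`dH_0`, since `H_0 ∘ Φ = K_0 = -a_n/8` is a Casimir function, whereas the tensor `Ẽ` of the second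
chart does not wherever the `H_j` are independent (`pushTensor_ne`).
-/

namespace StationaryKdV

noncomputable section

open PowerSeries

/-! ### From Laurent series in `λ` to power series in `t = λ⁻¹` -/

/-- The embedding of the power series in `t = λ⁻¹` into the Laurent series. -/
abbrev toL : ℝ⟦X⟧ →+* LaurentSeries ℝ := HahnSeries.ofPowerSeries ℤ ℝ

/-- `c + ∑_{k=1}^m x_k t^k`, where `x_k = 0` for `k > n`. -/
def pser {n : ℕ} (m : ℕ) (c : ℝ) (x : Fin n → ℝ) : ℝ⟦X⟧ :=
  PowerSeries.mk fun j => if j = 0 then c else if j ≤ m then comp x j else 0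

@[simp] theorem coeff_pser {n : ℕ} (m : ℕ) (c : ℝ) (x : Fin n → ℝ) (j : ℕ) :
    coeff j (pser m c x) = if j = 0 then c else if j ≤ m then comp x j else 0 := by
  simp [pser]

@[simp] theorem comp_succ {n : ℕ} (x : Fin n → ℝ) (i : Fin n) : comp x (i.val + 1) = x i := by
  have h : 1 ≤ i.val + 1 ∧ i.val + 1 ≤ n := ⟨by omega, i.isLt⟩
  simp [comp]

theorem comp_of_lt {n : ℕ} (x : Fin n → ℝ) {k : ℕ} (h : n < k) : comp x k = 0 := by
  unfold comp
  rw [dif_neg (by omega)]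

theorem comp_eq {n : ℕ} (x : Fin n → ℝ) {k : ℕ} (h1 : 1 ≤ k) (h2 : k ≤ n) :
    comp x k = x ⟨k - 1, by omega⟩ := by
  unfold comp
  rw [dif_pos ⟨h1, h2⟩]

theorem lam_mul_X : lam * toL X = 1 := by
  rw [lam, HahnSeries.ofPowerSeries_X, HahnSeries.single_mul_single]
  simp

theorem cst_eq (x : ℝ) : cst x = toL (C x) := by
  rw [cst, HahnSeries.ofPowerSeries_C]

theorem single_natCast (k : ℕ) (c : ℝ) :
    (HahnSeries.single (k : ℤ) c : LaurentSeries ℝ) = toL (C c * X ^ k) := by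
  rw [map_mul, HahnSeries.ofPowerSeries_C, HahnSeries.ofPowerSeries_X_pow, HahnSeries.C_apply,
    HahnSeries.single_mul_single]
  simp

theorem serTo_eq {n : ℕ} (m : ℕ) (c : ℝ) (x : Fin n → ℝ) : serTo m c x = toL (pser m c x) := by
  rw [serTo, cst_eq]
  simp only [single_natCast]
  rw [← map_sum, ← map_add]
  congr 1
  ext j
  simp only [map_add, map_sum, coeff_C, coeff_C_mul, coeff_X_pow, coeff_pser, mul_ite, mul_one,
    mul_zero, Finset.sum_ite_eq, Finset.mem_Icc]
  rcases Nat.eq_zero_or_pos j with rfl | h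
  · simp
  · simp [h.ne', Nat.succ_le_of_lt h]

theorem ser_eq {n : ℕ} (c : ℝ) (x : Fin n → ℝ) : ser c x = toL (pser n c x) := serTo_eq n c x

/-- `t a(λ)` for `a(λ) = -λ + ∑_{j<m} a_j λ^{-j}`; the coefficient of `t^{k+1}` is `a_k`. -/
def aPow (a : ℕ → ℝ) (m : ℕ) : ℝ⟦X⟧ :=
  PowerSeries.mk fun k => if k = 0 then -1 else if k ≤ m then a (k - 1) else 0

theorem coeff_aPow (a : ℕ → ℝ) (m k : ℕ) :
    coeff k (aPow a m) = if k = 0 then -1 else if k ≤ m then a (k - 1) else 0 := by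
  simp [aPow]

theorem aSer_eq (a : ℕ → ℝ) (m : ℕ) : aSer a m = lam * toL (aPow a m) := by
  have h : aPow a m = -1 + X * ∑ j ∈ Finset.range m, C (a j) * X ^ j := by
    ext k
    rw [coeff_aPow]
    cases k with
    | zero => simp
    | succ k =>
      simp [coeff_succ_X_mul, coeff_one, coeff_X_pow]
  rw [aSer, h]
  simp only [single_natCast]
  rw [← map_sum, map_add, map_mul, mul_add, ← mul_assoc, lam_mul_X, map_neg, map_one]
  ring

theorem lam_mul_coeff (f : LaurentSeries ℝ) (k : ℤ) : (lam * f).coeff k = f.coeff (k + 1) := by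
  have := HahnSeries.coeff_single_mul_add (r := (1:ℝ)) (x := f) (a := k + 1) (b := (-1 : ℤ))
  simpa [lam] using this

theorem toL_coeff (f : ℝ⟦X⟧) (k : ℕ) : (toL f).coeff (k : ℤ) = coeff k f :=
  HahnSeries.ofPowerSeries_apply_coeff f k

theorem Del_toL (f : ℝ⟦X⟧) (k : ℕ) : Del (-(k : ℤ)) (toL f) = coeff k f := by
  rw [Del, neg_neg, toL_coeff]

theorem Del_lam_toL (f : ℝ⟦X⟧) (k : ℕ) : Del (-(k : ℤ)) (lam * toL f) = coeff (k + 1) f := by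
  rw [Del, neg_neg, lam_mul_coeff]
  exact_mod_cast toL_coeff f (k + 1)

theorem lam_pow_mul_coeff (f : LaurentSeries ℝ) (m : ℕ) (k : ℤ) :
    (lam ^ m * f).coeff k = f.coeff (k + m) := by
  induction m generalizing k with
  | zero => simp
  | succ m ih =>
    rw [pow_succ', mul_assoc, lam_mul_coeff, ih]
    congr 1
    push_cast
    ring

theorem Del_lam_pow_toL (f : ℝ⟦X⟧) (j m : ℕ) :
    Del (-(j : ℤ)) (lam ^ m * (lam * toL f)) = coeff (j + m + 1) f := by
  rw [Del, neg_neg, lam_pow_mul_coeff]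
  have := Del_lam_toL f (j + m)
  rw [Del, neg_neg] at this
  exact_mod_cast this

theorem toL_injective : Function.Injective toL := HahnSeries.ofPowerSeries_injective

/-- The part of `λ^k f` polynomial in `λ` comes from the truncation of `f` at order `k`. -/
theorem plusPart_lam_pow (f : ℝ⟦X⟧) (k : ℕ) :
    plusPart (lam ^ k * toL f) = lam ^ k * toL (trunc (k + 1) f : Polynomial ℝ) := by
  ext j
  rw [plusPart, HahnSeries.coeff_truncLT, lam_pow_mul_coeff, lam_pow_mul_coeff]
  rcases lt_or_ge (j + k) 0 with h | h
  · rw [PowerSeries.coeff_coe, PowerSeries.coeff_coe, if_pos h, if_pos h]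
    simp
  · obtain ⟨i, hi⟩ := Int.eq_ofNat_of_zero_le h
    rw [hi, toL_coeff, toL_coeff, Polynomial.coeff_coe, coeff_trunc]
    split_ifs <;> first | rfl | omega

/-! ### The generating function -/

/-- `t B^λ(f, f)` as a function of the jet `(f, f', f'')` of a power series in `t`. The factor `t`
clears the pole `-λ f²`, so the coefficient of `λ^{-k}` in `B^λ(f, f)` is that of `t^{k+1}` here. -/
def genB (u : ℝ) (f f' f'' : ℝ⟦X⟧) : ℝ⟦X⟧ :=
  X * (2 * f * f'' - f' ^ 2) + (C (4 * u) * X - 1) * f ^ 2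

theorem bilB_lam_pow (u : ℝ) (k : ℕ) (f f' f'' g g' g'' : ℝ⟦X⟧) :
    bilB u ⟨toL f, toL f', toL f''⟩ ⟨lam ^ k * toL g, lam ^ k * toL g', lam ^ k * toL g''⟩ =
      lam ^ k * (lam * toL (X * (f'' * g + f * g'' - f' * g') + (C (4 * u) * X - 1) * f * g)) := by
  simp only [bilB, cst_eq, map_add, map_sub, map_mul, map_one]
  linear_combination (-(lam ^ k * (toL f'' * toL g + toL f * toL g'' - toL f' * toL g' +
    toL (C 4) * toL (C u) * toL f * toL g))) * lam_mul_X

theorem bilB_toL (u : ℝ) (f f' f'' : ℝ⟦X⟧) :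
    bilB u ⟨toL f, toL f', toL f''⟩ ⟨toL f, toL f', toL f''⟩ = lam * toL (genB u f f' f'') := by
  have := bilB_lam_pow u 0 f f' f'' f f' f''
  simp only [pow_zero, one_mul] at this
  rw [this, genB]
  congr 2
  ring

theorem exists_eq_trunc_add (f : ℝ⟦X⟧) (k : ℕ) :
    ∃ w, f = ((trunc k f : Polynomial ℝ) : ℝ⟦X⟧) + X ^ k * w ∧ coeff 0 w = coeff k f := by
  have h : X ^ k ∣ f - ((trunc k f : Polynomial ℝ) : ℝ⟦X⟧) := by
    rw [X_pow_dvd_iff]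
    intro m hm
    simp [coeff_trunc, hm]
  obtain ⟨w, hw⟩ := h
  refine ⟨w, by rw [← hw]; ring, ?_⟩
  have := congrArg (coeff k) hw
  rw [coeff_X_pow_mul', map_sub, Polynomial.coeff_coe, coeff_trunc] at this
  simpa using this.symm

/-- `p_{0k}` is, up to `v_{k+1}`, the coefficient of `λ^{-k}` in `B^λ(v, v)`. -/
theorem gd_zero {n : ℕ} (u : ℝ) (v vx vxx : Fin n → ℝ) (k : ℕ) :
    gd u (vJet v vx vxx) 0 k - comp v (k + 1) =
      coeff (k + 1) (genB u (pser n 1 v) (pser n 0 vx) (pser n 0 vxx)) := by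
  have hc : comp v (k + 1) = coeff (k + 1) (pser n 1 v) := by
    rw [coeff_pser, if_neg (by omega)]
    split_ifs with h
    · rfl
    · exact comp_of_lt v (by omega)
  have h1 : coeff 0 (pser n 1 v) = 1 := by simp
  rw [hc, gd, vJet, Jet.proj]
  simp only [ser_eq, plusPart_lam_pow]
  generalize pser n 1 v = f at *
  generalize pser n 0 vx = f' at *
  generalize pser n 0 vxx = f'' at *
  rw [bilB_lam_pow, Del_lam_pow_toL]
  obtain ⟨w, hw, hw0⟩ := exists_eq_trunc_add f (k + 1)
  obtain ⟨w', hw', -⟩ := exists_eq_trunc_add f' (k + 1)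
  obtain ⟨w'', hw'', -⟩ := exists_eq_trunc_add f'' (k + 1)
  set T : ℝ⟦X⟧ := ((trunc (k + 1) f : Polynomial ℝ) : ℝ⟦X⟧)
  set T' : ℝ⟦X⟧ := ((trunc (k + 1) f' : Polynomial ℝ) : ℝ⟦X⟧)
  set T'' : ℝ⟦X⟧ := ((trunc (k + 1) f'' : Polynomial ℝ) : ℝ⟦X⟧)
  have key : X * (f'' * T + f * T'' - f' * T') + (C (4 * u) * X - 1) * f * T =
      genB u f f' f'' + X ^ (k + 1) * (f * w
        - X * (f'' * w + f * w'' - f' * w' + C (4 * u) * f * w)) := by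
    rw [genB]
    linear_combination (-(X * f'' + (C (4 * u) * X - 1) * f)) * hw - X * f * hw'' + X * f' * hw'
  rw [key, map_add, coeff_X_pow_mul', zero_add, if_pos le_rfl, Nat.sub_self, ← hw0]
  simp only [coeff_zero_eq_constantCoeff] at h1 ⊢
  simp only [map_sub, map_mul, constantCoeff_X, h1]
  ring

/-- `p_{jn}` is the coefficient of `λ^{-(n+j)}` in `B^λ(v, v)`. -/
theorem gd_top {n : ℕ} (u : ℝ) (v vx vxx : Fin n → ℝ) (j : ℕ) :
    gd u (vJet v vx vxx) j n =
      coeff (j + n + 1) (genB u (pser n 1 v) (pser n 0 vx) (pser n 0 vxx)) := by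
  have ht : ∀ (c : ℝ) (x : Fin n → ℝ),
      ((trunc (n + 1) (pser n c x) : Polynomial ℝ) : ℝ⟦X⟧) = pser n c x := by
    intro c x
    ext j
    rw [Polynomial.coeff_coe, coeff_trunc, coeff_pser]
    split_ifs <;> first | rfl | omega
  rw [gd, vJet, Jet.proj]
  simp only [ser_eq, plusPart_lam_pow, ht]
  rw [bilB_lam_pow, Del_lam_pow_toL, genB]
  congr 1
  ring

/-! ### The square root in the generating function -/

/-- The force in the equation `X ρ'' + force = 0` for the square root `ρ` of `v`. The last term
accounts for the difference of `v` and `ρ²`: they agree up to order `t^m`, and the next coefficient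
of `v` is `-e`. With `m = n`, `e = 0`
this is the situation of the coordinates `r`, with `m = n - 1`, `e = q_n²` that of `q`. -/
def force (u : ℝ) (A ρ : ℝ⟦X⟧) (m : ℕ) (e : ℝ) : ℝ⟦X⟧ :=
  (C u * X - C (1 / 4)) * ρ - C (1 / 4) * A * ρ⁻¹ ^ 3
    + C ((1 / 2) * (coeff (m + 1) (ρ ^ 2) + e)) * X ^ (m + 1)

/-- Substituting `f = ρ²` turns the equation `t B^λ(f, f) = A` into `X ρ'' + force = 0`, order by
order in `t`. -/
theorem genB_coeff_iff (m : ℕ) (hm : 1 ≤ m) (a₀ e : ℝ) (A ρ ρ' ρ'' f f' f'' : ℝ⟦X⟧)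
    (hρ : coeff 0 ρ = 1) (hρ' : coeff 0 ρ' = 0) (hρ'' : coeff 0 ρ'' = 0)
    (hA : coeff 0 A = -1) (hA1 : coeff 1 A = a₀)
    (hf : X ^ (m + 1) ∣ f - ρ ^ 2) (hf' : X ^ (m + 1) ∣ f' - 2 * (ρ * ρ'))
    (hf'' : X ^ (m + 1) ∣ f'' - 2 * (ρ' ^ 2 + ρ * ρ'')) (he : e = -coeff (m + 1) f) :
    (∀ k ∈ Finset.Icc 1 m, coeff (k + 1) (genB (coeff 1 ρ + a₀ / 4) f f' f'') = coeff (k + 1) A) ↔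
      ∀ k ∈ Finset.Icc 1 m,
        coeff (k + 1) (X * ρ'' + force (coeff 1 ρ + a₀ / 4) A ρ m e) = 0 := by
  set u := coeff 1 ρ + a₀ / 4 with hu
  set G := X * ρ'' + force u A ρ m e with hG
  have hc : constantCoeff ρ = 1 := by simpa using hρ
  have hinv : ρ * ρ⁻¹ = 1 := PowerSeries.mul_inv_cancel ρ (by rw [hc]; norm_num)
  obtain ⟨w, hw⟩ := hf
  obtain ⟨w', hw'⟩ := hf'
  obtain ⟨w'', hw''⟩ := hf''
  have hw0 : coeff 0 w = coeff (m + 1) f - coeff (m + 1) (ρ ^ 2) := by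
    rw [← map_sub, hw, coeff_X_pow_mul']
    simp
  -- the two sides differ, up to the unit `4 ρ³`, by terms of order `t^{m+2}`
  have key : X ^ (m + 2) ∣ genB u f f' f'' - A - 4 * ρ ^ 3 * G := by
    have hwe : X ∣ 2 * ρ ^ 3 * C ((coeff (m + 1) (ρ ^ 2) + e)) + 2 * ρ ^ 2 * w := by
      rw [X_dvd_iff]
      simp only [map_add, map_mul, map_pow, hc, constantCoeff_C, he]
      rw [coeff_zero_eq_constantCoeff] at hw0
      rw [hw0]
      ring
    obtain ⟨z, hz⟩ := hwe
    have hforce : 4 * ρ ^ 3 * force u A ρ m e = (4 * C u * X - 1) * ρ ^ 4 - A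
        + 2 * C (coeff (m + 1) (ρ ^ 2) + e) * X ^ (m + 1) * ρ ^ 3 := by
      have h4 : C (1 / 4) * 4 = (1 : ℝ⟦X⟧) := by
        rw [← map_ofNat (C : ℝ →+* ℝ⟦X⟧) 4, ← map_mul]; norm_num
      have h2 : C (1 / 2) * 4 = (2 : ℝ⟦X⟧) := by
        rw [← map_ofNat (C : ℝ →+* ℝ⟦X⟧) 4, ← map_mul, ← map_ofNat (C : ℝ →+* ℝ⟦X⟧) 2]; norm_num
      rw [force, map_mul C]
      generalize ρ⁻¹ = i at *
      linear_combination (-(ρ ^ 4) - A * (ρ * i) ^ 3) * h4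
        + C (coeff (m + 1) (ρ ^ 2) + e) * X ^ (m + 1) * ρ ^ 3 * h2
        - A * ((ρ * i) ^ 2 + ρ * i + 1) * hinv
    have h4u : C (4 * u) = (4 : ℝ⟦X⟧) * C u := by
      rw [map_mul, map_ofNat]
    have eT : (X ^ (m + 1) : ℝ⟦X⟧) = X ^ m * X := pow_succ _ _
    refine ⟨2 * w * (2 * (ρ' ^ 2 + ρ * ρ'') + X ^ (m + 1) * w'') + 2 * ρ ^ 2 * w''
      - 4 * ρ * ρ' * w' - X ^ (m + 1) * w' ^ 2 + 4 * C u * (2 * ρ ^ 2 * w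
        + X ^ (m + 1) * w ^ 2) - X ^ m * w ^ 2 - z, ?_⟩
    have e1 : f = ρ ^ 2 + X ^ (m + 1) * w := by rw [← hw]; ring
    have e2 : f' = 2 * (ρ * ρ') + X ^ (m + 1) * w' := by rw [← hw']; ring
    have e3 : f'' = 2 * (ρ' ^ 2 + ρ * ρ'') + X ^ (m + 1) * w'' := by rw [← hw'']; ring
    have e4 : 4 * ρ ^ 3 * G = 4 * ρ ^ 3 * (X * ρ'') + 4 * ρ ^ 3 * force u A ρ m e := by
      rw [hG]; ring
    rw [e4, hforce, genB, h4u, pow_succ (X : ℝ⟦X⟧) (m + 1), e1, e2, e3]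
    generalize C (coeff (m + 1) (ρ ^ 2) + e) = d at *
    generalize (X ^ (m + 1) : ℝ⟦X⟧) = T at *
    generalize (X ^ m : ℝ⟦X⟧) = S at *
    linear_combination (-T) * hz - T * w ^ 2 * eT
  have low : X ^ 2 ∣ genB u f f' f'' - A := by
    have hX : ∀ k < 2, coeff k (X ^ (m + 1) * w : ℝ⟦X⟧) = 0 ∧
        coeff k (X ^ (m + 1) * w' : ℝ⟦X⟧) = 0 ∧ coeff k (X ^ (m + 1) * w'' : ℝ⟦X⟧) = 0 := by
      intro k hk
      simp only [coeff_X_pow_mul', if_neg (show ¬ m + 1 ≤ k by omega), and_self]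
    rw [coeff_zero_eq_constantCoeff] at hρ' hρ'' hA
    have f0 : constantCoeff f = 1 := by
      have := congrArg (coeff 0) hw
      rw [(hX 0 (by norm_num)).1] at this
      simpa [hc, sub_eq_zero] using this
    have f1 : coeff 1 f = 2 * coeff 1 ρ := by
      have := congrArg (coeff 1) hw
      rw [(hX 1 (by norm_num)).1, map_sub, pow_two, coeff_one_mul, hc] at this
      linarith
    have f'0 : constantCoeff f' = 0 := by
      have := congrArg (coeff 0) hw'
      rw [(hX 0 (by norm_num)).2.1] at this
      simpa [hρ', hc, sub_eq_zero] using this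
    have f''0 : constantCoeff f'' = 0 := by
      have := congrArg (coeff 0) hw''
      rw [(hX 0 (by norm_num)).2.2] at this
      simpa [hρ', hρ'', hc, sub_eq_zero] using this
    rw [X_pow_dvd_iff]
    intro k hk
    interval_cases k
    · simp [genB, f0, hA]
    · rw [genB, map_sub, map_add, sub_mul, map_sub, mul_assoc, mul_assoc]
      simp only [one_mul, coeff_C_mul, pow_two, coeff_one_mul, hA1]
      simp [f0, f'0, f''0, f1, hu]
      ring
  have hcomm : genB u f f' f'' - A = 4 * ρ ^ 3 * G + (genB u f f' f'' - A - 4 * ρ ^ 3 * G) := by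
    ring
  have hunit : ∀ k, X ^ k ∣ 4 * ρ ^ 3 * G ↔ X ^ k ∣ G := by
    intro k
    refine IsUnit.dvd_mul_left ?_
    rw [isUnit_iff_constantCoeff]
    simp only [map_mul, map_pow, hc, map_ofNat]
    norm_num
  have lowG : X ^ 2 ∣ G := by
    rw [← hunit]
    have h := dvd_sub low (dvd_trans (pow_dvd_pow X (show 2 ≤ m + 2 by omega)) key)
    rwa [sub_sub_cancel] at h
  have h1 : ∀ F : ℝ⟦X⟧, X ^ 2 ∣ F →
      ((∀ k ∈ Finset.Icc 1 m, coeff (k + 1) F = 0) ↔ X ^ (m + 2) ∣ F) := by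
    intro F hF
    rw [X_pow_dvd_iff] at hF ⊢
    constructor
    · intro h k hk
      rcases lt_or_ge k 2 with h2 | h2
      · exact hF k h2
      · obtain ⟨j, rfl⟩ : ∃ j, k = j + 1 := ⟨k - 1, by omega⟩
        exact h j (Finset.mem_Icc.2 ⟨by omega, by omega⟩)
    · intro h k hk
      rw [Finset.mem_Icc] at hk
      exact h (k + 1) (by omega)
  rw [h1 G lowG, ← hunit]
  have h2 : (∀ k ∈ Finset.Icc 1 m, coeff (k + 1) (genB u f f' f'') = coeff (k + 1) A) ↔
      ∀ k ∈ Finset.Icc 1 m, coeff (k + 1) (genB u f f' f'' - A) = 0 := by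
    simp only [map_sub, sub_eq_zero]
  rw [h2, h1 _ low, hcomm, dvd_add_left key]

/-! ### Calculus of power series with variable coefficients -/

section Calculus

variable {E : Type*} [NormedAddCommGroup E] [NormedSpace ℝ E]

/-- All coefficients of the power series `F x` are smooth functions of `x ∈ U`. -/
def CoeffSmoothOn (F : E → ℝ⟦X⟧) (U : Set E) : Prop :=
  ∀ k, ContDiffOn ℝ ∞ (fun x => coeff k (F x)) U

/-- The coefficientwise derivative of a curve of power series. -/
def HasCoeffDerivAt (F : ℝ → ℝ⟦X⟧) (F' : ℝ⟦X⟧) (x : ℝ) : Prop :=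
  ∀ k, HasDerivAt (fun y => coeff k (F y)) (coeff k F') x

theorem CoeffSmoothOn.const (f : ℝ⟦X⟧) (U : Set E) : CoeffSmoothOn (fun _ => f) U :=
  fun _ => contDiffOn_const

theorem CoeffSmoothOn.add {F G : E → ℝ⟦X⟧} {U : Set E} (hF : CoeffSmoothOn F U)
    (hG : CoeffSmoothOn G U) : CoeffSmoothOn (fun x => F x + G x) U := fun k => by
  simpa only [map_add] using (hF k).add (hG k)

theorem CoeffSmoothOn.sub {F G : E → ℝ⟦X⟧} {U : Set E} (hF : CoeffSmoothOn F U)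
    (hG : CoeffSmoothOn G U) : CoeffSmoothOn (fun x => F x - G x) U := fun k => by
  simpa only [map_sub] using (hF k).sub (hG k)

theorem CoeffSmoothOn.mul {F G : E → ℝ⟦X⟧} {U : Set E} (hF : CoeffSmoothOn F U)
    (hG : CoeffSmoothOn G U) : CoeffSmoothOn (fun x => F x * G x) U := fun k => by
  simp only [coeff_mul]
  exact ContDiffOn.sum fun p _ => (hF p.1).mul (hG p.2)

theorem CoeffSmoothOn.pow {F : E → ℝ⟦X⟧} {U : Set E} (hF : CoeffSmoothOn F U) (m : ℕ) :
    CoeffSmoothOn (fun x => F x ^ m) U := by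
  induction m with
  | zero => simpa using CoeffSmoothOn.const (E := E) 1 U
  | succ m ih => simpa only [pow_succ] using ih.mul hF

theorem CoeffSmoothOn.C {f : E → ℝ} {U : Set E} (hf : ContDiffOn ℝ ∞ f U) :
    CoeffSmoothOn (fun x => C (f x)) U := fun k => by
  simp only [coeff_C]
  split_ifs
  · exact hf
  · exact contDiffOn_const

theorem coeff_inv_of_one {f : ℝ⟦X⟧} (hf : constantCoeff f = 1) (k : ℕ) :
    coeff k f⁻¹ = if k = 0 then 1 else
      -∑ p ∈ Finset.HasAntidiagonal.antidiagonal k, if p.2 < k then coeff p.1 f * coeff p.2 f⁻¹ else 0 := by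
  rw [coeff_inv, hf]
  simp

theorem CoeffSmoothOn.inv {F : E → ℝ⟦X⟧} {U : Set E} (hF : CoeffSmoothOn F U)
    (h1 : ∀ x, constantCoeff (F x) = 1) : CoeffSmoothOn (fun x => (F x)⁻¹) U := fun k => by
  induction k using Nat.strong_induction_on with
  | _ k ih =>
    rw [funext fun x => coeff_inv_of_one (h1 x) k]
    split_ifs
    · exact contDiffOn_const
    · refine (ContDiffOn.sum fun p _ => ?_).neg
      split_ifs with h
      · exact (hF p.1).mul (ih p.2 h)
      · exact contDiffOn_const

theorem HasCoeffDerivAt.const (f : ℝ⟦X⟧) (x : ℝ) : HasCoeffDerivAt (fun _ => f) 0 x :=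
  fun k => by simpa using hasDerivAt_const x (coeff k f)

theorem HasCoeffDerivAt.add {F G : ℝ → ℝ⟦X⟧} {F' G' : ℝ⟦X⟧} {x : ℝ} (hF : HasCoeffDerivAt F F' x)
    (hG : HasCoeffDerivAt G G' x) : HasCoeffDerivAt (fun y => F y + G y) (F' + G') x :=
  fun k => by simpa only [map_add] using (hF k).fun_add (hG k)

theorem HasCoeffDerivAt.sub {F G : ℝ → ℝ⟦X⟧} {F' G' : ℝ⟦X⟧} {x : ℝ} (hF : HasCoeffDerivAt F F' x)
    (hG : HasCoeffDerivAt G G' x) : HasCoeffDerivAt (fun y => F y - G y) (F' - G') x :=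
  fun k => by simpa only [map_sub] using (hF k).fun_sub (hG k)

theorem HasCoeffDerivAt.mul {F G : ℝ → ℝ⟦X⟧} {F' G' : ℝ⟦X⟧} {x : ℝ} (hF : HasCoeffDerivAt F F' x)
    (hG : HasCoeffDerivAt G G' x) :
    HasCoeffDerivAt (fun y => F y * G y) (F' * G x + F x * G') x := fun k => by
  simp only [coeff_mul, map_add, ← Finset.sum_add_distrib]
  exact HasDerivAt.fun_sum fun p _ => (hF p.1).mul (hG p.2)

theorem HasCoeffDerivAt.sq {F : ℝ → ℝ⟦X⟧} {F' : ℝ⟦X⟧} {x : ℝ} (hF : HasCoeffDerivAt F F' x) :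
    HasCoeffDerivAt (fun y => F y ^ 2) (2 * (F x * F')) x := by
  have h := hF.mul hF
  simp only [← pow_two] at h
  convert h using 1
  ring

theorem HasCoeffDerivAt.const_mul {F : ℝ → ℝ⟦X⟧} {F' : ℝ⟦X⟧} {x : ℝ} (f : ℝ⟦X⟧)
    (hF : HasCoeffDerivAt F F' x) : HasCoeffDerivAt (fun y => f * F y) (f * F') x := by
  simpa using (HasCoeffDerivAt.const f x).mul hF

theorem HasCoeffDerivAt.C {f : ℝ → ℝ} {f' x : ℝ} (hf : HasDerivAt f f' x) :
    HasCoeffDerivAt (fun y => C (f y)) (C f') x := fun k => by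
  simp only [coeff_C]
  split_ifs
  · exact hf
  · exact hasDerivAt_const _ _

theorem HasCoeffDerivAt.inv {F : ℝ → ℝ⟦X⟧} {F' : ℝ⟦X⟧} {x : ℝ} (hF : HasCoeffDerivAt F F' x)
    (h1 : ∀ y, constantCoeff (F y) = 1) :
    HasCoeffDerivAt (fun y => (F y)⁻¹) (-(F' * (F x)⁻¹ ^ 2)) x := fun k => by
  have hne : F x * (F x)⁻¹ = 1 := PowerSeries.mul_inv_cancel _ (by rw [h1]; norm_num)
  have hz : F' * (F x)⁻¹ + F x * -(F' * (F x)⁻¹ ^ 2) = 0 := by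
    linear_combination (-(F' * (F x)⁻¹)) * hne
  have h0 : coeff 0 F' = 0 := by
    have h := hF 0
    simp only [coeff_zero_eq_constantCoeff, h1] at h ⊢
    exact h.unique (hasDerivAt_const _ _)
  induction k using Nat.strong_induction_on with
  | _ k ih =>
    rw [funext fun y => coeff_inv_of_one (h1 y) k]
    split_ifs with hk
    · subst hk
      refine (hasDerivAt_const x (1 : ℝ)).congr_deriv ?_
      rw [coeff_zero_eq_constantCoeff] at h0 ⊢
      simp [h0]
    · have hd : HasDerivAt (fun y => -∑ p ∈ Finset.HasAntidiagonal.antidiagonal k,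
          if p.2 < k then coeff p.1 (F y) * coeff p.2 (F y)⁻¹ else 0)
          (-∑ p ∈ Finset.HasAntidiagonal.antidiagonal k, if p.2 < k then coeff p.1 F' * coeff p.2 (F x)⁻¹
            + coeff p.1 (F x) * coeff p.2 (-(F' * (F x)⁻¹ ^ 2)) else 0) x := by
        refine (HasDerivAt.fun_sum fun p _ => ?_).neg
        split_ifs with h
        · exact (hF p.1).mul (ih p.2 h)
        · exact hasDerivAt_const _ _
      refine hd.congr_deriv ?_
      have hz' := congrArg (coeff k) hz
      rw [map_add, coeff_mul, coeff_mul, ← Finset.sum_add_distrib, map_zero] at hz'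
      have hmem : (0, k) ∈ Finset.HasAntidiagonal.antidiagonal k := by simp
      rw [← Finset.add_sum_erase _ _ hmem] at hz' ⊢
      have hsum : ∀ p ∈ (Finset.HasAntidiagonal.antidiagonal k).erase (0, k),
          (if p.2 < k then coeff p.1 F' * coeff p.2 (F x)⁻¹
            + coeff p.1 (F x) * coeff p.2 (-(F' * (F x)⁻¹ ^ 2)) else 0) =
          coeff p.1 F' * coeff p.2 (F x)⁻¹
            + coeff p.1 (F x) * coeff p.2 (-(F' * (F x)⁻¹ ^ 2)) := by
        rintro ⟨i, j⟩ hp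
        rw [Finset.mem_erase, Finset.HasAntidiagonal.mem_antidiagonal] at hp
        refine if_pos ?_
        rcases hp with ⟨h1, h2⟩
        simp only [ne_eq, Prod.mk.injEq, not_and] at h1 h2 ⊢
        by_contra h3
        exact h1 (by omega) (by omega)
      rw [Finset.sum_congr rfl hsum]
      simp only [h0, lt_self_iff_false, if_false, zero_mul, zero_add] at hz' ⊢
      simp only [coeff_zero_eq_constantCoeff, h1, one_mul] at hz'
      linarith

theorem pd_eq {n : ℕ} {f : (Fin n → ℝ) → ℝ} {x : Fin n → ℝ} {k : Fin n} {d : ℝ}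
    (hf : DifferentiableAt ℝ f x)
    (h : HasDerivAt (fun ε : ℝ => f (x + ε • Pi.single k 1)) d 0) : pd f x k = d := by
  have hl : HasDerivAt (fun ε : ℝ => x + ε • (Pi.single k 1 : Fin n → ℝ)) (Pi.single k 1) 0 := by
    simpa using ((hasDerivAt_id (0 : ℝ)).smul_const (Pi.single k 1 : Fin n → ℝ)).const_add x
  have hf' : HasFDerivAt f (fderiv ℝ f x) (x + (0 : ℝ) • (Pi.single k 1 : Fin n → ℝ)) := by
    simpa using hf.hasFDerivAt
  exact (hf'.comp_hasDerivAt (0 : ℝ) hl).unique h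

theorem comp_add {n : ℕ} (x y : Fin n → ℝ) (k : ℕ) : comp (x + y) k = comp x k + comp y k := by
  unfold comp
  split_ifs <;> simp

theorem comp_smul {n : ℕ} (c : ℝ) (x : Fin n → ℝ) (k : ℕ) : comp (c • x) k = c * comp x k := by
  unfold comp
  split_ifs <;> simp

theorem comp_single {n : ℕ} (i : Fin n) (k : ℕ) :
    comp (Pi.single i 1 : Fin n → ℝ) k = if k = i.val + 1 then 1 else 0 := by
  unfold comp
  split_ifs with h1 h2 h2
  · subst h2
    simp
  · rw [Pi.single_apply, if_neg]
    intro h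
    apply h2
    rw [← h]
    simp
    omega
  · omega
  · rfl

theorem pser_add_single {n : ℕ} (m : ℕ) (c ε : ℝ) (x : Fin n → ℝ) (i : Fin n) (hi : i.val + 1 ≤ m) :
    pser m c (x + ε • Pi.single i 1) = pser m c x + C ε * X ^ (i.val + 1) := by
  ext k
  simp only [map_add, coeff_pser, coeff_C_mul, coeff_X_pow, comp_add, comp_smul, comp_single]
  split_ifs <;> first | omega | simp

theorem pser_add_single_of_lt {n : ℕ} (m : ℕ) (c ε : ℝ) (x : Fin n → ℝ) (i : Fin n)
    (hi : m < i.val + 1) : pser m c (x + ε • Pi.single i 1) = pser m c x := by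
  ext k
  simp only [coeff_pser, comp_add, comp_smul, comp_single]
  split_ifs <;> first | omega | simp

theorem contDiff_comp {n : ℕ} (k : ℕ) : ContDiff ℝ ∞ (fun x : Fin n → ℝ => comp x k) := by
  unfold comp
  split_ifs
  · exact contDiff_apply _ _ _
  · exact contDiff_const

theorem contDiffOn_comp {n : ℕ} {g : E → Fin n → ℝ} {U : Set E} (hg : ContDiffOn ℝ ∞ g U) (k : ℕ) :
    ContDiffOn ℝ ∞ (fun x => comp (g x) k) U :=
  (contDiff_comp k).comp_contDiffOn hg

theorem CoeffSmoothOn.pser {n : ℕ} {g : E → Fin n → ℝ} {U : Set E} (hg : ContDiffOn ℝ ∞ g U)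
    (m : ℕ) (c : ℝ) : CoeffSmoothOn (fun x => pser m c (g x)) U := fun k => by
  simp only [coeff_pser]
  split_ifs
  · exact contDiffOn_const
  · exact contDiffOn_comp hg k
  · exact contDiffOn_const

theorem hasDerivAt_comp {n : ℕ} {g : ℝ → Fin n → ℝ} {g' : Fin n → ℝ} {x : ℝ}
    (hg : HasDerivAt g g' x) (k : ℕ) : HasDerivAt (fun y => comp (g y) k) (comp g' k) x := by
  unfold comp
  split_ifs
  · exact hasDerivAt_pi.1 hg _
  · exact hasDerivAt_const _ _

theorem HasCoeffDerivAt.pser {n : ℕ} {g : ℝ → Fin n → ℝ} {g' : Fin n → ℝ} {x : ℝ}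
    (hg : HasDerivAt g g' x) (m : ℕ) (c : ℝ) :
    HasCoeffDerivAt (fun y => pser m c (g y)) (pser m 0 g') x := fun k => by
  simp only [coeff_pser]
  split_ifs
  · exact hasDerivAt_const _ _
  · exact hasDerivAt_comp hg k
  · exact hasDerivAt_const _ _

end Calculus

/-! ### The potential -/

/-- The potential: the coefficient of `t^N` in `t 𝒱(ρ)`, completed by `(ρ₁ + a₀/4) e / 2`. The
completion is needed for the coordinates `q`, where `e = q_n²`. -/
def pot (a₀ : ℝ) (A : ℝ⟦X⟧) (N : ℕ) (e : ℝ) (ρ : ℝ⟦X⟧) : ℝ :=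
  coeff N (C (1 / 2) * (C (coeff 1 ρ) * X + C (1 / 4) * (C a₀ * X - 1)) * ρ ^ 2
    + C (1 / 8) * A * ρ⁻¹ ^ 2) + 1 / 2 * (coeff 1 ρ + a₀ / 4) * e

/-- The coefficients of `force` are the partial derivatives of `pot`. The last term of
`force` comes from the derivative of the factor `ρ₁ + a₀/4`, that is of `u`, with respect to `ρ₁`. -/
theorem hasDerivAt_pot (a₀ e : ℝ) (A ρ : ℝ⟦X⟧) (m k : ℕ) (hρ : constantCoeff ρ = 1) (hk : 1 ≤ k)
    (hkm : k ≤ m) :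
    HasDerivAt (fun ε : ℝ => pot a₀ A (m + 2) e (ρ + C ε * X ^ k))
      (coeff (m + 2 - k) (force (coeff 1 ρ + a₀ / 4) A ρ m e)) 0 := by
  have hF : HasCoeffDerivAt (fun ε : ℝ => ρ + C ε * X ^ k) (X ^ k) 0 := by
    have h := (HasCoeffDerivAt.const ρ 0).add
      ((HasCoeffDerivAt.C (hasDerivAt_id (0 : ℝ))).mul (HasCoeffDerivAt.const (X ^ k) 0))
    simpa using h
  have h0 : ρ + C (0 : ℝ) * X ^ k = ρ := by simp
  have h1 : ∀ ε : ℝ, constantCoeff (ρ + C ε * X ^ k) = 1 := by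
    intro ε
    simp [hρ, show k ≠ 0 by omega]
  have hsq := hF.sq
  have hinv := (hF.inv h1).sq
  have hlin := ((HasCoeffDerivAt.C (hF 1)).mul (HasCoeffDerivAt.const X 0)).add
    (HasCoeffDerivAt.const (C (1 / 4) * (C a₀ * X - 1)) 0)
  have hall := (((hlin.const_mul (C (1 / 2))).mul hsq).add (hinv.const_mul (C (1 / 8) * A))) (m + 2)
  have he := ((((hF 1).add_const (a₀ / 4)).const_mul (1 / 2)).mul_const e)
  simp only [h0] at hall he
  refine (hall.add he).congr_deriv ?_
  have hC : (C (1 / 2) : ℝ⟦X⟧) * 2 = 1 := by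
    rw [← map_ofNat (C : ℝ →+* ℝ⟦X⟧) 2, ← map_mul]; norm_num
  have hC8 : (C (1 / 8) : ℝ⟦X⟧) * 2 = C (1 / 4) := by
    rw [← map_ofNat (C : ℝ →+* ℝ⟦X⟧) 2, ← map_mul]; norm_num
  have hC4 : (C (1 / 4) : ℝ⟦X⟧) * C a₀ = C (a₀ / 4) := by
    rw [← map_mul]; congr 1; ring
  have key : C (1 / 2) * (C (coeff 1 (X ^ k)) * X + C (coeff 1 ρ) * 0 + 0) * ρ ^ 2
      + C (1 / 2) * (C (coeff 1 ρ) * X + C (1 / 4) * (C a₀ * X - 1)) * (2 * (ρ * X ^ k))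
      + C (1 / 8) * A * (2 * (ρ⁻¹ * -(X ^ k * ρ⁻¹ ^ 2)))
      = C (1 / 2 * coeff 1 (X ^ k : ℝ⟦X⟧)) * (X * ρ ^ 2)
        + X ^ k * ((C (coeff 1 ρ + a₀ / 4) * X - C (1 / 4)) * ρ - C (1 / 4) * A * ρ⁻¹ ^ 3) := by
    rw [map_add, map_mul, ← hC4]
    linear_combination (C (coeff 1 ρ) * X + C (1 / 4) * (C a₀ * X - 1)) * (ρ * X ^ k) * hC
      - A * ρ⁻¹ ^ 3 * X ^ k * hC8
  rw [key, map_add, coeff_C_mul, coeff_succ_X_mul, coeff_X_pow_mul', if_pos (by omega), force,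
    map_add (coeff (m + 2 - k)) (_ - _) _, coeff_C_mul, coeff_X_pow, coeff_X_pow]
  by_cases h : k = 1
  · subst h
    rw [if_pos rfl, if_pos (by omega)]
    ring
  · rw [if_neg (by omega), if_neg (by omega)]
    ring

theorem contDiffOn_pot {E : Type*} [NormedAddCommGroup E] [NormedSpace ℝ E] {U : Set E} (a₀ : ℝ)
    {A F : E → ℝ⟦X⟧} {e : E → ℝ} (N : ℕ) (hA : CoeffSmoothOn A U) (he : ContDiffOn ℝ ∞ e U)
    (hF : CoeffSmoothOn F U) (h1 : ∀ x, constantCoeff (F x) = 1) :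
    ContDiffOn ℝ ∞ (fun x => pot a₀ (A x) N (e x) (F x)) U := by
  have h2 := ((((CoeffSmoothOn.const (C (1 / 2)) U).mul
    (((CoeffSmoothOn.C (hF 1)).mul (CoeffSmoothOn.const X U)).add
      (CoeffSmoothOn.const (C (1 / 4) * (C a₀ * X - 1)) U))).mul (hF.pow 2)).add
    (((CoeffSmoothOn.const (C (1 / 8)) U).mul hA).mul ((hF.inv h1).pow 2))) N
  exact h2.add ((contDiffOn_const.mul ((hF 1).add contDiffOn_const)).mul he)

theorem coeffSmoothOn_force {E : Type*} [NormedAddCommGroup E] [NormedSpace ℝ E] {U : Set E}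
    {u e : E → ℝ} {A F : E → ℝ⟦X⟧} (m : ℕ) (hu : ContDiffOn ℝ ∞ u U) (hA : CoeffSmoothOn A U)
    (he : ContDiffOn ℝ ∞ e U) (hF : CoeffSmoothOn F U) (h1 : ∀ x, constantCoeff (F x) = 1) :
    CoeffSmoothOn (fun x => force (u x) (A x) (F x) m (e x)) U :=
  (((((CoeffSmoothOn.C hu).mul (CoeffSmoothOn.const X U)).sub
    (CoeffSmoothOn.const (C (1 / 4)) U)).mul hF).sub
    (((CoeffSmoothOn.const (C (1 / 4)) U).mul hA).mul ((hF.inv h1).pow 3))).add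
    ((CoeffSmoothOn.C (contDiffOn_const.mul (((hF.pow 2) (m + 1)).add he))).mul
      (CoeffSmoothOn.const (X ^ (m + 1)) U))

/-! ### The coordinates `r` -/

theorem X_pow_dvd_sub_iff {f g : ℝ⟦X⟧} {N : ℕ} :
    X ^ N ∣ f - g ↔ ∀ k < N, coeff k f = coeff k g := by
  simp only [X_pow_dvd_iff, map_sub, sub_eq_zero]

/-- The coefficient of `t^N` in a product depends only on the factors up to order `t^N`. -/
theorem coeff_mul_congr {f f' g g' : ℝ⟦X⟧} {N : ℕ} (hf : ∀ k ≤ N, coeff k f = coeff k f')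
    (hg : ∀ k ≤ N, coeff k g = coeff k g') : coeff N (f * g) = coeff N (f' * g') := by
  simp only [coeff_mul]
  refine Finset.sum_congr rfl fun p hp => ?_
  rw [Finset.HasAntidiagonal.mem_antidiagonal] at hp
  rw [hf p.1 (by omega), hg p.2 (by omega)]

theorem fun_eq_of_comp {n : ℕ} {x y : Fin n → ℝ} (h : ∀ k ∈ Finset.Icc 1 n, comp x k = comp y k) :
    x = y := by
  ext i
  have := h (i.val + 1) (Finset.mem_Icc.2 ⟨by omega, i.isLt⟩)
  simpa using this

/-- A square root with constant term `1` is unique, order by order. -/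
theorem coeff_eq_of_sq {f g : ℝ⟦X⟧} {N : ℕ} (hf : constantCoeff f = 1) (hg : constantCoeff g = 1)
    (h : ∀ k < N, coeff k (f ^ 2) = coeff k (g ^ 2)) : ∀ k < N, coeff k f = coeff k g := by
  rw [← X_pow_dvd_sub_iff] at h ⊢
  have hu : IsUnit (f + g) := by
    rw [isUnit_iff_constantCoeff, map_add, hf, hg]
    norm_num
  rw [sq_sub_sq] at h
  exact hu.dvd_mul_left.1 h

/-- A series that is invertible can be cancelled, order by order. -/
theorem coeff_eq_of_mul {f g h : ℝ⟦X⟧} {N : ℕ} (hf : constantCoeff f ≠ 0)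
    (hgh : ∀ k < N, coeff k (f * g) = coeff k (f * h)) : ∀ k < N, coeff k g = coeff k h := by
  rw [← X_pow_dvd_sub_iff] at hgh ⊢
  have hu : IsUnit f := by
    rw [isUnit_iff_constantCoeff]
    exact hf.isUnit
  rw [← mul_sub] at hgh
  exact hu.dvd_mul_left.1 hgh

theorem constantCoeff_pser {n : ℕ} (m : ℕ) (c : ℝ) (x : Fin n → ℝ) :
    constantCoeff (pser m c x) = c := by
  rw [← coeff_zero_eq_constantCoeff_apply]
  simp

theorem ofNat_eq_toL (k : ℕ) [k.AtLeastTwo] :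
    (OfNat.ofNat k : LaurentSeries ℝ) = toL (OfNat.ofNat k) := (map_ofNat toL k).symm

theorem comp_vOfR {n : ℕ} (r : Fin n → ℝ) {k : ℕ} (h1 : 1 ≤ k) (h2 : k ≤ n) :
    comp (vOfR r) k = coeff k (pser n 1 r ^ 2) := by
  rw [comp_eq _ h1 h2, vOfR, ser_eq, ← map_pow, Del_toL, Nat.sub_add_cancel h1]

theorem comp_vxOfR {n : ℕ} (r rx : Fin n → ℝ) {k : ℕ} (h1 : 1 ≤ k) (h2 : k ≤ n) :
    comp (vxOfR r rx) k = coeff k (2 * (pser n 1 r * pser n 0 rx)) := by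
  rw [comp_eq _ h1 h2, vxOfR, ser_eq, ser_eq, ofNat_eq_toL, ← map_mul, ← map_mul, Del_toL,
    Nat.sub_add_cancel h1]

theorem comp_vxxOfR {n : ℕ} (r rx rxx : Fin n → ℝ) {k : ℕ} (h1 : 1 ≤ k) (h2 : k ≤ n) :
    comp (vxxOfR r rx rxx) k =
      coeff k (2 * (pser n 0 rx ^ 2 + pser n 1 r * pser n 0 rxx)) := by
  rw [comp_eq _ h1 h2, vxxOfR, ser_eq, ser_eq, ser_eq, ofNat_eq_toL, ← map_mul, ← map_pow,
    ← map_add, ← map_mul, Del_toL, Nat.sub_add_cancel h1]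

theorem coeff_pser_eq {n m N : ℕ} (hN : N ≤ m) {c : ℝ} {x : Fin n → ℝ} {f : ℝ⟦X⟧}
    (h0 : constantCoeff f = c)
    (h : ∀ k, 1 ≤ k → k ≤ N → comp x k = coeff k f) :
    ∀ k < N + 1, coeff k (pser m c x) = coeff k f := by
  intro k hk
  rw [coeff_pser]
  split_ifs with h1 h2
  · rw [h1, coeff_zero_eq_constantCoeff_apply, h0]
  · exact h k (by omega) (by omega)
  · omega

theorem coeff_pser_vOfR {n : ℕ} (r : Fin n → ℝ) :
    ∀ k < n + 1, coeff k (pser n 1 (vOfR r)) = coeff k (pser n 1 r ^ 2) :=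
  coeff_pser_eq le_rfl (by simp [constantCoeff_pser]) fun _ h1 h2 => comp_vOfR r h1 h2

theorem coeff_pser_vxOfR {n : ℕ} (r rx : Fin n → ℝ) :
    ∀ k < n + 1, coeff k (pser n 0 (vxOfR r rx)) = coeff k (2 * (pser n 1 r * pser n 0 rx)) :=
  coeff_pser_eq le_rfl (by simp [constantCoeff_pser]) fun _ h1 h2 => comp_vxOfR r rx h1 h2

theorem coeff_pser_vxxOfR {n : ℕ} (r rx rxx : Fin n → ℝ) :
    ∀ k < n + 1, coeff k (pser n 0 (vxxOfR r rx rxx)) =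
      coeff k (2 * (pser n 0 rx ^ 2 + pser n 1 r * pser n 0 rxx)) :=
  coeff_pser_eq le_rfl (by simp [constantCoeff_pser]) fun _ h1 h2 => comp_vxxOfR r rx rxx h1 h2

/-- The square root of `v(λ)` with constant term `1`. -/
def sqrtSer {n : ℕ} (v : Fin n → ℝ) : ℝ⟦X⟧ := PowerSeries.mk (sqrtCoeff fun k => coeff k (pser n 1 v))

theorem sqrtSer_sq {n : ℕ} (v : Fin n → ℝ) : sqrtSer v ^ 2 = pser n 1 v := by
  rw [sqrtSer, sqrtCoeff_sq _ (by simp)]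
  ext k
  rw [coeff_mk]

theorem constantCoeff_sqrtSer {n : ℕ} (v : Fin n → ℝ) : constantCoeff (sqrtSer v) = 1 := by
  rw [sqrtSer, ← coeff_zero_eq_constantCoeff_apply, coeff_mk, sqrtCoeff]

theorem comp_rCoord {n : ℕ} (v : Fin n → ℝ) {k : ℕ} (h1 : 1 ≤ k) (h2 : k ≤ n) :
    comp (rCoord v) k = coeff k (sqrtSer v) := by
  rw [comp_eq _ h1 h2, rCoord, sqrtSer, coeff_mk, ser_eq]
  simp only [toL_coeff, Nat.sub_add_cancel h1]

theorem coeff_pser_rCoord {n : ℕ} (v : Fin n → ℝ) :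
    ∀ k < n + 1, coeff k (pser n 1 (rCoord v)) = coeff k (sqrtSer v) :=
  coeff_pser_eq le_rfl (constantCoeff_sqrtSer v) fun _ h1 h2 => comp_rCoord v h1 h2

theorem vOfR_rCoord {n : ℕ} (v : Fin n → ℝ) : vOfR (rCoord v) = v := by
  refine fun_eq_of_comp fun k hk => ?_
  rw [Finset.mem_Icc] at hk
  rw [comp_vOfR _ hk.1 hk.2, pow_two, coeff_mul_congr (f' := sqrtSer v) (g' := sqrtSer v),
    ← pow_two, sqrtSer_sq, coeff_pser, if_neg (by omega), if_pos hk.2]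
  · exact fun j hj => coeff_pser_rCoord v j (by omega)
  · exact fun j hj => coeff_pser_rCoord v j (by omega)

theorem rCoord_vOfR {n : ℕ} (r : Fin n → ℝ) : rCoord (vOfR r) = r := by
  refine fun_eq_of_comp fun k hk => ?_
  rw [Finset.mem_Icc] at hk
  rw [comp_rCoord _ hk.1 hk.2, coeff_eq_of_sq (N := n + 1) (constantCoeff_sqrtSer _)
    (constantCoeff_pser n 1 r) _ k (by omega), coeff_pser, if_neg (by omega), if_pos hk.2]
  intro j hj
  rw [sqrtSer_sq, coeff_pser_vOfR r j hj]

theorem uOf_vOfR {n : ℕ} (hn : 1 ≤ n) (a : ℕ → ℝ) (r : Fin n → ℝ) :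
    uOf a (vOfR r) = coeff 1 (pser n 1 r) + a 0 / 4 := by
  rw [uOf, comp_vOfR r le_rfl hn, pow_two, coeff_one_mul, constantCoeff_pser]
  ring

/-! ### The Hamiltonian in the coordinates `(r, s)` -/

/-- The coefficients of `𝓗` are kinetic energy plus `pot`; the factor `t` shifts the index of the
latter. -/
theorem scrH_eq (a₀ : ℝ) (A w z : ℝ⟦X⟧) (hw : constantCoeff w = 1) (N : ℕ) :
    Del (-(N : ℤ)) (scrH a₀ (lam * toL A) (toL w) (toL z)) =
      1 / 2 * coeff N (z ^ 2) + pot a₀ A (N + 1) 0 w := by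
  have hWI : toL w * toL w⁻¹ = 1 := by
    rw [← map_mul, PowerSeries.mul_inv_cancel _ (by rw [hw]; norm_num), map_one]
  have hW : toL w ≠ 0 := left_ne_zero_of_mul (a := toL w) (b := toL w⁻¹) (by rw [hWI]; exact one_ne_zero)
  have h8 : toL (C (1 / 8)) * 8 = 1 := by
    rw [ofNat_eq_toL, ← map_mul, ← map_ofNat (C : ℝ →+* ℝ⟦X⟧) 8, ← map_mul]
    norm_num
  have hdiv : lam * toL A / (8 * toL w ^ 2) = lam * toL (C (1 / 8) * A * w⁻¹ ^ 2) := by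
    have h8' : (8 : LaurentSeries ℝ) ≠ 0 := right_ne_zero_of_mul (by rw [h8]; exact one_ne_zero)
    rw [div_eq_iff (mul_ne_zero h8' (pow_ne_zero 2 hW))]
    simp only [map_mul, map_pow]
    generalize toL w⁻¹ = I at *
    linear_combination (-(lam * toL A * (toL w * I) ^ 2)) * h8
      - lam * toL A * (toL w * I + 1) * hWI
  have hD : Del (-1) (toL w) = coeff 1 w := by exact_mod_cast Del_toL w 1
  have h : scrH a₀ (lam * toL A) (toL w) (toL z) = lam * toL (X * (C (1 / 2) * z ^ 2)
      + (C (1 / 2) * (C (coeff 1 w) * X + C (1 / 4) * (C a₀ * X - 1)) * w ^ 2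
        + C (1 / 8) * A * w⁻¹ ^ 2)) := by
    rw [scrH, hdiv, hD]
    simp only [cst_eq, map_add, map_mul, map_sub, map_pow, map_one]
    linear_combination (-(toL (C (1 / 2)) * toL z ^ 2 + toL (C (1 / 2)) * (toL (C (coeff 1 w))
      + toL (C (1 / 4)) * toL (C a₀)) * toL w ^ 2)) * lam_mul_X
  rw [h, Del_lam_toL, map_add, coeff_succ_X_mul, coeff_C_mul, pot, mul_zero, add_zero]

theorem scrL_eq (a₀ : ℝ) (A w z : ℝ⟦X⟧) (hw : constantCoeff w = 1) (N : ℕ) :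
    Del (-(N : ℤ)) (scrL a₀ (lam * toL A) (toL w) (toL z)) =
      1 / 2 * coeff N (z ^ 2) - pot a₀ A (N + 1) 0 w := by
  have h : scrL a₀ (lam * toL A) (toL w) (toL z) =
      toL (C 1 * z ^ 2) - scrH a₀ (lam * toL A) (toL w) (toL z) := by
    have hC : toL (C (1 / 2)) + toL (C (1 / 2)) = toL (C 1) := by
      rw [← map_add, ← map_add]
      norm_num
    rw [scrL, scrH, map_mul, ← hC, map_pow, cst_eq]
    ring
  have hs : ∀ f g : LaurentSeries ℝ, Del (-(N : ℤ)) (f - g) = Del (-(N : ℤ)) f - Del (-(N : ℤ)) g := by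
    intro f g
    simp [Del]
  rw [h, hs, Del_toL, scrH_eq a₀ A w z hw, coeff_C_mul]
  ring

/-- `t a(λ)` in `L_n^{(0)}` and `H_n^{(0)}`, where `a_n = α`. -/
def aPow0 (a : ℕ → ℝ) (n : ℕ) (α : ℝ) : ℝ⟦X⟧ := aPow a n + C α * X ^ (n + 1)

theorem aSer_add_single (a : ℕ → ℝ) (n : ℕ) (α : ℝ) :
    aSer a n + HahnSeries.single (n : ℤ) α = lam * toL (aPow0 a n α) := by
  rw [aSer_eq, single_natCast, aPow0, map_add, pow_succ, map_mul, map_mul, map_mul]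
  linear_combination (-(toL (C α) * toL (X ^ n))) * lam_mul_X

theorem H0_eq (n : ℕ) (a : ℕ → ℝ) (α : ℝ) (r s : Fin n → ℝ) :
    H0 n a α r s = 1 / 2 * coeff (n + 1) (pser n 0 s ^ 2)
      + pot (a 0) (aPow0 a n α) (n + 2) 0 (pser n 1 r) := by
  rw [H0, aSer_add_single, ser_eq, ser_eq, scrH_eq _ _ _ _ (constantCoeff_pser _ _ _)]

theorem L0_eq (n : ℕ) (a : ℕ → ℝ) (α : ℝ) (r s : Fin n → ℝ) :
    L0 n a α r s = 1 / 2 * coeff (n + 1) (pser n 0 s ^ 2)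
      - pot (a 0) (aPow0 a n α) (n + 2) 0 (pser n 1 r) := by
  rw [L0, aSer_add_single, ser_eq, ser_eq, scrL_eq _ _ _ _ (constantCoeff_pser _ _ _)]

/-- The force in the coordinates `r`. -/
def force0 (n : ℕ) (a : ℕ → ℝ) (α : ℝ) (r : Fin n → ℝ) : ℝ⟦X⟧ :=
  force (coeff 1 (pser n 1 r) + a 0 / 4) (aPow0 a n α) (pser n 1 r) n 0

section Smoothness

variable {E : Type*} [NormedAddCommGroup E] [NormedSpace ℝ E]

theorem coeffSmoothOn_aPow0 (a : ℕ → ℝ) (n : ℕ) {α : E → ℝ} {U : Set E} (hα : ContDiffOn ℝ ∞ α U) :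
    CoeffSmoothOn (fun x => aPow0 a n (α x)) U :=
  (CoeffSmoothOn.const _ U).add ((CoeffSmoothOn.C hα).mul (CoeffSmoothOn.const _ U))

theorem coeffSmoothOn_force0 (n : ℕ) (a : ℕ → ℝ) {α : E → ℝ} {r : E → Fin n → ℝ} {U : Set E}
    (hα : ContDiffOn ℝ ∞ α U) (hr : ContDiffOn ℝ ∞ r U) :
    CoeffSmoothOn (fun x => force0 n a (α x) (r x)) U :=
  coeffSmoothOn_force n ((CoeffSmoothOn.pser hr n 1 1).add contDiffOn_const)
    (coeffSmoothOn_aPow0 a n hα) contDiffOn_const (CoeffSmoothOn.pser hr n 1)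
    fun _ => constantCoeff_pser _ _ _

theorem contDiffOn_pot0 (n : ℕ) (a : ℕ → ℝ) {α : E → ℝ} {r : E → Fin n → ℝ} {U : Set E}
    (hα : ContDiffOn ℝ ∞ α U) (hr : ContDiffOn ℝ ∞ r U) :
    ContDiffOn ℝ ∞ (fun x => pot (a 0) (aPow0 a n (α x)) (n + 2) 0 (pser n 1 (r x))) U :=
  contDiffOn_pot _ _ (coeffSmoothOn_aPow0 a n hα) contDiffOn_const (CoeffSmoothOn.pser hr n 1)
    fun _ => constantCoeff_pser _ _ _

end Smoothness

theorem pd_pot0 (n : ℕ) (a : ℕ → ℝ) (α : ℝ) (r : Fin n → ℝ) (i : Fin n) :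
    pd (fun y => pot (a 0) (aPow0 a n α) (n + 2) 0 (pser n 1 y)) r i =
      coeff (n + 1 - i.val) (force0 n a α r) := by
  refine pd_eq ?_ ?_
  · exact ((contDiffOn_univ.1 (contDiffOn_pot0 n a contDiffOn_const contDiffOn_id)).differentiable
      (by simp)).differentiableAt
  · have h := hasDerivAt_pot (a 0) 0 (aPow0 a n α) (pser n 1 r) n (i.val + 1)
      (constantCoeff_pser _ _ _) (by omega) i.isLt
    rw [show n + 2 - (i.val + 1) = n + 1 - i.val by omega] at h
    refine h.congr_of_eventuallyEq (Filter.Eventually.of_forall fun ε => ?_)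
    simp only [pser_add_single n 1 ε r i i.isLt]

/-- The differential of the kinetic energy `∑ w_i w_{N-i} / 2`. -/
theorem hasDerivAt_kinetic (N : ℕ) (f : ℝ⟦X⟧) {k : ℕ} (hk : k ≤ N) :
    HasDerivAt (fun ε : ℝ => 1 / 2 * coeff N ((f + C ε * X ^ k) ^ 2)) (coeff (N - k) f) 0 := by
  have hF : HasCoeffDerivAt (fun ε : ℝ => f + C ε * X ^ k) (X ^ k) 0 := by
    have h := (HasCoeffDerivAt.const f 0).add
      ((HasCoeffDerivAt.C (hasDerivAt_id (0 : ℝ))).mul (HasCoeffDerivAt.const (X ^ k) 0))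
    simpa using h
  refine ((hF.sq N).const_mul (1 / 2)).congr_deriv ?_
  have : (2 : ℝ⟦X⟧) * ((f + C 0 * X ^ k) * X ^ k) = C 2 * (X ^ k * f) := by
    rw [map_ofNat C 2, map_zero]
    ring
  rw [this, coeff_C_mul, coeff_X_pow_mul', if_pos hk]
  ring

theorem contDiff_kinetic (n m N : ℕ) :
    ContDiff ℝ ∞ (fun w : Fin n → ℝ => 1 / 2 * coeff N (pser m 0 w ^ 2)) :=
  contDiff_const.mul (contDiffOn_univ.1
    ((CoeffSmoothOn.pser (contDiffOn_id (s := univ)) m 0).pow 2 N))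

theorem pd_kinetic0 (n : ℕ) (w : Fin n → ℝ) (i : Fin n) :
    pd (fun w : Fin n → ℝ => 1 / 2 * coeff (n + 1) (pser n 0 w ^ 2)) w i = mom0 w i := by
  refine pd_eq ((contDiff_kinetic n n (n + 1)).differentiable (by simp)).differentiableAt ?_
  have h := hasDerivAt_kinetic (n + 1) (pser n 0 w) (k := i.val + 1) (by omega)
  refine (h.congr_of_eventuallyEq (Filter.Eventually.of_forall fun ε => ?_)).congr_deriv ?_
  · simp only [pser_add_single n 0 ε w i i.isLt]
  · rw [coeff_pser, if_neg (by omega), if_pos (by omega), mom0, ← comp_succ w i.rev, Fin.val_rev]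
    congr 1
    omega

theorem pd_const_add {n : ℕ} (c : ℝ) (f : (Fin n → ℝ) → ℝ) (x : Fin n → ℝ) (i : Fin n) :
    pd (fun y => c + f y) x i = pd f x i := by
  rw [pd, pd, fderiv_const_add]

theorem pd_const_sub {n : ℕ} (c : ℝ) (f : (Fin n → ℝ) → ℝ) (x : Fin n → ℝ) (i : Fin n) :
    pd (fun y => c - f y) x i = -pd f x i := by
  rw [pd, pd, fderiv_const_sub]
  rfl

theorem pd_add_const {n : ℕ} (c : ℝ) (f : (Fin n → ℝ) → ℝ) (x : Fin n → ℝ) (i : Fin n) :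
    pd (fun y => f y + c) x i = pd f x i := by
  rw [pd, pd, fderiv_add_const]

theorem pd_sub_const {n : ℕ} (c : ℝ) (f : (Fin n → ℝ) → ℝ) (x : Fin n → ℝ) (i : Fin n) :
    pd (fun y => f y - c) x i = pd f x i := by
  rw [pd, pd, fderiv_sub_const]

theorem pd_H0_fst (n : ℕ) (a : ℕ → ℝ) (α : ℝ) (r s : Fin n → ℝ) (i : Fin n) :
    pd (fun y => H0 n a α y s) r i = coeff (n + 1 - i.val) (force0 n a α r) := by
  simp only [H0_eq]
  rw [pd_const_add, pd_pot0]

theorem pd_H0_snd (n : ℕ) (a : ℕ → ℝ) (α : ℝ) (r s : Fin n → ℝ) (i : Fin n) :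
    pd (H0 n a α r) s i = mom0 s i := by
  have : H0 n a α r = fun s => 1 / 2 * coeff (n + 1) (pser n 0 s ^ 2)
      + pot (a 0) (aPow0 a n α) (n + 2) 0 (pser n 1 r) := funext fun s => H0_eq n a α r s
  rw [this, pd_add_const, pd_kinetic0]

theorem pd_L0_fst (n : ℕ) (a : ℕ → ℝ) (α : ℝ) (r w : Fin n → ℝ) (i : Fin n) :
    pd (fun y => L0 n a α y w) r i = -coeff (n + 1 - i.val) (force0 n a α r) := by
  simp only [L0_eq]
  rw [pd_const_sub, pd_pot0]

theorem pd_L0_snd (n : ℕ) (a : ℕ → ℝ) (α : ℝ) (r w : Fin n → ℝ) (i : Fin n) :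
    pd (L0 n a α r) w i = mom0 w i := by
  have : L0 n a α r = fun s => 1 / 2 * coeff (n + 1) (pser n 0 s ^ 2)
      - pot (a 0) (aPow0 a n α) (n + 2) 0 (pser n 1 r) := funext fun s => L0_eq n a α r s
  rw [this, pd_sub_const, pd_kinetic0]

theorem mom0_mom0 {n : ℕ} (w : Fin n → ℝ) : mom0 (mom0 w) = w := by
  ext i
  simp [mom0]

/-- `r_{xx}` on the solutions of the canonical equations of `H_n^{(0)}`. -/
def accel0 (n : ℕ) (a : ℕ → ℝ) (α : ℝ) (r s : Fin n → ℝ) : Fin n → ℝ :=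
  mom0 fun k => -pd (fun y => H0 n a α y s) r k

theorem accel0_apply (n : ℕ) (a : ℕ → ℝ) (α : ℝ) (r s : Fin n → ℝ) (i : Fin n) :
    accel0 n a α r s i = -coeff (i.val + 2) (force0 n a α r) := by
  rw [accel0, mom0, pd_H0_fst, Fin.val_rev,
    show n + 1 - (n - (i.val + 1)) = i.val + 2 by have := i.isLt; omega]

/-- `t B^λ(v, v)` at a jet of `v`. -/
def genBv {n : ℕ} (a : ℕ → ℝ) (v vx vxx : Fin n → ℝ) : ℝ⟦X⟧ :=
  genB (uOf a v) (pser n 1 v) (pser n 0 vx) (pser n 0 vxx)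

theorem coeff_aPow0 (a : ℕ → ℝ) (n : ℕ) (α : ℝ) {k : ℕ} (hk : k ≤ n) :
    coeff (k + 1) (aPow0 a n α) = if k = n then α else a k := by
  rw [aPow0, map_add, coeff_C_mul, coeff_X_pow, coeff_aPow, if_neg (by omega)]
  split_ifs <;> first | omega | simp

/-- The jets at which the equations of the `P₀`-system hold. They prescribe the coefficients of
`λ^{-1}, …, λ^{-n}` in `B^λ(v, v)`; those of `λ` and `1` are `-1` and `a₀` automatically. -/
def IsP0Jet {n : ℕ} (a : ℕ → ℝ) (α : ℝ) (v vx vxx : Fin n → ℝ) : Prop :=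
  ∀ k ∈ Finset.Icc 1 n, coeff (k + 1) (genBv a v vx vxx) = if k = n then α else a k

/-- In the coordinates `r` the `P₀`-equations are solved for `r_{xx}`. -/
theorem isP0Jet_iff {n : ℕ} (hn : 1 ≤ n) (a : ℕ → ℝ) (α : ℝ) (r rx rxx : Fin n → ℝ) :
    IsP0Jet a α (vOfR r) (vxOfR r rx) (vxxOfR r rx rxx) ↔
      ∀ i : Fin n, rxx i = -coeff (i.val + 2) (force0 n a α r) := by
  have h := genB_coeff_iff n hn (a 0) 0 (aPow0 a n α) (pser n 1 r) (pser n 0 rx) (pser n 0 rxx)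
    (pser n 1 (vOfR r)) (pser n 0 (vxOfR r rx)) (pser n 0 (vxxOfR r rx rxx))
    (by simp) (by simp) (by simp)
    (by rw [aPow0, map_add, coeff_C_mul, coeff_X_pow, coeff_aPow]; simp)
    (by rw [coeff_aPow0 a n α (Nat.zero_le n), if_neg (by omega)])
    (X_pow_dvd_sub_iff.2 (coeff_pser_vOfR r)) (X_pow_dvd_sub_iff.2 (coeff_pser_vxOfR r rx))
    (X_pow_dvd_sub_iff.2 (coeff_pser_vxxOfR r rx rxx)) (by simp)
  rw [← uOf_vOfR hn] at h
  have h1 : IsP0Jet a α (vOfR r) (vxOfR r rx) (vxxOfR r rx rxx) ↔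
      ∀ k ∈ Finset.Icc 1 n, coeff (k + 1) (genB (uOf a (vOfR r)) (pser n 1 (vOfR r))
        (pser n 0 (vxOfR r rx)) (pser n 0 (vxxOfR r rx rxx))) = coeff (k + 1) (aPow0 a n α) := by
    refine forall₂_congr fun k hk => ?_
    rw [coeff_aPow0 a n α (Finset.mem_Icc.1 hk).2, genBv]
  rw [h1, h, uOf_vOfR hn]
  constructor
  · intro h i
    have := h (i.val + 1) (Finset.mem_Icc.2 ⟨by omega, i.isLt⟩)
    rw [map_add, coeff_succ_X_mul, coeff_pser, if_neg (by omega),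
      if_pos (show i.val + 1 ≤ n from i.isLt), comp_succ] at this
    rw [force0]
    linarith
  · intro h k hk
    rw [Finset.mem_Icc] at hk
    have := h ⟨k - 1, by omega⟩
    rw [map_add, coeff_succ_X_mul, coeff_pser, if_neg (by omega), if_pos hk.2,
      comp_eq _ hk.1 hk.2, this, force0]
    simp only
    rw [show k - 1 + 2 = k + 1 by omega]
    ring

theorem isP0Jet_accel0 {n : ℕ} (hn : 1 ≤ n) (a : ℕ → ℝ) (α : ℝ) (r s rx : Fin n → ℝ) :
    IsP0Jet a α (vOfR r) (vxOfR r rx) (vxxOfR r rx (accel0 n a α r s)) :=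
  (isP0Jet_iff hn a α r rx _).2 fun i => accel0_apply n a α r s i

theorem redY_eq (n : ℕ) (a : ℕ → ℝ) (α : ℝ) (j : ℕ) (r s : Fin n → ℝ) :
    redY n a α j r s = (-1 / 8) * coeff (j + n + 1) (genBv a (vOfR r) (vxOfR r (mom0 s))
      (vxxOfR r (mom0 s) (accel0 n a α r s))) := by
  rw [redY, genBv, ← gd_top]
  rfl

/-! ### Mechanical systems -/

/-- For a Lagrangian whose momenta are a permutation `σ` of the velocities and whose force is `-F`,
the Euler--Lagrange equations and the canonical equations of the corresponding Hamiltonian both say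
`q_{xx} = -F(q)`, up to the permutation. -/
theorem mechanics_iff {n : ℕ} {L H : (Fin n → ℝ) → (Fin n → ℝ) → ℝ} {mom : (Fin n → ℝ) → Fin n → ℝ}
    {σ : Fin n → Fin n} (hσ : ∀ w k, mom w k = w (σ k)) (hmom : ∀ w, mom (mom w) = w)
    {F : (Fin n → ℝ) → Fin n → ℝ} {U : Set (Fin n → ℝ)}
    (hL1 : ∀ q ∈ U, ∀ w k, pd (fun y => L y w) q k = -F q k)
    (hL2 : ∀ q w k, pd (L q) w k = mom w k)
    (hH1 : ∀ q ∈ U, ∀ p k, pd (fun y => H y p) q k = F q k)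
    (hH2 : ∀ q p k, pd (H q) p k = mom p k)
    {I : Set ℝ} (hI : IsOpen I) {q : ℝ → Fin n → ℝ} (hq : ContDiffOn ℝ 2 q I)
    (hqU : ∀ x ∈ I, q x ∈ U) :
    (EulerLagrange L I q ↔ ∀ x ∈ I, ∀ k, deriv (deriv q) x k = -mom (F (q x)) k) ∧
    (HamiltonEqs H I q (fun x => mom (deriv q x)) ↔
      ∀ x ∈ I, ∀ k, deriv (deriv q) x k = -mom (F (q x)) k) := by
  have hd1 : ∀ x ∈ I, HasDerivAt q (deriv q x) x := fun x hx =>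
    ((hq.differentiableOn (by norm_num)).differentiableAt (hI.mem_nhds hx)).hasDerivAt
  have hq' : ContDiffOn ℝ 1 (deriv q) I := hq.deriv_of_isOpen hI (by norm_num)
  have hd2 : ∀ x ∈ I, HasDerivAt (deriv q) (deriv (deriv q) x) x := fun x hx =>
    ((hq'.differentiableOn (by norm_num)).differentiableAt (hI.mem_nhds hx)).hasDerivAt
  have hd3 : ∀ x ∈ I, HasDerivAt (fun x => mom (deriv q x)) (mom (deriv (deriv q) x)) x := by
    intro x hx
    rw [hasDerivAt_pi]
    intro k
    simp only [hσ]
    exact hasDerivAt_pi.1 (hd2 x hx) (σ k)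
  have hswap : ∀ v w : Fin n → ℝ, (∀ k, v k = -mom w k) ↔ ∀ k, mom v k = -w k := by
    intro v w
    constructor
    · intro h k
      rw [hσ, h, ← hσ (mom w), hmom]
    · intro h k
      rw [← congrFun (hmom v) k, hσ (mom v), h, hσ]
  refine ⟨forall₂_congr fun x hx => ?_, ?_⟩
  · rw [hswap]
    refine forall_congr' fun k => ?_
    rw [hL1 _ (hqU x hx)]
    simp only [hL2]
    rw [(hasDerivAt_pi.1 (hd3 x hx) k).deriv]
    constructor <;> intro h <;> linarith
  · refine forall₂_congr fun x hx => ?_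
    rw [hswap]
    have h1 : (fun k => pd (H (q x)) (mom (deriv q x)) k) = deriv q x := by
      simp only [hH2, hmom]
    have h2 : (fun k => -pd (fun y => H y (mom (deriv q x))) (q x) k) = fun k => -F (q x) k := by
      simp only [hH1 _ (hqU x hx)]
    rw [h1, h2]
    constructor
    · rintro ⟨-, h⟩ k
      exact congrFun ((hd3 x hx).unique h) k
    · intro h
      refine ⟨hd1 x hx, ?_⟩
      rw [← funext h]
      exact hd3 x hx

/-! ### Conservation of the Gelfand--Dickey polynomials -/

theorem coeff_zero_genBv {n : ℕ} (a : ℕ → ℝ) (v vx vxx : Fin n → ℝ) :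
    coeff 0 (genBv a v vx vxx) = -1 := by
  rw [coeff_zero_eq_constantCoeff_apply, genBv, genB]
  simp [constantCoeff_pser]

theorem coeff_one_genBv {n : ℕ} (hn : 1 ≤ n) (a : ℕ → ℝ) (v vx vxx : Fin n → ℝ) :
    coeff 1 (genBv a v vx vxx) = a 0 := by
  rw [genBv, genB, map_add, sub_mul, map_sub, mul_assoc, mul_assoc]
  simp only [one_mul, coeff_C_mul, pow_two, coeff_one_mul]
  simp [constantCoeff_pser, uOf, hn]
  ring

theorem IsP0Jet.coeff_eq {n : ℕ} (hn : 1 ≤ n) {a : ℕ → ℝ} {α : ℝ} {v vx vxx : Fin n → ℝ}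
    (h : IsP0Jet a α v vx vxx) {k : ℕ} (hk : k ≤ n + 1) :
    coeff k (genBv a v vx vxx) = coeff k (aPow0 a n α) := by
  cases k with
  | zero =>
    rw [coeff_zero_genBv, aPow0, map_add, coeff_C_mul, coeff_X_pow, coeff_aPow]
    simp
  | succ k =>
    rw [coeff_aPow0 a n α (by omega)]
    rcases Nat.eq_zero_or_pos k with rfl | h0
    · rw [zero_add, coeff_one_genBv hn, if_neg (by omega)]
    · exact h k (Finset.mem_Icc.2 ⟨h0, by omega⟩)

theorem hasDerivAt_uOf {n : ℕ} (a : ℕ → ℝ) {v : ℝ → Fin n → ℝ} {v' : Fin n → ℝ} {x : ℝ}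
    (hv : HasDerivAt v v' x) : HasDerivAt (fun y => uOf a (v y)) (comp v' 1 / 2) x :=
  ((hasDerivAt_comp hv 1).div_const 2).add_const _

/-- `d/dx B^λ(v, v) = 2 v (v_{xxx} + (4u - λ) v_x + 2 u_x v)`. -/
theorem hasCoeffDerivAt_genBv {n : ℕ} (a : ℕ → ℝ) {v vx vxx : ℝ → Fin n → ℝ} {vxxx : Fin n → ℝ}
    {x : ℝ} (hv : HasDerivAt v (vx x) x) (hvx : HasDerivAt vx (vxx x) x)
    (hvxx : HasDerivAt vxx vxxx x) :
    HasCoeffDerivAt (fun y => genBv a (v y) (vx y) (vxx y))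
      (C 2 * pser n 1 (v x) * (X * pser n 0 vxxx + (C (4 * uOf a (v x)) * X - 1) * pser n 0 (vx x)
        + C (comp (vx x) 1) * X * pser n 1 (v x))) x := by
  have h1 := HasCoeffDerivAt.pser hv n 1
  have h2 := HasCoeffDerivAt.pser hvx n 0
  have h3 := HasCoeffDerivAt.pser hvxx n 0
  have hu := HasCoeffDerivAt.C ((hasDerivAt_uOf a hv).const_mul 4)
  have h := (((((h1.const_mul 2).mul h3).sub h2.sq).const_mul X)).add
    (((hu.mul (HasCoeffDerivAt.const X x)).sub (HasCoeffDerivAt.const 1 x)).mul h1.sq)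
  have e : C (4 * (comp (vx x) 1 / 2)) = C 2 * C (comp (vx x) 1) := by
    rw [← map_mul]
    congr 1
    ring
  have h' : HasCoeffDerivAt (fun y => genBv a (v y) (vx y) (vxx y)) _ x := h
  convert h' using 1
  rw [e, map_ofNat]
  ring

/-- If along a curve, to first order at a point, the coefficients of `B^λ(v, v)` up to that of
`λ^{-n}` are constant, or all but the last of these and that of `λ^{-2n}` while `v_n ≠ 0`, then so
are all. -/
theorem hasDerivAt_coeff_genBv_zero {n : ℕ} (a : ℕ → ℝ) {v vx vxx : ℝ → Fin n → ℝ} {x : ℝ}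
    (hv : HasDerivAt v (vx x) x) (hvx : HasDerivAt vx (vxx x) x) (hvxx : DifferentiableAt ℝ vxx x)
    (hlow : ∀ k ≤ n, HasDerivAt (fun y => coeff k (genBv a (v y) (vx y) (vxx y))) 0 x)
    (htop : HasDerivAt (fun y => coeff (n + 1) (genBv a (v y) (vx y) (vxx y))) 0 x ∨
      comp (v x) n ≠ 0 ∧
        HasDerivAt (fun y => coeff (2 * n + 1) (genBv a (v y) (vx y) (vxx y))) 0 x) (k : ℕ) :
    HasDerivAt (fun y => coeff k (genBv a (v y) (vx y) (vxx y))) 0 x := by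
  have hder := hasCoeffDerivAt_genBv a hv hvx hvxx.hasDerivAt
  set f := pser n 1 (v x)
  -- the derivative of `t B^λ(v, v)` is `2 v Q`, where `Q` has no terms beyond `t^{n+1}`
  set Q := X * pser n 0 (deriv vxx x) + (C (4 * uOf a (v x)) * X - 1) * pser n 0 (vx x)
    + C (comp (vx x) 1) * X * pser n 1 (v x) with hQ
  have hzero : ∀ j, HasDerivAt (fun y => coeff j (genBv a (v y) (vx y) (vxx y))) 0 x →
      coeff j (C 2 * f * Q) = 0 := fun j hj => (hder j).unique hj
  have hf0 : constantCoeff (C 2 * f) ≠ 0 := by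
    simp [f, constantCoeff_pser]
  have hQlow : ∀ j < n + 1, coeff j Q = 0 := by
    have := coeff_eq_of_mul (N := n + 1) (g := Q) (h := 0) hf0
      (fun j hj => by rw [hzero j (hlow j (by omega)), mul_zero, map_zero])
    intro j hj
    rw [this j hj, map_zero]
  have hQhigh : ∀ j, n + 1 < j → coeff j Q = 0 := by
    intro j hj
    obtain ⟨i, rfl⟩ : ∃ i, j = i + 1 := ⟨j - 1, by omega⟩
    rw [hQ, map_add, map_add, coeff_succ_X_mul, sub_mul, map_sub, mul_assoc, mul_assoc, coeff_C_mul,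
      coeff_C_mul, coeff_succ_X_mul, coeff_succ_X_mul]
    simp [show i ≠ 0 by omega, show ¬ i ≤ n by omega, show ¬ i + 1 ≤ n by omega]
  have hQn : coeff (n + 1) Q = 0 := by
    rcases htop with h | ⟨hvn, h⟩
    · have := hzero (n + 1) h
      have h2 := coeff_eq_of_mul (N := n + 2) (g := Q) (h := 0) hf0
        (fun j hj => by
          rcases Nat.lt_succ_iff_lt_or_eq.1 hj with h' | rfl
          · rw [hzero j (hlow j (by omega))]; simp
          · rw [this]; simp)
      rw [h2 (n + 1) (by omega), map_zero]
    · have h2 : Q = C (coeff (n + 1) Q) * X ^ (n + 1) := by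
        ext j
        rw [coeff_C_mul, coeff_X_pow]
        rcases lt_trichotomy j (n + 1) with h' | h' | h'
        · rw [hQlow j h', if_neg (by omega), mul_zero]
        · rw [if_pos h', h', mul_one]
        · rw [hQhigh j h', if_neg (by omega), mul_zero]
      have h3 := hzero _ h
      have h4 : C 2 * f * Q = C (2 * coeff (n + 1) Q) * (X ^ (n + 1) * f) := by
        conv_lhs => rw [h2]
        rw [map_mul]
        ring
      rw [h4, coeff_C_mul, coeff_X_pow_mul', if_pos (by omega),
        show 2 * n + 1 - (n + 1) = n by omega] at h3
      have h5 : coeff n f ≠ 0 := by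
        rcases Nat.eq_zero_or_pos n with h0 | h0
        · subst h0
          exact absurd (by simp [comp]) hvn
        · simp only [f, coeff_pser]
          rw [if_neg (by omega), if_pos le_rfl]
          exact hvn
      rcases mul_eq_zero.1 h3 with h6 | h6
      · linarith
      · exact absurd h6 h5
  have := hder k
  have hQ0 : Q = 0 := by
    ext j
    rcases lt_trichotomy j (n + 1) with h' | h' | h'
    · simpa using hQlow j h'
    · simpa [h'] using hQn
    · simpa using hQhigh j h'
  rw [hQ0, mul_zero, map_zero] at this
  exact this

/-- If the coefficients of `B^λ(v, v)` up to that of `λ^{-n}` are constant along a curve, or all but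
the last of these and that of `λ^{-2n}` while `v_n ≠ 0`, then so are all. -/
theorem exists_eq_of_genBv {n : ℕ} (a : ℕ → ℝ) {I : Set ℝ} (hI : IsOpen I) (hc : IsPreconnected I)
    {v vx vxx : ℝ → Fin n → ℝ} (hv : ∀ x ∈ I, HasDerivAt v (vx x) x)
    (hvx : ∀ x ∈ I, HasDerivAt vx (vxx x) x) (hvxx : ∀ x ∈ I, DifferentiableAt ℝ vxx x)
    (hlow : ∀ k ≤ n, ∃ c, ∀ x ∈ I, coeff k (genBv a (v x) (vx x) (vxx x)) = c)
    (htop : (∃ c, ∀ x ∈ I, coeff (n + 1) (genBv a (v x) (vx x) (vxx x)) = c) ∨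
      (∀ x ∈ I, comp (v x) n ≠ 0) ∧
        ∃ c, ∀ x ∈ I, coeff (2 * n + 1) (genBv a (v x) (vx x) (vxx x)) = c) (k : ℕ) :
    ∃ c, ∀ x ∈ I, coeff k (genBv a (v x) (vx x) (vxx x)) = c := by
  have hzero : ∀ j, (∃ c, ∀ x ∈ I, coeff j (genBv a (v x) (vx x) (vxx x)) = c) →
      ∀ x ∈ I, HasDerivAt (fun y => coeff j (genBv a (v y) (vx y) (vxx y))) 0 x := by
    rintro j ⟨c, hc⟩ x hx
    refine (hasDerivAt_const x c).congr_of_eventuallyEq ?_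
    filter_upwards [hI.mem_nhds hx] with y hy using hc y hy
  have hd := fun x hx => hasDerivAt_coeff_genBv_zero a (hv x hx) (hvx x hx) (hvxx x hx)
    (fun k hk => hzero k (hlow k hk) x hx)
    (htop.imp (fun h => hzero _ h x hx) fun h => ⟨h.1 x hx, hzero _ h.2 x hx⟩) k
  exact hI.exists_is_const_of_deriv_eq_zero hc
    (fun x hx => (hd x hx).differentiableAt.differentiableWithinAt) fun x hx => (hd x hx).deriv

/-! ### Curves in the coordinates `r` -/

theorem coeffSmoothOn_sqrtSer {n : ℕ} :
    CoeffSmoothOn (fun v : Fin n → ℝ => sqrtSer v) univ := fun k => by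
  induction k using Nat.strong_induction_on with
  | _ k ih =>
    simp only [sqrtSer, coeff_mk] at ih ⊢
    cases k with
    | zero =>
      simp only [sqrtCoeff]
      exact contDiffOn_const
    | succ k =>
      have h : (fun v : Fin n → ℝ => sqrtCoeff (fun k => coeff k (pser n 1 v)) (k + 1)) =
          fun v => (coeff (k + 1) (pser n 1 v) - ∑ i : Fin k,
            sqrtCoeff (fun k => coeff k (pser n 1 v)) (i.val + 1) *
              sqrtCoeff (fun k => coeff k (pser n 1 v)) (k - i.val)) / 2 := by
        funext v
        rw [sqrtCoeff]
      rw [h]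
      refine ((CoeffSmoothOn.pser contDiffOn_id n 1 (k + 1)).sub
        (ContDiffOn.sum fun i _ => ?_)).div_const 2
      exact (ih _ (by omega)).mul (ih _ (by omega))

theorem contDiff_rCoord {n : ℕ} : ContDiff ℝ ∞ (rCoord : (Fin n → ℝ) → Fin n → ℝ) := by
  rw [contDiff_pi]
  intro i
  have h := contDiffOn_univ.1 (coeffSmoothOn_sqrtSer (n := n) (i.val + 1))
  have e : (fun v : Fin n → ℝ => rCoord v i) = fun v => coeff (i.val + 1) (sqrtSer v) := by
    funext v
    rw [← comp_succ (rCoord v) i, comp_rCoord v (by omega) i.isLt]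
  rwa [e]

theorem hasDerivAt_of_comp {n : ℕ} {g : ℝ → Fin n → ℝ} {g' : Fin n → ℝ} {x : ℝ}
    (h : ∀ k, 1 ≤ k → k ≤ n → HasDerivAt (fun y => comp (g y) k) (comp g' k) x) :
    HasDerivAt g g' x := by
  rw [hasDerivAt_pi]
  intro i
  have := h (i.val + 1) (by omega) i.isLt
  simpa only [comp_succ] using this

theorem hasDerivAt_vOfR {n : ℕ} {r : ℝ → Fin n → ℝ} {r' : Fin n → ℝ} {x : ℝ}
    (hr : HasDerivAt r r' x) : HasDerivAt (fun y => vOfR (r y)) (vxOfR (r x) r') x := by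
  refine hasDerivAt_of_comp fun k h1 h2 => ?_
  simp only [comp_vOfR _ h1 h2, comp_vxOfR _ _ h1 h2]
  exact (HasCoeffDerivAt.pser hr n 1).sq k

theorem hasDerivAt_vxOfR {n : ℕ} {r w : ℝ → Fin n → ℝ} {w' : Fin n → ℝ} {x : ℝ}
    (hr : HasDerivAt r (w x) x) (hw : HasDerivAt w w' x) :
    HasDerivAt (fun y => vxOfR (r y) (w y)) (vxxOfR (r x) (w x) w') x := by
  refine hasDerivAt_of_comp fun k h1 h2 => ?_
  simp only [comp_vxOfR _ _ h1 h2, comp_vxxOfR _ _ _ h1 h2]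
  have := (((HasCoeffDerivAt.pser hr n 1).mul (HasCoeffDerivAt.pser hw n 0)).const_mul 2) k
  rwa [← pow_two] at this

section Smoothness

variable {E : Type*} [NormedAddCommGroup E] [NormedSpace ℝ E]

theorem contDiffOn_of_comp {n : ℕ} {g : E → Fin n → ℝ} {U : Set E} {m : WithTop ℕ∞}
    (h : ∀ k, 1 ≤ k → k ≤ n → ContDiffOn ℝ m (fun x => comp (g x) k) U) : ContDiffOn ℝ m g U := by
  rw [contDiffOn_pi]
  intro i
  have := h (i.val + 1) (by omega) i.isLt
  simpa only [comp_succ] using this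

theorem contDiffOn_vOfR {n : ℕ} {r : E → Fin n → ℝ} {U : Set E} (hr : ContDiffOn ℝ ∞ r U) :
    ContDiffOn ℝ ∞ (fun x => vOfR (r x)) U := by
  refine contDiffOn_of_comp fun k h1 h2 => ?_
  simp only [comp_vOfR _ h1 h2]
  exact (CoeffSmoothOn.pser hr n 1).pow 2 k

theorem contDiffOn_vxOfR {n : ℕ} {r w : E → Fin n → ℝ} {U : Set E} (hr : ContDiffOn ℝ ∞ r U)
    (hw : ContDiffOn ℝ ∞ w U) : ContDiffOn ℝ ∞ (fun x => vxOfR (r x) (w x)) U := by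
  refine contDiffOn_of_comp fun k h1 h2 => ?_
  simp only [comp_vxOfR _ _ h1 h2]
  exact (CoeffSmoothOn.const 2 U).mul ((CoeffSmoothOn.pser hr n 1).mul (CoeffSmoothOn.pser hw n 0)) k

theorem contDiffOn_vxxOfR {n : ℕ} {r w z : E → Fin n → ℝ} {U : Set E} (hr : ContDiffOn ℝ ∞ r U)
    (hw : ContDiffOn ℝ ∞ w U) (hz : ContDiffOn ℝ ∞ z U) :
    ContDiffOn ℝ ∞ (fun x => vxxOfR (r x) (w x) (z x)) U := by
  refine contDiffOn_of_comp fun k h1 h2 => ?_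
  simp only [comp_vxxOfR _ _ _ h1 h2]
  exact (CoeffSmoothOn.const 2 U).mul (((CoeffSmoothOn.pser hw n 0).pow 2).add
    ((CoeffSmoothOn.pser hr n 1).mul (CoeffSmoothOn.pser hz n 0))) k

theorem contDiffOn_mom0 {n : ℕ} {w : E → Fin n → ℝ} {U : Set E} {m : WithTop ℕ∞}
    (hw : ContDiffOn ℝ m w U) : ContDiffOn ℝ m (fun x => mom0 (w x)) U := by
  rw [contDiffOn_pi] at hw ⊢
  exact fun i => hw i.rev

theorem contDiffOn_accel0 (n : ℕ) (a : ℕ → ℝ) {α : E → ℝ} {r s : E → Fin n → ℝ} {U : Set E}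
    (hα : ContDiffOn ℝ ∞ α U) (hr : ContDiffOn ℝ ∞ r U) :
    ContDiffOn ℝ ∞ (fun x => accel0 n a (α x) (r x) (s x)) U := by
  rw [contDiffOn_pi]
  intro i
  simp only [accel0_apply]
  exact (coeffSmoothOn_force0 n a hα hr _).neg

theorem coeffSmoothOn_genBv {n : ℕ} (a : ℕ → ℝ) {v vx vxx : E → Fin n → ℝ} {U : Set E}
    (hv : ContDiffOn ℝ ∞ v U) (hvx : ContDiffOn ℝ ∞ vx U) (hvxx : ContDiffOn ℝ ∞ vxx U) :
    CoeffSmoothOn (fun x => genBv a (v x) (vx x) (vxx x)) U := by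
  have h1 := CoeffSmoothOn.pser hv n 1
  have h2 := CoeffSmoothOn.pser hvx n 0
  have h3 := CoeffSmoothOn.pser hvxx n 0
  have hu : ContDiffOn ℝ ∞ (fun x => 4 * uOf a (v x)) U :=
    contDiffOn_const.mul (((contDiffOn_comp hv 1).div_const 2).add contDiffOn_const)
  exact ((CoeffSmoothOn.const X U).mul ((((CoeffSmoothOn.const 2 U).mul h1).mul h3).sub
    (h2.pow 2))).add ((((CoeffSmoothOn.C hu).mul (CoeffSmoothOn.const X U)).sub
      (CoeffSmoothOn.const 1 U)).mul (h1.pow 2))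

theorem contDiffOn_redY (n : ℕ) (a : ℕ → ℝ) (j : ℕ) {α : E → ℝ} {r s : E → Fin n → ℝ} {U : Set E}
    (hα : ContDiffOn ℝ ∞ α U) (hr : ContDiffOn ℝ ∞ r U) (hs : ContDiffOn ℝ ∞ s U) :
    ContDiffOn ℝ ∞ (fun x => redY n a (α x) j (r x) (s x)) U := by
  simp only [redY_eq]
  exact contDiffOn_const.mul (coeffSmoothOn_genBv a (contDiffOn_vOfR hr)
    (contDiffOn_vxOfR hr (contDiffOn_mom0 hs)) (contDiffOn_vxxOfR hr (contDiffOn_mom0 hs)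
      (contDiffOn_accel0 n a hα hr)) _)

end Smoothness

theorem gdAlong_zero {n : ℕ} (a : ℕ → ℝ) (v : ℝ → Fin n → ℝ) (x : ℝ) (k : ℕ) :
    gdAlong a v x 0 k - comp (v x) (k + 1) =
      coeff (k + 1) (genBv a (v x) (deriv v x) (deriv (deriv v) x)) := gd_zero _ _ _ _ _

theorem gdAlong_top {n : ℕ} (a : ℕ → ℝ) (v : ℝ → Fin n → ℝ) (x : ℝ) (j : ℕ) :
    gdAlong a v x j n =
      coeff (j + n + 1) (genBv a (v x) (deriv v x) (deriv (deriv v) x)) := gd_top _ _ _ _ _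

theorem p0System_iff {n : ℕ} (hn : 1 ≤ n) (a : ℕ → ℝ) (α : ℝ) (I : Set ℝ) (v : ℝ → Fin n → ℝ) :
    P0System a α I v ↔ ∀ x ∈ I, IsP0Jet a α (v x) (deriv v x) (deriv (deriv v) x) := by
  refine forall₂_congr fun x _ => ?_
  simp only [gdAlong_zero]
  rw [gdAlong_top, zero_add]
  constructor
  · rintro ⟨h1, h2⟩ k hk
    rw [Finset.mem_Icc] at hk
    split_ifs with h
    · rw [h, h2]
    · exact h1 k (Finset.mem_Icc.2 ⟨hk.1, by omega⟩)
  · intro h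
    refine ⟨fun k hk => ?_, ?_⟩
    · rw [Finset.mem_Icc] at hk
      rw [h k (Finset.mem_Icc.2 ⟨hk.1, by omega⟩), if_neg (by omega)]
    · rw [h n (Finset.mem_Icc.2 ⟨hn, le_rfl⟩), if_pos rfl]

theorem deriv_vOfR {n : ℕ} {I : Set ℝ} (hI : IsOpen I) {r : ℝ → Fin n → ℝ}
    (hr : ∀ x ∈ I, HasDerivAt r (deriv r x) x)
    (hr' : ∀ x ∈ I, HasDerivAt (deriv r) (deriv (deriv r) x) x) {x : ℝ} (hx : x ∈ I) :
    deriv (fun y => vOfR (r y)) x = vxOfR (r x) (deriv r x) ∧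
    deriv (deriv fun y => vOfR (r y)) x =
      vxxOfR (r x) (deriv r x) (deriv (deriv r) x) := by
  refine ⟨(hasDerivAt_vOfR (hr x hx)).deriv, ?_⟩
  have h : deriv (fun y => vOfR (r y)) =ᶠ[nhds x] fun y => vxOfR (r y) (deriv r y) := by
    filter_upwards [hI.mem_nhds hx] with y hy using (hasDerivAt_vOfR (hr y hy)).deriv
  rw [h.deriv_eq, (hasDerivAt_vxOfR (hr x hx) (hr' x hx)).deriv]

theorem hasDerivAt_deriv_of_contDiffOn {n : ℕ} {I : Set ℝ} (hI : IsOpen I) {r : ℝ → Fin n → ℝ}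
    (hr : ContDiffOn ℝ 2 r I) : (∀ x ∈ I, HasDerivAt r (deriv r x) x) ∧
      ∀ x ∈ I, HasDerivAt (deriv r) (deriv (deriv r) x) x := by
  have hq' : ContDiffOn ℝ 1 (deriv r) I := hr.deriv_of_isOpen hI (by norm_num)
  exact ⟨fun x hx =>
    ((hr.differentiableOn (by norm_num)).differentiableAt (hI.mem_nhds hx)).hasDerivAt, fun x hx =>
    ((hq'.differentiableOn (by norm_num)).differentiableAt (hI.mem_nhds hx)).hasDerivAt⟩

/-- The `P₀`-system as Newton's equations for the coordinates `r`. -/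
theorem p0System_iff_accel0 {n : ℕ} (hn : 1 ≤ n) (a : ℕ → ℝ) (α : ℝ) {I : Set ℝ} (hI : IsOpen I)
    {v : ℝ → Fin n → ℝ} (hv : ContDiffOn ℝ 2 v I) :
    P0System a α I v ↔ ∀ x ∈ I, ∀ k, deriv (deriv fun y => rCoord (v y)) x k =
      -mom0 (fun i => coeff (n + 1 - i.val) (force0 n a α (rCoord (v x)))) k := by
  have hr : ContDiffOn ℝ 2 (fun x => rCoord (v x)) I :=
    (contDiff_rCoord.of_le (by norm_cast)).comp_contDiffOn hv
  obtain ⟨h1, h2⟩ := hasDerivAt_deriv_of_contDiffOn hI hr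
  have hvr : v = fun y => vOfR (rCoord (v y)) := by
    funext y
    rw [vOfR_rCoord]
  rw [p0System_iff hn]
  refine forall₂_congr fun x hx => ?_
  obtain ⟨e1, e2⟩ := deriv_vOfR hI h1 h2 hx
  rw [← hvr] at e1 e2
  rw [e1, e2]
  conv_lhs => rw [← vOfR_rCoord (v x)]
  rw [rCoord_vOfR, isP0Jet_iff hn]
  refine forall_congr' fun i => ?_
  rw [mom0, Fin.val_rev, show n + 1 - (n - (i.val + 1)) = i.val + 2 by have := i.isLt; omega]

/-- The `P₀`-system is equivalent to the Euler--Lagrange equations of `L_n^{(0)}` and to the canonical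
equations of `H_n^{(0)}`. -/
theorem p0System_equiv {n : ℕ} (hn : 1 ≤ n) (a : ℕ → ℝ) (α : ℝ) {I : Set ℝ} (hI : IsOpen I)
    {v : ℝ → Fin n → ℝ} (hv : ContDiffOn ℝ 2 v I) :
    (P0System a α I v ↔ EulerLagrange (L0 n a α) I (fun x => rCoord (v x))) ∧
    (P0System a α I v ↔ HamiltonEqs (H0 n a α) I (fun x => rCoord (v x))
      (fun x => mom0 (deriv (fun y => rCoord (v y)) x))) := by
  have hr : ContDiffOn ℝ 2 (fun x => rCoord (v x)) I :=
    (contDiff_rCoord.of_le (by norm_cast)).comp_contDiffOn hv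
  have h := mechanics_iff (L := L0 n a α) (H := H0 n a α) (mom := mom0) (σ := Fin.rev)
    (F := fun r i => coeff (n + 1 - i.val) (force0 n a α r)) (U := univ) (fun _ _ => rfl) mom0_mom0
    (fun q _ w k => pd_L0_fst n a α q w k) (pd_L0_snd n a α) (fun q _ w k => pd_H0_fst n a α q w k)
    (pd_H0_snd n a α) hI hr (fun _ _ => mem_univ _)
  rw [p0System_iff_accel0 hn a α hI hv]
  exact ⟨h.1.symm, h.2.symm⟩

/-- Along a canonical curve the Gelfand--Dickey polynomials are constant, because the coefficients
of `B^λ(v, v)` up to that of `λ^{-n}` are prescribed. -/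
theorem hamiltonEqs0_integrals {n : ℕ} (hn : 1 ≤ n) (a : ℕ → ℝ) (α : ℝ) {I : Set ℝ} (hI : IsOpen I)
    (hc : IsPreconnected I) {r s : ℝ → Fin n → ℝ} (h : HamiltonEqs (H0 n a α) I r s) (j : ℕ) :
    ∃ A : ℝ, ∀ x ∈ I, gdAlong a (fun y => vOfR (r y)) x j n = A ∧
      redY n a α j (r x) (s x) = -A / 8 := by
  have hr : ∀ x ∈ I, HasDerivAt r (mom0 (s x)) x := fun x hx => by
    have := (h x hx).1
    simpa only [pd_H0_snd] using this
  have hs : ∀ x ∈ I, HasDerivAt (fun y => mom0 (s y)) (accel0 n a α (r x) (s x)) x := fun x hx => by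
    rw [hasDerivAt_pi]
    exact fun i => hasDerivAt_pi.1 (h x hx).2 i.rev
  have hr1 : ∀ x ∈ I, deriv r x = mom0 (s x) := fun x hx => (hr x hx).deriv
  have hr2 : ∀ x ∈ I, HasDerivAt (deriv r) (accel0 n a α (r x) (s x)) x := fun x hx => by
    refine (hs x hx).congr_of_eventuallyEq ?_
    filter_upwards [hI.mem_nhds hx] with y hy using hr1 y hy
  have hvxx : ∀ x ∈ I, DifferentiableAt ℝ
      (fun y => vxxOfR (r y) (mom0 (s y)) (accel0 n a α (r y) (s y))) x := by
    intro x hx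
    have hz : DifferentiableAt ℝ (fun y => (r y, s y)) x :=
      (hr x hx).differentiableAt.prodMk (h x hx).2.differentiableAt
    have hF : ContDiff ℝ ∞ (fun z : (Fin n → ℝ) × (Fin n → ℝ) =>
        vxxOfR z.1 (mom0 z.2) (accel0 n a α z.1 z.2)) :=
      contDiffOn_univ.1 (contDiffOn_vxxOfR contDiffOn_fst (contDiffOn_mom0 contDiffOn_snd)
        (contDiffOn_accel0 n a contDiffOn_const contDiffOn_fst))
    have hd : DifferentiableAt ℝ (fun z : (Fin n → ℝ) × (Fin n → ℝ) =>
        vxxOfR z.1 (mom0 z.2) (accel0 n a α z.1 z.2)) (r x, s x) := hF.differentiable (by simp) _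
    exact hd.fun_comp' x hz
  have hjet : ∀ x, IsP0Jet a α (vOfR (r x)) (vxOfR (r x) (mom0 (s x)))
      (vxxOfR (r x) (mom0 (s x)) (accel0 n a α (r x) (s x))) :=
    fun x => isP0Jet_accel0 hn a α (r x) (s x) _
  have hlow' : ∀ k ≤ n + 1, ∃ c, ∀ x ∈ I, coeff k (genBv a (vOfR (r x)) (vxOfR (r x) (mom0 (s x)))
      (vxxOfR (r x) (mom0 (s x)) (accel0 n a α (r x) (s x)))) = c :=
    fun k hk => ⟨_, fun x _ => (hjet x).coeff_eq hn hk⟩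
  obtain ⟨A, hA⟩ := exists_eq_of_genBv a hI hc (v := fun x => vOfR (r x))
    (vx := fun x => vxOfR (r x) (mom0 (s x)))
    (vxx := fun x => vxxOfR (r x) (mom0 (s x)) (accel0 n a α (r x) (s x)))
    (fun x hx => hasDerivAt_vOfR (hr x hx)) (fun x hx => hasDerivAt_vxOfR (hr x hx) (hs x hx)) hvxx
    (fun k hk => hlow' k (by omega)) (Or.inl (hlow' (n + 1) le_rfl)) (j + n + 1)
  refine ⟨A, fun x hx => ⟨?_, ?_⟩⟩
  · obtain ⟨e1, e2⟩ := deriv_vOfR hI (fun x hx => (hr x hx).differentiableAt.hasDerivAt)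
      (fun x hx => (hr2 x hx).differentiableAt.hasDerivAt) hx
    rw [gdAlong_top, e1, e2, (hr2 x hx).deriv, hr1 x hx, hA x hx]
  · rw [redY_eq, hA x hx]
    ring

/-! ### The Lagrangian `L_n^{(0)}` -/

theorem coeff_sq_pser {n : ℕ} (w : Fin n → ℝ) :
    coeff (n + 1) (pser n 0 w ^ 2) = ∑ i, w i * w i.rev := by
  have h : (fun i : Fin n => w i * w i.rev) = fun i : Fin n =>
      (fun k => coeff (k + 1) (pser n 0 w) * coeff (n - k) (pser n 0 w)) i.val := by
    funext i
    have hi := i.isLt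
    simp only [coeff_pser]
    rw [if_neg (by omega), if_pos (by omega), if_neg (by omega), if_pos (by omega), comp_succ,
      ← comp_succ w i.rev, Fin.val_rev]
    congr 2
    omega
  rw [h, Fin.sum_univ_eq_sum_range (fun k => coeff (k + 1) (pser n 0 w) * coeff (n - k) (pser n 0 w)),
    pow_two, coeff_mul, Finset.Nat.sum_antidiagonal_eq_sum_range_succ (fun i j =>
      coeff i (pser n 0 w) * coeff j (pser n 0 w)), Finset.sum_range_succ, Finset.sum_range_succ']
  simp

/-- The metric of the kinetic energy `∑ w_k w_{n+1-k} / 2` is a permutation matrix. -/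
theorem isNaturalLagrangian_L0 (n : ℕ) (a : ℕ → ℝ) (α : ℝ) :
    IsNaturalLagrangian (L0 n a α) univ := by
  refine ⟨fun _ => (1 : Matrix (Fin n) (Fin n) ℝ).submatrix Fin.rev id,
    fun r => pot (a 0) (aPow0 a n α) (n + 2) 0 (pser n 1 r), fun _ _ => contDiffOn_const,
    contDiffOn_pot0 n a contDiffOn_const contDiffOn_id, fun q _ => ⟨?_, ?_, fun w => ?_⟩⟩
  · ext i j
    simp only [Matrix.transpose_apply, Matrix.submatrix_apply, id, Matrix.one_apply]
    congr 1
    rw [eq_iff_iff, Fin.rev_eq_iff, eq_comm]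
  · have h := Matrix.det_permute (Fin.revPerm : Equiv.Perm (Fin n)) (1 : Matrix (Fin n) (Fin n) ℝ)
    have e : (1 : Matrix (Fin n) (Fin n) ℝ).submatrix Fin.rev id =
      (1 : Matrix (Fin n) (Fin n) ℝ).submatrix (Fin.revPerm : Equiv.Perm (Fin n)) id := rfl
    rw [e, h, Matrix.det_one, mul_one]
    norm_cast
    exact Units.ne_zero _
  · rw [L0_eq, coeff_sq_pser]
    simp [Matrix.one_apply, mul_comm]

theorem isCanonicalForm_L0 (n : ℕ) (a : ℕ → ℝ) (α : ℝ) :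
    IsCanonicalForm (L0 n a α) (H0 n a α) mom0 univ := by
  refine ⟨Function.Involutive.bijective mom0_mom0, fun q _ w => ⟨pd_L0_snd n a α q w, ?_⟩⟩
  have h : ∑ k, mom0 w k * w k = ∑ k, w k * w k.rev :=
    Finset.sum_congr rfl fun k _ => mul_comm _ _
  have h2 : ∑ k, mom0 w k * mom0 w k.rev = ∑ k, w k * w k.rev := by
    refine Finset.sum_congr rfl fun k _ => ?_
    simp [mom0, mul_comm]
  rw [H0_eq, L0_eq, coeff_sq_pser, coeff_sq_pser, h, h2]
  ring

/-! ### The coordinates `q` -/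

theorem comp_vOfQ {n : ℕ} (q : Fin n → ℝ) {k : ℕ} (h1 : 1 ≤ k) (h2 : k < n) :
    comp (vOfQ q) k = coeff k (pser (n - 1) 1 q ^ 2) := by
  rw [comp_eq _ h1 h2.le, vOfQ]
  simp only [Nat.sub_add_cancel h1]
  rw [if_neg (by omega), serTo_eq, ← map_pow, Del_toL]

theorem comp_vxOfQ {n : ℕ} (q qx : Fin n → ℝ) {k : ℕ} (h1 : 1 ≤ k) (h2 : k < n) :
    comp (vxOfQ q qx) k = coeff k (2 * (pser (n - 1) 1 q * pser (n - 1) 0 qx)) := by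
  rw [comp_eq _ h1 h2.le, vxOfQ]
  simp only [Nat.sub_add_cancel h1]
  rw [if_neg (by omega), serTo_eq, serTo_eq, ofNat_eq_toL, ← map_mul, ← map_mul, Del_toL]

theorem comp_vxxOfQ {n : ℕ} (q qx qxx : Fin n → ℝ) {k : ℕ} (h1 : 1 ≤ k) (h2 : k < n) :
    comp (vxxOfQ q qx qxx) k =
      coeff k (2 * (pser (n - 1) 0 qx ^ 2 + pser (n - 1) 1 q * pser (n - 1) 0 qxx)) := by
  rw [comp_eq _ h1 h2.le, vxxOfQ]
  simp only [Nat.sub_add_cancel h1]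
  rw [if_neg (by omega), serTo_eq, serTo_eq, serTo_eq, ofNat_eq_toL, ← map_mul, ← map_pow,
    ← map_add, ← map_mul, Del_toL]

theorem comp_vOfQ_last {n : ℕ} (hn : 1 ≤ n) (q : Fin n → ℝ) :
    comp (vOfQ q) n = -comp q n ^ 2 := by
  rw [comp_eq _ hn le_rfl, comp_eq _ hn le_rfl, vOfQ]
  simp only [Nat.sub_add_cancel hn]
  rw [if_true]

theorem comp_vxOfQ_last {n : ℕ} (hn : 1 ≤ n) (q qx : Fin n → ℝ) :
    comp (vxOfQ q qx) n = -(2 * (comp q n * comp qx n)) := by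
  rw [comp_eq _ hn le_rfl, comp_eq _ hn le_rfl, comp_eq _ hn le_rfl, vxOfQ]
  simp only [Nat.sub_add_cancel hn]
  rw [if_true]

theorem comp_vxxOfQ_last {n : ℕ} (hn : 1 ≤ n) (q qx qxx : Fin n → ℝ) :
    comp (vxxOfQ q qx qxx) n = -(2 * (comp qx n ^ 2 + comp q n * comp qxx n)) := by
  rw [comp_eq _ hn le_rfl, comp_eq _ hn le_rfl, comp_eq _ hn le_rfl, comp_eq _ hn le_rfl, vxxOfQ]
  simp only [Nat.sub_add_cancel hn]
  rw [if_true]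

theorem coeff_pser_vOfQ {n : ℕ} (q : Fin n → ℝ) :
    ∀ k < n - 1 + 1, coeff k (pser n 1 (vOfQ q)) = coeff k (pser (n - 1) 1 q ^ 2) :=
  coeff_pser_eq (by omega) (by simp [constantCoeff_pser]) fun _ h1 h2 => comp_vOfQ q h1 (by omega)

theorem coeff_pser_vxOfQ {n : ℕ} (q qx : Fin n → ℝ) :
    ∀ k < n - 1 + 1, coeff k (pser n 0 (vxOfQ q qx)) =
      coeff k (2 * (pser (n - 1) 1 q * pser (n - 1) 0 qx)) :=
  coeff_pser_eq (by omega) (by simp [constantCoeff_pser])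
    fun _ h1 h2 => comp_vxOfQ q qx h1 (by omega)

theorem coeff_pser_vxxOfQ {n : ℕ} (q qx qxx : Fin n → ℝ) :
    ∀ k < n - 1 + 1, coeff k (pser n 0 (vxxOfQ q qx qxx)) =
      coeff k (2 * (pser (n - 1) 0 qx ^ 2 + pser (n - 1) 1 q * pser (n - 1) 0 qxx)) :=
  coeff_pser_eq (by omega) (by simp [constantCoeff_pser])
    fun _ h1 h2 => comp_vxxOfQ q qx qxx h1 (by omega)

theorem comp_qCoord {n : ℕ} (v : Fin n → ℝ) {k : ℕ} (h1 : 1 ≤ k) (h2 : k < n) :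
    comp (qCoord v) k = comp (rCoord v) k := by
  rw [comp_eq _ h1 h2.le, comp_eq _ h1 h2.le, qCoord]
  simp only [Nat.sub_add_cancel h1]
  rw [if_neg (by omega)]

theorem comp_qCoord_last {n : ℕ} (hn : 1 ≤ n) (v : Fin n → ℝ) :
    comp (qCoord v) n = √(-comp v n) := by
  rw [comp_eq _ hn le_rfl, comp_eq _ hn le_rfl, qCoord]
  simp only [Nat.sub_add_cancel hn]
  rw [if_true]

theorem vOfQ_qCoord {n : ℕ} {v : Fin n → ℝ} (hv : comp v n < 0) : vOfQ (qCoord v) = v := by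
  refine fun_eq_of_comp fun k hk => ?_
  rw [Finset.mem_Icc] at hk
  rcases hk.2.lt_or_eq with h | rfl
  · have hc : ∀ j ≤ k, coeff j (pser (n - 1) 1 (qCoord v)) = coeff j (sqrtSer v) := fun j hj =>
      coeff_pser_eq le_rfl (constantCoeff_sqrtSer v)
        (fun i h1 h2 => by rw [comp_qCoord v h1 (by omega), comp_rCoord v h1 (by omega)]) j
        (by omega)
    rw [comp_vOfQ _ hk.1 h, pow_two, coeff_mul_congr hc hc, ← pow_two, sqrtSer_sq, coeff_pser,
      if_neg (by omega), if_pos hk.2]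
  · rw [comp_vOfQ_last hk.1, comp_qCoord_last hk.1, Real.sq_sqrt (by linarith), neg_neg]

theorem comp_rCoord_vOfQ {n : ℕ} (q : Fin n → ℝ) {k : ℕ} (h1 : 1 ≤ k) (h2 : k < n) :
    comp (rCoord (vOfQ q)) k = comp q k := by
  rw [comp_rCoord _ h1 h2.le, coeff_eq_of_sq (N := n - 1 + 1) (constantCoeff_sqrtSer _)
    (constantCoeff_pser (n - 1) 1 q) _ k (by omega), coeff_pser, if_neg (by omega),
    if_pos (by omega)]
  intro j hj
  rw [sqrtSer_sq, coeff_pser_vOfQ q j hj]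

theorem qCoord_vOfQ {n : ℕ} {q : Fin n → ℝ} (hq : 0 < comp q n) : qCoord (vOfQ q) = q := by
  refine fun_eq_of_comp fun k hk => ?_
  rw [Finset.mem_Icc] at hk
  rcases hk.2.lt_or_eq with h | rfl
  · rw [comp_qCoord _ hk.1 h, comp_rCoord_vOfQ q hk.1 h]
  · rw [comp_qCoord_last hk.1, comp_vOfQ_last hk.1, neg_neg, Real.sqrt_sq hq.le]

theorem uOf_vOfQ {n : ℕ} (hn : 2 ≤ n) (a : ℕ → ℝ) (q : Fin n → ℝ) :
    uOf a (vOfQ q) = coeff 1 (pser (n - 1) 1 q) + a 0 / 4 := by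
  rw [uOf, comp_vOfQ q le_rfl hn, pow_two, coeff_one_mul, constantCoeff_pser]
  ring

/-- The index of the velocity that is the `i`-th momentum of `L_n^{(1)}`: the involution `k ↦ n - k`
for `k < n` that fixes `n`, with indices counted from `0`. -/
def rev1 {n : ℕ} (i : Fin n) : Fin n :=
  if i.val + 1 = n then i else ⟨n - (i.val + 1) - 1, by have := i.isLt; omega⟩

theorem val_rev1 {n : ℕ} {i : Fin n} (h : i.val + 1 ≠ n) :
    (rev1 i).val = n - (i.val + 1) - 1 := by
  rw [rev1, if_neg h]

theorem rev1_last {n : ℕ} {i : Fin n} (h : i.val + 1 = n) : rev1 i = i := by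
  rw [rev1, if_pos h]

theorem rev1_rev1 {n : ℕ} (i : Fin n) : rev1 (rev1 i) = i := by
  by_cases h : i.val + 1 = n
  · rw [rev1_last h, rev1_last h]
  · have hi := i.isLt
    have h2 := val_rev1 h
    ext
    rw [val_rev1 (by omega), h2]
    omega

theorem mom1_apply {n : ℕ} (w : Fin n → ℝ) (i : Fin n) : mom1 w i = w (rev1 i) := by
  rw [mom1, rev1]
  have hi := i.isLt
  split_ifs with h
  · rfl
  · rw [comp_eq w (by omega) (by omega)]

theorem mom1_mom1 {n : ℕ} (w : Fin n → ℝ) : mom1 (mom1 w) = w := by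
  ext i
  rw [mom1_apply, mom1_apply, rev1_rev1]

/-! ### The Hamiltonian in the coordinates `(q, p)` -/

/-- The kinetic energy `∑_{k<n} w_k w_{n-k} / 2 + w_n² / 2`. -/
def kin1 {n : ℕ} (w : Fin n → ℝ) : ℝ :=
  1 / 2 * coeff n (pser (n - 1) 0 w ^ 2) + 1 / 2 * comp w n ^ 2

/-- The potential in the coordinates `q`. -/
def pot1 (n : ℕ) (a : ℕ → ℝ) (β : ℝ) (q : Fin n → ℝ) : ℝ :=
  pot (a 0) (aPow a n) (n + 1) (comp q n ^ 2) (pser (n - 1) 1 q) + β / (8 * comp q n ^ 2)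

/-- The force in the coordinates `q_k`, `k < n`. -/
def force1 (n : ℕ) (a : ℕ → ℝ) (q : Fin n → ℝ) : ℝ⟦X⟧ :=
  force (coeff 1 (pser (n - 1) 1 q) + a 0 / 4) (aPow a n) (pser (n - 1) 1 q) (n - 1)
    (comp q n ^ 2)

/-- The differential of `pot1`. -/
def dpot1 (n : ℕ) (a : ℕ → ℝ) (β : ℝ) (q : Fin n → ℝ) (i : Fin n) : ℝ :=
  if i.val + 1 = n then
    (coeff 1 (pser (n - 1) 1 q) + a 0 / 4) * comp q n - β / (4 * comp q n ^ 3)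
  else coeff (n - i.val) (force1 n a q)

theorem coeff_pser_sq_truncate {n : ℕ} (hn : 1 ≤ n) (w : Fin n → ℝ) :
    coeff n (pser n 0 w ^ 2) = coeff n (pser (n - 1) 0 w ^ 2) := by
  have h : pser n 0 w = pser (n - 1) 0 w + C (comp w n) * X ^ n := by
    ext j
    simp only [map_add, coeff_pser, coeff_C_mul, coeff_X_pow]
    rcases lt_trichotomy j n with h | h | h
    · split_ifs <;> first | omega | simp
    · subst h
      split_ifs <;> first | omega | simp
    · split_ifs <;> first | omega | simp
  have h2 : pser n 0 w ^ 2 = pser (n - 1) 0 w ^ 2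
      + X ^ n * (C (comp w n) * (2 * pser (n - 1) 0 w + C (comp w n) * X ^ n)) := by
    rw [h]
    ring
  rw [h2, map_add, coeff_X_pow_mul', if_pos le_rfl, Nat.sub_self, coeff_C_mul, map_add]
  simp only [coeff_zero_eq_constantCoeff, map_mul, map_pow, map_ofNat, constantCoeff_pser,
    constantCoeff_C, constantCoeff_X, zero_pow (show n ≠ 0 by omega)]
  ring

theorem coeff_one_pser_pred {n : ℕ} (hn : 2 ≤ n) (q : Fin n → ℝ) :
    coeff 1 (pser (n - 1) 1 q) = comp q 1 := by
  rw [coeff_pser, if_neg (by omega), if_pos (by omega)]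

theorem H1_eq {n : ℕ} (hn : 2 ≤ n) (a : ℕ → ℝ) (β : ℝ) (q p : Fin n → ℝ) :
    H1 n a β q p = kin1 p + pot1 n a β q := by
  rw [H1, aSer_eq, serTo_eq, ser_eq, scrH_eq _ _ _ _ (constantCoeff_pser _ _ _),
    coeff_pser_sq_truncate (by omega), kin1, pot1, pot, pot, coeff_one_pser_pred hn]
  ring

theorem L1_eq {n : ℕ} (hn : 2 ≤ n) (a : ℕ → ℝ) (β : ℝ) (q w : Fin n → ℝ) :
    L1 n a β q w = kin1 w - pot1 n a β q := by
  rw [L1, aSer_eq, serTo_eq, serTo_eq, scrL_eq _ _ _ _ (constantCoeff_pser _ _ _), kin1, pot1, pot,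
    pot, coeff_one_pser_pred hn]
  ring

section Smoothness

variable {E : Type*} [NormedAddCommGroup E] [NormedSpace ℝ E]

theorem coeffSmoothOn_force1 (n : ℕ) (a : ℕ → ℝ) {q : E → Fin n → ℝ} {U : Set E}
    (hq : ContDiffOn ℝ ∞ q U) : CoeffSmoothOn (fun x => force1 n a (q x)) U :=
  coeffSmoothOn_force _ ((CoeffSmoothOn.pser hq (n - 1) 1 1).add contDiffOn_const)
    (CoeffSmoothOn.const _ U) ((contDiffOn_comp hq n).pow 2) (CoeffSmoothOn.pser hq (n - 1) 1)
    fun _ => constantCoeff_pser _ _ _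

theorem contDiffOn_pot1 (n : ℕ) (a : ℕ → ℝ) {β : E → ℝ} {q : E → Fin n → ℝ} {U : Set E}
    (hβ : ContDiffOn ℝ ∞ β U) (hq : ContDiffOn ℝ ∞ q U) (hU : ∀ x ∈ U, comp (q x) n ≠ 0) :
    ContDiffOn ℝ ∞ (fun x => pot1 n a (β x) (q x)) U := by
  refine (contDiffOn_pot _ _ (CoeffSmoothOn.const _ U) ((contDiffOn_comp hq n).pow 2)
    (CoeffSmoothOn.pser hq (n - 1) 1) fun _ => constantCoeff_pser _ _ _).add
    (hβ.div (contDiffOn_const.mul ((contDiffOn_comp hq n).pow 2)) fun x hx => ?_)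
  have := hU x hx
  positivity

theorem contDiffOn_dpot1 (n : ℕ) (a : ℕ → ℝ) {β : E → ℝ} {q : E → Fin n → ℝ} {U : Set E}
    (hβ : ContDiffOn ℝ ∞ β U) (hq : ContDiffOn ℝ ∞ q U) (hU : ∀ x ∈ U, comp (q x) n ≠ 0)
    (i : Fin n) : ContDiffOn ℝ ∞ (fun x => dpot1 n a (β x) (q x) i) U := by
  unfold dpot1
  split_ifs
  · refine (((CoeffSmoothOn.pser hq (n - 1) 1 1).add contDiffOn_const).mul
      (contDiffOn_comp hq n)).sub
      (hβ.div (contDiffOn_const.mul ((contDiffOn_comp hq n).pow 3)) fun x hx => ?_)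
    exact mul_ne_zero (by norm_num) (pow_ne_zero 3 (hU x hx))
  · exact coeffSmoothOn_force1 n a hq _

theorem contDiffOn_mom1 {n : ℕ} {w : E → Fin n → ℝ} {U : Set E} {m : WithTop ℕ∞}
    (hw : ContDiffOn ℝ m w U) : ContDiffOn ℝ m (fun x => mom1 (w x)) U := by
  rw [contDiffOn_pi] at hw ⊢
  intro i
  simp only [mom1_apply]
  exact hw _

end Smoothness

theorem isOpen_comp_ne {n : ℕ} (k : ℕ) : IsOpen {q : Fin n → ℝ | comp q k ≠ 0} :=
  isOpen_ne_fun (contDiff_comp k).continuous continuous_const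

theorem pd_pot1 {n : ℕ} (hn : 2 ≤ n) (a : ℕ → ℝ) (β : ℝ) {q : Fin n → ℝ} (hq : comp q n ≠ 0)
    (i : Fin n) : pd (pot1 n a β) q i = dpot1 n a β q i := by
  refine pd_eq ?_ ?_
  · exact ((contDiffOn_pot1 n a contDiffOn_const contDiffOn_id (U := {q | comp q n ≠ 0})
      fun _ h => h).differentiableOn (by simp)).differentiableAt ((isOpen_comp_ne n).mem_nhds hq)
  · rw [dpot1]
    split_ifs with hi
    · have hc : ∀ ε : ℝ, comp (q + ε • Pi.single i 1) n = comp q n + ε := by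
        intro ε
        rw [comp_add, comp_smul, comp_single, if_pos hi.symm, mul_one]
      have h1 : HasDerivAt (fun ε : ℝ => comp q n + ε) 1 0 := (hasDerivAt_id _).const_add _
      have h2 := (((h1.fun_pow 2).const_mul (1 / 2 * (coeff 1 (pser (n - 1) 1 q) + a 0 / 4))).const_add
        (pot (a 0) (aPow a n) (n + 1) 0 (pser (n - 1) 1 q))).add
        ((hasDerivAt_const (0 : ℝ) β).div ((h1.fun_pow 2).const_mul 8) (by simpa using hq))
      refine (h2.congr_of_eventuallyEq (Filter.Eventually.of_forall fun ε => ?_)).congr_deriv ?_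
      · simp only [pot1, hc, pser_add_single_of_lt (n - 1) 1 ε q i (by omega)]
        simp only [pot, Pi.add_apply, Pi.div_apply]
        ring
      · simp only [add_zero]
        field_simp
        ring
    · have hi' := i.isLt
      have h := hasDerivAt_pot (a 0) (comp q n ^ 2) (aPow a n) (pser (n - 1) 1 q) (n - 1) (i.val + 1)
        (constantCoeff_pser _ _ _) (by omega) (by omega)
      rw [show n - 1 + 2 - (i.val + 1) = n - i.val by omega, show n - 1 + 2 = n + 1 by omega] at h
      have hc : ∀ ε : ℝ, comp (q + ε • Pi.single i 1) n = comp q n := by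
        intro ε
        rw [comp_add, comp_smul, comp_single, if_neg (by omega), mul_zero, add_zero]
      refine (h.add_const (β / (8 * comp q n ^ 2))).congr_of_eventuallyEq
        (Filter.Eventually.of_forall fun ε => ?_)
      simp only [pot1, hc, pser_add_single (n - 1) 1 ε q i (by omega)]

theorem pd_kin1 {n : ℕ} (w : Fin n → ℝ) (i : Fin n) : pd kin1 w i = mom1 w i := by
  have hd : ContDiff ℝ ∞ (kin1 : (Fin n → ℝ) → ℝ) :=
    (contDiff_kinetic n (n - 1) n).add (contDiff_const.mul ((contDiff_comp n).pow 2))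
  have hi' := i.isLt
  refine pd_eq (hd.differentiable (by simp)).differentiableAt ?_
  rw [mom1]
  split_ifs with hi
  · have h1 : HasDerivAt (fun ε : ℝ => comp w n + ε) 1 0 := (hasDerivAt_id _).const_add _
    have h2 := ((h1.fun_pow 2).const_mul (1 / 2)).const_add
      (1 / 2 * coeff n (pser (n - 1) 0 w ^ 2))
    refine (h2.congr_of_eventuallyEq (Filter.Eventually.of_forall fun ε => ?_)).congr_deriv ?_
    · simp only [kin1, comp_add, comp_smul, comp_single, if_pos hi.symm, mul_one,
        pser_add_single_of_lt (n - 1) 0 ε w i (by omega)]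
    · rw [← comp_succ w i, hi]
      simp
  · have h := hasDerivAt_kinetic n (pser (n - 1) 0 w) (k := i.val + 1) (by omega)
    refine ((h.add_const (1 / 2 * comp w n ^ 2)).congr_of_eventuallyEq
      (Filter.Eventually.of_forall fun ε => ?_)).congr_deriv ?_
    · simp only [kin1, comp_add, comp_smul, comp_single, if_neg (show ¬ n = i.val + 1 by omega),
        mul_zero, add_zero, pser_add_single (n - 1) 0 ε w i (by omega)]
    · rw [coeff_pser, if_neg (by omega), if_pos (by omega)]

theorem pd_H1_fst {n : ℕ} (hn : 2 ≤ n) (a : ℕ → ℝ) (β : ℝ) {q : Fin n → ℝ} (hq : comp q n ≠ 0)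
    (p : Fin n → ℝ) (i : Fin n) : pd (fun y => H1 n a β y p) q i = dpot1 n a β q i := by
  simp only [H1_eq hn]
  rw [pd_const_add, pd_pot1 hn a β hq]

theorem pd_H1_snd {n : ℕ} (hn : 2 ≤ n) (a : ℕ → ℝ) (β : ℝ) (q p : Fin n → ℝ) (i : Fin n) :
    pd (H1 n a β q) p i = mom1 p i := by
  rw [funext fun p => H1_eq hn a β q p, pd_add_const, pd_kin1]

theorem pd_L1_fst {n : ℕ} (hn : 2 ≤ n) (a : ℕ → ℝ) (β : ℝ) {q : Fin n → ℝ} (hq : comp q n ≠ 0)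
    (w : Fin n → ℝ) (i : Fin n) : pd (fun y => L1 n a β y w) q i = -dpot1 n a β q i := by
  simp only [L1_eq hn]
  rw [pd_const_sub, pd_pot1 hn a β hq]

theorem pd_L1_snd {n : ℕ} (hn : 2 ≤ n) (a : ℕ → ℝ) (β : ℝ) (q w : Fin n → ℝ) (i : Fin n) :
    pd (L1 n a β q) w i = mom1 w i := by
  rw [funext fun p => L1_eq hn a β q p, pd_sub_const, pd_kin1]

/-- `q_{xx}` on the solutions of the canonical equations of `H_n^{(1)}`. -/
def accel1 (n : ℕ) (a : ℕ → ℝ) (β : ℝ) (q p : Fin n → ℝ) : Fin n → ℝ :=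
  mom1 fun k => -pd (fun y => H1 n a β y p) q k

theorem accel1_eq {n : ℕ} (hn : 2 ≤ n) (a : ℕ → ℝ) (β : ℝ) {q : Fin n → ℝ} (hq : comp q n ≠ 0)
    (p : Fin n → ℝ) (i : Fin n) : accel1 n a β q p i = -mom1 (dpot1 n a β q) i := by
  rw [accel1, mom1_apply, mom1_apply, pd_H1_fst hn a β hq]

/-- The jets at which the equations of the `P₁`-system hold. They prescribe the coefficients of
`λ^{-1}, …, λ^{-(n-1)}` and `λ^{-2n}` in `B^λ(v, v)`. -/
def IsP1Jet {n : ℕ} (a : ℕ → ℝ) (β : ℝ) (v vx vxx : Fin n → ℝ) : Prop :=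
  (∀ k ∈ Finset.Icc 1 (n - 1), coeff (k + 1) (genBv a v vx vxx) = a k) ∧
    coeff (2 * n + 1) (genBv a v vx vxx) = β

theorem coeff_mul_pser_top {n : ℕ} {f g : ℝ⟦X⟧} (hf : ∀ k, n < k → coeff k f = 0)
    (hg : ∀ k, n < k → coeff k g = 0) : coeff (2 * n) (f * g) = coeff n f * coeff n g := by
  rw [coeff_mul, Finset.sum_eq_single (n, n)]
  · rintro ⟨i, j⟩ hij hne
    rw [Finset.HasAntidiagonal.mem_antidiagonal] at hij
    simp only at hij ⊢
    rcases lt_trichotomy i n with h | h | h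
    · rw [hg j (by omega), mul_zero]
    · exact absurd (Prod.ext h (show j = n by omega)) hne
    · rw [hf i h, zero_mul]
  · intro h
    exact absurd (Finset.HasAntidiagonal.mem_antidiagonal.2 (by simp only; omega)) h

theorem coeff_mul_pser_above {n k : ℕ} {f g : ℝ⟦X⟧} (hk : 2 * n < k)
    (hf : ∀ k, n < k → coeff k f = 0) (hg : ∀ k, n < k → coeff k g = 0) :
    coeff k (f * g) = 0 := by
  rw [coeff_mul]
  refine Finset.sum_eq_zero ?_
  rintro ⟨i, j⟩ hij
  rw [Finset.HasAntidiagonal.mem_antidiagonal] at hij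
  simp only at hij ⊢
  rcases lt_or_ge n i with h | h
  · rw [hf i h, zero_mul]
  · rw [hg j (by omega), mul_zero]

theorem coeff_pser_of_lt {n m k : ℕ} (c : ℝ) (x : Fin n → ℝ) (h : m < k) :
    coeff k (pser m c x) = 0 := by
  rw [coeff_pser, if_neg (by omega), if_neg (by omega)]

/-- The last Gelfand--Dickey polynomial `p_{nn}`. Only the top coefficients `v_n` contribute, so it is
`B(v_n, v_n)` without the term in `λ`. -/
theorem coeff_top_genBv {n : ℕ} (hn : 1 ≤ n) (a : ℕ → ℝ) (v vx vxx : Fin n → ℝ) :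
    coeff (2 * n + 1) (genBv a v vx vxx) =
      2 * comp v n * comp vxx n - comp vx n ^ 2 + 4 * uOf a v * comp v n ^ 2 := by
  have hf : ∀ k, n < k → coeff k (pser n 1 v) = 0 := fun k h => coeff_pser_of_lt 1 v h
  have hf' : ∀ k, n < k → coeff k (pser n 0 vx) = 0 := fun k h => coeff_pser_of_lt 0 vx h
  have hf'' : ∀ k, n < k → coeff k (pser n 0 vxx) = 0 := fun k h => coeff_pser_of_lt 0 vxx h
  have e : genBv a v vx vxx = X * (C 2 * (pser n 1 v * pser n 0 vxx) - pser n 0 vx * pser n 0 vx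
      + C (4 * uOf a v) * (pser n 1 v * pser n 1 v)) - pser n 1 v * pser n 1 v := by
    rw [genBv, genB, map_ofNat C 2]
    ring
  have hc : ∀ (c : ℝ) (x : Fin n → ℝ), coeff n (pser n c x) = comp x n := by
    intro c x
    rw [coeff_pser, if_neg (by omega), if_pos le_rfl]
  rw [e, map_sub, coeff_succ_X_mul, map_add, map_sub, coeff_C_mul, coeff_C_mul,
    coeff_mul_pser_top hf hf'', coeff_mul_pser_top hf' hf', coeff_mul_pser_top hf hf,
    coeff_mul_pser_above (by omega) hf hf]
  simp only [hc]
  ring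

/-- In the coordinates `q` the `P₁`-equations are solved for `q_{xx}`: the first `n - 1` of them are
those of a square root of lower order, and `p_{nn} = a_{2n}` is an equation for `q_n` alone, apart
from `u`. -/
theorem isP1Jet_iff {n : ℕ} (hn : 2 ≤ n) (a : ℕ → ℝ) (β : ℝ) {q : Fin n → ℝ} (hq : comp q n ≠ 0)
    (qx qxx : Fin n → ℝ) :
    IsP1Jet a β (vOfQ q) (vxOfQ q qx) (vxxOfQ q qx qxx) ↔
      ∀ i : Fin n, qxx i = -mom1 (dpot1 n a β q) i := by
  have h := genB_coeff_iff (n - 1) (by omega) (a 0) (comp q n ^ 2) (aPow a n) (pser (n - 1) 1 q)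
    (pser (n - 1) 0 qx) (pser (n - 1) 0 qxx)
    (pser n 1 (vOfQ q)) (pser n 0 (vxOfQ q qx)) (pser n 0 (vxxOfQ q qx qxx))
    (by simp) (by simp) (by simp)
    (by rw [coeff_aPow]; simp)
    (by rw [coeff_aPow, if_neg (by omega), if_pos (by omega)])
    (X_pow_dvd_sub_iff.2 (coeff_pser_vOfQ q)) (X_pow_dvd_sub_iff.2 (coeff_pser_vxOfQ q qx))
    (X_pow_dvd_sub_iff.2 (coeff_pser_vxxOfQ q qx qxx))
    (by rw [Nat.sub_add_cancel (by omega), coeff_pser, if_neg (by omega), if_pos le_rfl,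
      comp_vOfQ_last (by omega), neg_neg])
  rw [← uOf_vOfQ hn] at h
  have h1 : (∀ k ∈ Finset.Icc 1 (n - 1), coeff (k + 1) (genBv a (vOfQ q) (vxOfQ q qx)
      (vxxOfQ q qx qxx)) = a k) ↔
      ∀ k ∈ Finset.Icc 1 (n - 1), coeff (k + 1) (genB (uOf a (vOfQ q)) (pser n 1 (vOfQ q))
        (pser n 0 (vxOfQ q qx)) (pser n 0 (vxxOfQ q qx qxx))) = coeff (k + 1) (aPow a n) := by
    refine forall₂_congr fun k hk => ?_
    rw [Finset.mem_Icc] at hk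
    rw [coeff_aPow, if_neg (by omega), if_pos (by omega), Nat.add_sub_cancel, genBv]
  -- the last equation is the one for `q_n`
  have h2 : coeff (2 * n + 1) (genBv a (vOfQ q) (vxOfQ q qx) (vxxOfQ q qx qxx)) = β ↔
      comp qxx n = -((coeff 1 (pser (n - 1) 1 q) + a 0 / 4) * comp q n
        - β / (4 * comp q n ^ 3)) := by
    rw [coeff_top_genBv (by omega), comp_vOfQ_last (by omega), comp_vxOfQ_last (by omega),
      comp_vxxOfQ_last (by omega), uOf_vOfQ hn]
    constructor
    · rintro rfl
      field_simp
      ring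
    · intro h
      rw [h]
      field_simp
      ring
  rw [IsP1Jet, h1, h, h2, uOf_vOfQ hn]
  constructor
  · rintro ⟨h3, h4⟩ i
    have hi' := i.isLt
    rw [mom1_apply]
    by_cases hi : i.val + 1 = n
    · rw [rev1_last hi, dpot1, if_pos hi, ← h4, ← comp_succ qxx i, hi]
    · have := h3 (i.val + 1) (Finset.mem_Icc.2 ⟨by omega, by omega⟩)
      rw [map_add, coeff_succ_X_mul, coeff_pser, if_neg (by omega),
        if_pos (by omega), comp_succ] at this
      rw [dpot1, val_rev1 hi, if_neg (by omega), force1,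
        show n - (n - (i.val + 1) - 1) = i.val + 1 + 1 by omega]
      linarith
  · intro h3
    constructor
    · intro k hk
      rw [Finset.mem_Icc] at hk
      have := h3 ⟨k - 1, by omega⟩
      rw [mom1_apply, dpot1, val_rev1 (by simp only; omega), if_neg (by simp only; omega)] at this
      rw [map_add, coeff_succ_X_mul, coeff_pser, if_neg (by omega), if_pos hk.2,
        comp_eq _ hk.1 (by omega), this, force1,
        show n - (n - (k - 1 + 1) - 1) = k + 1 by omega]
      ring
    · rw [comp_eq qxx (by omega) le_rfl, h3, mom1_apply, rev1_last (by simp only; omega), dpot1,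
        if_pos (by simp only; omega)]

theorem isP1Jet_accel1 {n : ℕ} (hn : 2 ≤ n) (a : ℕ → ℝ) (β : ℝ) {q : Fin n → ℝ} (hq : comp q n ≠ 0)
    (p qx : Fin n → ℝ) :
    IsP1Jet a β (vOfQ q) (vxOfQ q qx) (vxxOfQ q qx (accel1 n a β q p)) :=
  (isP1Jet_iff hn a β hq qx _).2 fun i => accel1_eq hn a β hq p i

theorem redX_eq (n : ℕ) (a : ℕ → ℝ) (β : ℝ) (j : ℕ) (q p : Fin n → ℝ) :
    redX n a β j q p = (-1 / 8) * coeff (j + n + 1) (genBv a (vOfQ q) (vxOfQ q (mom1 p))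
      (vxxOfQ q (mom1 p) (accel1 n a β q p))) := by
  rw [redX, genBv, ← gd_top]
  rfl

/-! ### Curves in the coordinates `q` -/

theorem hasDerivAt_vOfQ {n : ℕ} {q : ℝ → Fin n → ℝ} {q' : Fin n → ℝ} {x : ℝ}
    (hq : HasDerivAt q q' x) : HasDerivAt (fun y => vOfQ (q y)) (vxOfQ (q x) q' ) x := by
  refine hasDerivAt_of_comp fun k h1 h2 => ?_
  rcases h2.lt_or_eq with h2 | rfl
  · simp only [comp_vOfQ _ h1 h2, comp_vxOfQ _ _ h1 h2]
    exact (HasCoeffDerivAt.pser hq (n - 1) 1).sq k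
  · simp only [comp_vOfQ_last h1, comp_vxOfQ_last h1]
    refine ((hasDerivAt_comp hq k).fun_pow 2).fun_neg.congr_deriv ?_
    ring

theorem hasDerivAt_vxOfQ {n : ℕ} {q w : ℝ → Fin n → ℝ} {w' : Fin n → ℝ} {x : ℝ}
    (hq : HasDerivAt q (w x) x) (hw : HasDerivAt w w' x) :
    HasDerivAt (fun y => vxOfQ (q y) (w y)) (vxxOfQ (q x) (w x) w') x := by
  refine hasDerivAt_of_comp fun k h1 h2 => ?_
  rcases h2.lt_or_eq with h2 | rfl
  · simp only [comp_vxOfQ _ _ h1 h2, comp_vxxOfQ _ _ _ h1 h2]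
    have := (((HasCoeffDerivAt.pser hq (n - 1) 1).mul
      (HasCoeffDerivAt.pser hw (n - 1) 0)).const_mul 2) k
    rwa [← pow_two] at this
  · simp only [comp_vxOfQ_last h1, comp_vxxOfQ_last h1]
    refine (((hasDerivAt_comp hq k).fun_mul (hasDerivAt_comp hw k)).const_mul 2).fun_neg.congr_deriv ?_
    ring

section Smoothness

variable {E : Type*} [NormedAddCommGroup E] [NormedSpace ℝ E]

theorem contDiffOn_vOfQ {n : ℕ} {q : E → Fin n → ℝ} {U : Set E} (hq : ContDiffOn ℝ ∞ q U) :
    ContDiffOn ℝ ∞ (fun x => vOfQ (q x)) U := by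
  refine contDiffOn_of_comp fun k h1 h2 => ?_
  rcases h2.lt_or_eq with h2 | rfl
  · simp only [comp_vOfQ _ h1 h2]
    exact (CoeffSmoothOn.pser hq (n - 1) 1).pow 2 k
  · simp only [comp_vOfQ_last h1]
    exact ((contDiffOn_comp hq k).pow 2).neg

theorem contDiffOn_vxOfQ {n : ℕ} {q w : E → Fin n → ℝ} {U : Set E} (hq : ContDiffOn ℝ ∞ q U)
    (hw : ContDiffOn ℝ ∞ w U) : ContDiffOn ℝ ∞ (fun x => vxOfQ (q x) (w x)) U := by
  refine contDiffOn_of_comp fun k h1 h2 => ?_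
  rcases h2.lt_or_eq with h2 | rfl
  · simp only [comp_vxOfQ _ _ h1 h2]
    exact (CoeffSmoothOn.const 2 U).mul
      ((CoeffSmoothOn.pser hq (n - 1) 1).mul (CoeffSmoothOn.pser hw (n - 1) 0)) k
  · simp only [comp_vxOfQ_last h1]
    exact (contDiffOn_const.mul ((contDiffOn_comp hq k).mul (contDiffOn_comp hw k))).neg

theorem contDiffOn_vxxOfQ {n : ℕ} {q w z : E → Fin n → ℝ} {U : Set E} (hq : ContDiffOn ℝ ∞ q U)
    (hw : ContDiffOn ℝ ∞ w U) (hz : ContDiffOn ℝ ∞ z U) :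
    ContDiffOn ℝ ∞ (fun x => vxxOfQ (q x) (w x) (z x)) U := by
  refine contDiffOn_of_comp fun k h1 h2 => ?_
  rcases h2.lt_or_eq with h2 | rfl
  · simp only [comp_vxxOfQ _ _ _ h1 h2]
    exact (CoeffSmoothOn.const 2 U).mul (((CoeffSmoothOn.pser hw (n - 1) 0).pow 2).add
      ((CoeffSmoothOn.pser hq (n - 1) 1).mul (CoeffSmoothOn.pser hz (n - 1) 0))) k
  · simp only [comp_vxxOfQ_last h1]
    exact (contDiffOn_const.mul (((contDiffOn_comp hw k).pow 2).add
      ((contDiffOn_comp hq k).mul (contDiffOn_comp hz k)))).neg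

theorem contDiffOn_accel1 {n : ℕ} (hn : 2 ≤ n) (a : ℕ → ℝ) {β : E → ℝ} {q p : E → Fin n → ℝ}
    {U : Set E} (hβ : ContDiffOn ℝ ∞ β U) (hq : ContDiffOn ℝ ∞ q U)
    (hU : ∀ x ∈ U, comp (q x) n ≠ 0) :
    ContDiffOn ℝ ∞ (fun x => accel1 n a (β x) (q x) (p x)) U := by
  rw [contDiffOn_pi]
  intro i
  have h : ∀ x ∈ U, accel1 n a (β x) (q x) (p x) i = -dpot1 n a (β x) (q x) (rev1 i) := by
    intro x hx
    rw [accel1_eq hn a _ (hU x hx), mom1_apply]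
  exact (contDiffOn_dpot1 n a hβ hq hU _).neg.congr h

theorem contDiffOn_redX {n : ℕ} (hn : 2 ≤ n) (a : ℕ → ℝ) (j : ℕ) {β : E → ℝ} {q p : E → Fin n → ℝ}
    {U : Set E} (hβ : ContDiffOn ℝ ∞ β U) (hq : ContDiffOn ℝ ∞ q U) (hp : ContDiffOn ℝ ∞ p U)
    (hU : ∀ x ∈ U, comp (q x) n ≠ 0) :
    ContDiffOn ℝ ∞ (fun x => redX n a (β x) j (q x) (p x)) U := by
  simp only [redX_eq]
  exact contDiffOn_const.mul (coeffSmoothOn_genBv a (contDiffOn_vOfQ hq)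
    (contDiffOn_vxOfQ hq (contDiffOn_mom1 hp)) (contDiffOn_vxxOfQ hq (contDiffOn_mom1 hp)
      (contDiffOn_accel1 hn a hβ hq hU)) _)

end Smoothness

theorem contDiffOn_qCoord {n : ℕ} (hn : 1 ≤ n) :
    ContDiffOn ℝ ∞ (qCoord : (Fin n → ℝ) → Fin n → ℝ) {v | comp v n < 0} := by
  refine contDiffOn_of_comp fun k h1 h2 => ?_
  rcases h2.lt_or_eq with h2 | rfl
  · simp only [comp_qCoord _ h1 h2]
    exact contDiffOn_comp contDiff_rCoord.contDiffOn k
  · simp only [comp_qCoord_last hn]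
    refine (contDiff_comp k).contDiffOn.neg.sqrt fun v hv => ?_
    rw [mem_ofPred_eq] at hv
    linarith

theorem p1System_iff {n : ℕ} (a : ℕ → ℝ) (β : ℝ) (I : Set ℝ) (v : ℝ → Fin n → ℝ) :
    P1System a β I v ↔ ∀ x ∈ I, IsP1Jet a β (v x) (deriv v x) (deriv (deriv v) x) := by
  refine forall₂_congr fun x _ => ?_
  simp only [gdAlong_zero]
  rw [gdAlong_top, ← two_mul, IsP1Jet]

theorem deriv_vOfQ {n : ℕ} {I : Set ℝ} (hI : IsOpen I) {q : ℝ → Fin n → ℝ}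
    (hq : ∀ x ∈ I, HasDerivAt q (deriv q x) x)
    (hq' : ∀ x ∈ I, HasDerivAt (deriv q) (deriv (deriv q) x) x) {x : ℝ} (hx : x ∈ I) :
    deriv (fun y => vOfQ (q y)) x = vxOfQ (q x) (deriv q x) ∧
    deriv (deriv fun y => vOfQ (q y)) x =
      vxxOfQ (q x) (deriv q x) (deriv (deriv q) x) := by
  refine ⟨(hasDerivAt_vOfQ (hq x hx)).deriv, ?_⟩
  have h : deriv (fun y => vOfQ (q y)) =ᶠ[nhds x] fun y => vxOfQ (q y) (deriv q y) := by
    filter_upwards [hI.mem_nhds hx] with y hy using (hasDerivAt_vOfQ (hq y hy)).deriv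
  rw [h.deriv_eq, (hasDerivAt_vxOfQ (hq x hx) (hq' x hx)).deriv]

theorem contDiffOn_qCoord_comp {n : ℕ} (hn : 1 ≤ n) {I : Set ℝ} {v : ℝ → Fin n → ℝ}
    (hv : ContDiffOn ℝ 2 v I) (hneg : ∀ x ∈ I, comp (v x) n < 0) :
    ContDiffOn ℝ 2 (fun x => qCoord (v x)) I :=
  ((contDiffOn_qCoord hn).of_le (by norm_cast)).comp hv hneg

theorem comp_qCoord_pos {n : ℕ} (hn : 1 ≤ n) {v : Fin n → ℝ} (hv : comp v n < 0) :
    0 < comp (qCoord v) n := by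
  rw [comp_qCoord_last hn]
  exact Real.sqrt_pos.2 (by linarith)

/-- Where `v_n < 0`, the `P₁`-system is equivalent to the Euler--Lagrange equations of `L_n^{(1)}` and
to the canonical equations of `H_n^{(1)}`. -/
theorem p1System_equiv {n : ℕ} (hn : 2 ≤ n) (a : ℕ → ℝ) (β : ℝ) {I : Set ℝ} (hI : IsOpen I)
    {v : ℝ → Fin n → ℝ} (hv : ContDiffOn ℝ 2 v I) (hneg : ∀ x ∈ I, comp (v x) n < 0) :
    (P1System a β I v ↔ EulerLagrange (L1 n a β) I (fun x => qCoord (v x))) ∧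
    (P1System a β I v ↔ HamiltonEqs (H1 n a β) I (fun x => qCoord (v x))
      (fun x => mom1 (deriv (fun y => qCoord (v y)) x))) := by
  have hq := contDiffOn_qCoord_comp (by omega) hv hneg
  have hU : ∀ x ∈ I, comp (qCoord (v x)) n ≠ 0 := fun x hx =>
    (comp_qCoord_pos (by omega) (hneg x hx)).ne'
  have h := mechanics_iff (L := L1 n a β) (H := H1 n a β) (mom := mom1) (σ := rev1)
    (F := dpot1 n a β) (U := {q | comp q n ≠ 0}) mom1_apply mom1_mom1
    (fun q hq w k => pd_L1_fst hn a β hq w k) (pd_L1_snd hn a β)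
    (fun q hq w k => pd_H1_fst hn a β hq w k) (pd_H1_snd hn a β) hI hq hU
  have key : P1System a β I v ↔ ∀ x ∈ I, ∀ k, deriv (deriv fun y => qCoord (v y)) x k =
      -mom1 (dpot1 n a β (qCoord (v x))) k := by
    obtain ⟨h1, h2⟩ := hasDerivAt_deriv_of_contDiffOn hI hq
    rw [p1System_iff]
    refine forall₂_congr fun x hx => ?_
    obtain ⟨e1, e2⟩ := deriv_vOfQ hI h1 h2 hx
    have hvq : v =ᶠ[nhds x] fun y => vOfQ (qCoord (v y)) := by
      filter_upwards [hI.mem_nhds hx] with y hy using (vOfQ_qCoord (hneg y hy)).symm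
    rw [← hvq.deriv_eq] at e1
    rw [← hvq.deriv.deriv_eq] at e2
    rw [e1, e2]
    have h3 := isP1Jet_iff hn a β (hU x hx) (deriv (fun y => qCoord (v y)) x)
      (deriv (deriv fun y => qCoord (v y)) x)
    rwa [vOfQ_qCoord (hneg x hx)] at h3
  rw [key]
  exact ⟨h.1.symm, h.2.symm⟩

theorem IsP1Jet.coeff_eq {n : ℕ} (hn : 2 ≤ n) {a : ℕ → ℝ} {β : ℝ} {v vx vxx : Fin n → ℝ}
    (h : IsP1Jet a β v vx vxx) {k : ℕ} (hk : k ≤ n) :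
    coeff k (genBv a v vx vxx) = coeff k (aPow a n) := by
  cases k with
  | zero =>
    rw [coeff_zero_genBv, coeff_aPow]
    simp
  | succ k =>
    rw [coeff_aPow, if_neg (by omega), if_pos hk, Nat.add_sub_cancel]
    rcases Nat.eq_zero_or_pos k with rfl | h0
    · rw [zero_add, coeff_one_genBv (by omega)]
    · exact h.1 k (Finset.mem_Icc.2 ⟨h0, by omega⟩)

/-- Along a canonical curve with `q_n ≠ 0` the Gelfand--Dickey polynomials are constant; `a_{2n}` is
prescribed in place of `a_n`, which suffices because `v_n ≠ 0`. -/
theorem hamiltonEqs1_integrals {n : ℕ} (hn : 2 ≤ n) (a : ℕ → ℝ) (β : ℝ) {I : Set ℝ} (hI : IsOpen I)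
    (hc : IsPreconnected I) {q p : ℝ → Fin n → ℝ} (hU : ∀ x ∈ I, comp (q x) n ≠ 0)
    (h : HamiltonEqs (H1 n a β) I q p) (j : ℕ) :
    ∃ A : ℝ, ∀ x ∈ I, gdAlong a (fun y => vOfQ (q y)) x j n = A ∧
      redX n a β j (q x) (p x) = -A / 8 := by
  have hq : ∀ x ∈ I, HasDerivAt q (mom1 (p x)) x := fun x hx => by
    have := (h x hx).1
    simpa only [pd_H1_snd hn] using this
  have hp : ∀ x ∈ I, HasDerivAt (fun y => mom1 (p y)) (accel1 n a β (q x) (p x)) x := fun x hx => by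
    rw [hasDerivAt_pi]
    intro i
    simp only [mom1_apply, accel1]
    exact hasDerivAt_pi.1 (h x hx).2 (rev1 i)
  have hq1 : ∀ x ∈ I, deriv q x = mom1 (p x) := fun x hx => (hq x hx).deriv
  have hq2 : ∀ x ∈ I, HasDerivAt (deriv q) (accel1 n a β (q x) (p x)) x := fun x hx => by
    refine (hp x hx).congr_of_eventuallyEq ?_
    filter_upwards [hI.mem_nhds hx] with y hy using hq1 y hy
  have hvxx : ∀ x ∈ I, DifferentiableAt ℝ
      (fun y => vxxOfQ (q y) (mom1 (p y)) (accel1 n a β (q y) (p y))) x := by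
    intro x hx
    have hz : DifferentiableAt ℝ (fun y => (q y, p y)) x :=
      (hq x hx).differentiableAt.prodMk (h x hx).2.differentiableAt
    have hF : ContDiffOn ℝ ∞ (fun z : (Fin n → ℝ) × (Fin n → ℝ) =>
        vxxOfQ z.1 (mom1 z.2) (accel1 n a β z.1 z.2)) {z | comp z.1 n ≠ 0} :=
      contDiffOn_vxxOfQ contDiffOn_fst (contDiffOn_mom1 contDiffOn_snd)
        (contDiffOn_accel1 hn a contDiffOn_const contDiffOn_fst fun _ hz => hz)
    have hd : DifferentiableAt ℝ (fun z : (Fin n → ℝ) × (Fin n → ℝ) =>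
        vxxOfQ z.1 (mom1 z.2) (accel1 n a β z.1 z.2)) (q x, p x) :=
      (hF.differentiableOn (by simp)).differentiableAt
        (((isOpen_comp_ne n).preimage continuous_fst).mem_nhds (hU x hx))
    exact hd.fun_comp' x hz
  have hjet : ∀ x ∈ I, IsP1Jet a β (vOfQ (q x)) (vxOfQ (q x) (mom1 (p x)))
      (vxxOfQ (q x) (mom1 (p x)) (accel1 n a β (q x) (p x))) :=
    fun x hx => isP1Jet_accel1 hn a β (hU x hx) (p x) _
  have hlow : ∀ k ≤ n, ∃ c, ∀ x ∈ I, coeff k (genBv a (vOfQ (q x)) (vxOfQ (q x) (mom1 (p x)))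
      (vxxOfQ (q x) (mom1 (p x)) (accel1 n a β (q x) (p x)))) = c :=
    fun k hk => ⟨_, fun x hx => (hjet x hx).coeff_eq hn hk⟩
  have hne : ∀ x ∈ I, comp (vOfQ (q x)) n ≠ 0 := fun x hx => by
    rw [comp_vOfQ_last (by omega), neg_ne_zero]
    exact pow_ne_zero 2 (hU x hx)
  obtain ⟨A, hA⟩ := exists_eq_of_genBv a hI hc (v := fun x => vOfQ (q x))
    (vx := fun x => vxOfQ (q x) (mom1 (p x)))
    (vxx := fun x => vxxOfQ (q x) (mom1 (p x)) (accel1 n a β (q x) (p x)))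
    (fun x hx => hasDerivAt_vOfQ (hq x hx)) (fun x hx => hasDerivAt_vxOfQ (hq x hx) (hp x hx)) hvxx
    hlow (Or.inr ⟨hne, β, fun x hx => (hjet x hx).2⟩) (j + n + 1)
  refine ⟨A, fun x hx => ⟨?_, ?_⟩⟩
  · obtain ⟨e1, e2⟩ := deriv_vOfQ hI (fun x hx => (hq x hx).differentiableAt.hasDerivAt)
      (fun x hx => (hq2 x hx).differentiableAt.hasDerivAt) hx
    rw [gdAlong_top, e1, e2, (hq2 x hx).deriv, hq1 x hx, hA x hx]
  · rw [redX_eq, hA x hx]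
    ring

/-! ### The Lagrangian `L_n^{(1)}` -/

theorem kin1_eq {n : ℕ} (hn : 1 ≤ n) (w : Fin n → ℝ) :
    kin1 w = 1 / 2 * ∑ i, w i * w (rev1 i) := by
  obtain ⟨m, rfl⟩ : ∃ m, n = m + 1 := ⟨n - 1, by omega⟩
  have h : (fun i : Fin m => w i.castSucc * w (rev1 i.castSucc)) = fun i : Fin m =>
      (fun k => coeff (k + 1) (pser m 0 w) * coeff (m - k) (pser m 0 w)) i.val := by
    funext i
    have hi := i.isLt
    simp only [coeff_pser]
    rw [if_neg (by omega), if_pos (by omega), if_neg (by omega), if_pos (by omega),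
      ← comp_succ w i.castSucc, ← comp_succ w (rev1 _), val_rev1 (by simp; omega)]
    congr 2
    simp only [Fin.val_castSucc]
    omega
  have hl : w (Fin.last m) * w (rev1 (Fin.last m)) = comp w (m + 1) ^ 2 := by
    rw [rev1_last (by simp), ← comp_succ w (Fin.last m), pow_two]
    rfl
  rw [kin1, Fin.sum_univ_castSucc, hl, h,
    Fin.sum_univ_eq_sum_range (fun k => coeff (k + 1) (pser m 0 w) * coeff (m - k) (pser m 0 w)),
    Nat.add_sub_cancel,
    pow_two, coeff_mul, Finset.Nat.sum_antidiagonal_eq_sum_range_succ (fun i j =>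
      coeff i (pser m 0 w) * coeff j (pser m 0 w)), Finset.sum_range_succ, Finset.sum_range_succ']
  simp
  ring

/-- The metric of the kinetic energy is the matrix of the involution `rev1`. -/
theorem isNaturalLagrangian_L1 {n : ℕ} (hn : 2 ≤ n) (a : ℕ → ℝ) (β : ℝ) :
    IsNaturalLagrangian (L1 n a β) {q | comp q n ≠ 0} := by
  let σ : Equiv.Perm (Fin n) := Function.Involutive.toPerm rev1 rev1_rev1
  refine ⟨fun _ => (1 : Matrix (Fin n) (Fin n) ℝ).submatrix σ id, pot1 n a β,
    fun _ _ => contDiffOn_const,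
    contDiffOn_pot1 n a contDiffOn_const contDiffOn_id fun _ h => h, fun q _ => ⟨?_, ?_, fun w => ?_⟩⟩
  · ext i j
    simp only [Matrix.transpose_apply, Matrix.submatrix_apply, id, Matrix.one_apply]
    congr 1
    rw [eq_iff_iff]
    change rev1 j = i ↔ rev1 i = j
    constructor <;> rintro rfl <;> exact rev1_rev1 _
  · rw [Matrix.det_permute, Matrix.det_one, mul_one]
    norm_cast
    exact Units.ne_zero _
  · rw [L1_eq hn, kin1_eq (by omega)]
    simp [Matrix.one_apply, mul_comm, σ]
    rfl

theorem isCanonicalForm_L1 {n : ℕ} (hn : 2 ≤ n) (a : ℕ → ℝ) (β : ℝ) :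
    IsCanonicalForm (L1 n a β) (H1 n a β) mom1 {q | comp q n ≠ 0} := by
  refine ⟨Function.Involutive.bijective mom1_mom1, fun q _ w => ⟨pd_L1_snd hn a β q w, ?_⟩⟩
  have h : ∑ k, mom1 w k * w k = ∑ k, w k * w (rev1 k) :=
    Finset.sum_congr rfl fun k _ => by rw [mom1_apply, mul_comm]
  have h2 : ∑ k, mom1 w k * mom1 w (rev1 k) = ∑ k, w k * w (rev1 k) := by
    refine Finset.sum_congr rfl fun k _ => ?_
    rw [mom1_apply, mom1_apply, rev1_rev1, mul_comm]
  rw [H1_eq hn, L1_eq hn, kin1_eq (by omega), kin1_eq (by omega), h, h2]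
  ring

/-! ### Independence of the integrals -/

/-- `c λ^n + ∑_{k=1}^n x_k λ^{n-k}`, as a polynomial in `λ`. -/
def lamPoly {n : ℕ} (c : ℝ) (x : Fin n → ℝ) : Polynomial ℝ :=
  Polynomial.reflect n (trunc (n + 1) (pser n c x))

theorem coeff_lamPoly {n : ℕ} (c : ℝ) (x : Fin n → ℝ) {j : ℕ} (hj : j ≤ n) :
    (lamPoly c x).coeff j = coeff (n - j) (pser n c x) := by
  rw [lamPoly, Polynomial.coeff_reflect, Polynomial.revAt_le hj, coeff_trunc, if_pos (by omega)]

theorem coeff_lamPoly_of_lt {n : ℕ} (c : ℝ) (x : Fin n → ℝ) {j : ℕ} (hj : n < j) :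
    (lamPoly c x).coeff j = 0 := by
  rw [lamPoly, Polynomial.coeff_reflect, Polynomial.revAt_eq_self_of_lt hj, coeff_trunc,
    if_neg (by omega)]

theorem coe_trunc_pser {n : ℕ} (c : ℝ) (x : Fin n → ℝ) :
    ((trunc (n + 1) (pser n c x) : Polynomial ℝ) : ℝ⟦X⟧) = pser n c x := by
  ext j
  rw [Polynomial.coeff_coe, coeff_trunc]
  split_ifs with h
  · rfl
  · rw [coeff_pser_of_lt c x (by omega)]

theorem lamPoly_mul_eq {n : ℕ} {c d c' d' : ℝ} {x y x' y' : Fin n → ℝ}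
    (h : pser n c x * pser n d y = pser n c' x' * pser n d' y') :
    lamPoly c x * lamPoly d y = lamPoly c' x' * lamPoly d' y' := by
  have hd : ∀ (c : ℝ) (x : Fin n → ℝ), (trunc (n + 1) (pser n c x)).natDegree ≤ n := fun c x =>
    Nat.lt_succ_iff.1 (natDegree_trunc_lt _ _)
  have h' : trunc (n + 1) (pser n c x) * trunc (n + 1) (pser n d y) =
      trunc (n + 1) (pser n c' x') * trunc (n + 1) (pser n d' y') := by
    apply Polynomial.coe_injective ℝ
    rw [Polynomial.coe_mul, Polynomial.coe_mul, coe_trunc_pser, coe_trunc_pser, coe_trunc_pser,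
      coe_trunc_pser, h]
  unfold lamPoly
  rw [← Polynomial.reflect_mul _ _ (hd _ _) (hd _ _), h', Polynomial.reflect_mul _ _ (hd _ _) (hd _ _)]

theorem lamPoly_one_ne_zero {n : ℕ} (v : Fin n → ℝ) : lamPoly 1 v ≠ 0 := by
  intro h
  have := coeff_lamPoly 1 v le_rfl
  rw [h] at this
  simp at this

/-- If `v(λ)` and `v_x(λ)` have no common root, then `v η = v_x g` only for `g = 0`. -/
theorem eq_zero_of_isCoprime {n : ℕ} {v vx η g : Fin n → ℝ}
    (hc : IsCoprime (lamPoly 1 v) (lamPoly 0 vx))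
    (h : pser n 1 v * pser n 0 η = pser n 0 vx * pser n 0 g) : g = 0 := by
  have hdvd : lamPoly 1 v ∣ lamPoly 0 g :=
    hc.dvd_of_dvd_mul_left ⟨lamPoly 0 η, (lamPoly_mul_eq h).symm⟩
  have hdeg : (lamPoly 0 g).degree < n := by
    rw [Polynomial.degree_lt_iff_coeff_zero]
    intro j hj
    rcases hj.lt_or_eq with h | rfl
    · exact coeff_lamPoly_of_lt 0 g h
    · rw [coeff_lamPoly 0 g le_rfl]
      simp
  have hdeg1 : (n : WithBot ℕ) ≤ (lamPoly 1 v).degree := by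
    refine Polynomial.le_degree_of_ne_zero ?_
    rw [coeff_lamPoly 1 v le_rfl]
    simp
  have h0 := Polynomial.eq_zero_of_dvd_of_degree_lt hdvd (hdeg.trans_le hdeg1)
  refine fun_eq_of_comp fun k hk => ?_
  rw [Finset.mem_Icc] at hk
  have := coeff_lamPoly 0 g (j := n - k) (by omega)
  rw [h0, Nat.sub_sub_self hk.2, coeff_pser, if_neg (by omega), if_pos hk.2] at this
  rw [← this]
  simp [comp]

/-- A nonzero polynomial is coprime to almost all translates of another one. -/
theorem eventually_isCoprime (V W : Polynomial ℝ) (hV : V ≠ 0) {κ : ℝ} (hκ : κ ≠ 0) :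
    ∀ᶠ ε in nhdsWithin (0 : ℝ) {0}ᶜ, IsCoprime V (W + Polynomial.C (κ * ε)) := by
  classical
  -- an irreducible factor of `V` divides at most one translate
  have hfin : {ε : ℝ | ¬ IsCoprime V (W + Polynomial.C (κ * ε))}.Finite := by
    refine Set.Finite.subset
      (s := ⋃ p ∈ ((UniqueFactorizationMonoid.normalizedFactors V).toFinset : Set (Polynomial ℝ)),
        {ε : ℝ | Irreducible p ∧ p ∣ W + Polynomial.C (κ * ε)}) ?_ ?_
    · refine Set.Finite.biUnion (Finset.finite_toSet _) fun p _ => Set.Subsingleton.finite ?_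
      rintro ε ⟨hp, hε⟩ ε' ⟨-, hε'⟩
      by_contra hne
      have h := dvd_sub hε hε'
      rw [add_sub_add_left_eq_sub, ← Polynomial.C_sub, ← mul_sub] at h
      refine hp.not_isUnit (isUnit_of_dvd_unit h ?_)
      rw [Polynomial.isUnit_C]
      exact (mul_ne_zero hκ (sub_ne_zero.2 hne)).isUnit
    · intro ε hε
      by_contra hnot
      refine hε (isCoprime_of_irreducible_dvd (fun h => hV h.1) fun z hz hzV hzW => hnot ?_)
      obtain ⟨p, hp, hassoc⟩ :=
        UniqueFactorizationMonoid.exists_mem_normalizedFactors_of_dvd hV hz hzV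
      refine Set.mem_biUnion (x := p) (Finset.mem_coe.2 (Multiset.mem_toFinset.2 hp)) ⟨hassoc.irreducible hz, ?_⟩
      exact hassoc.dvd_iff_dvd_left.1 hzW
  have hcl := (hfin.subset (sdiff_subset (t := {0}))).isClosed
  have h0 : (0 : ℝ) ∉ {ε : ℝ | ¬ IsCoprime V (W + Polynomial.C (κ * ε))} \ {0} := by simp
  filter_upwards [self_mem_nhdsWithin, mem_nhdsWithin_of_mem_nhds (hcl.isOpen_compl.mem_nhds h0)]
    with ε h1 h2
  by_contra h3
  exact h2 ⟨h3, h1⟩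

/-- Covectors on the phase space are independent as soon as their restrictions to the space of momenta
have no common zero. -/
theorem linearIndependent_of_injective_snd {n : ℕ}
    (φ : Fin n → ((Fin n → ℝ) × (Fin n → ℝ)) →L[ℝ] ℝ)
    (h : ∀ σ : Fin n → ℝ, (∀ j, φ j (0, σ) = 0) → σ = 0) : LinearIndependent ℝ φ := by
  let T : (Fin n → ℝ) →ₗ[ℝ] (Fin n → ℝ) :=
    LinearMap.pi fun j => (φ j).toLinearMap.comp (LinearMap.inr ℝ (Fin n → ℝ) (Fin n → ℝ))
  have hT : ∀ σ j, T σ j = φ j (0, σ) := fun σ j => rfl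
  have hinj : Function.Injective T := by
    rw [← LinearMap.ker_eq_bot, LinearMap.ker_eq_bot']
    intro σ hσ
    exact h σ fun j => by rw [← hT, hσ]; rfl
  rw [Fintype.linearIndependent_iff]
  intro c hc
  obtain ⟨σ, hσ⟩ := LinearMap.injective_iff_surjective.1 hinj c
  have h1 : ∑ j, c j * c j = 0 := by
    have := congrArg (fun ψ : ((Fin n → ℝ) × (Fin n → ℝ)) →L[ℝ] ℝ => ψ (0, σ)) hc
    simp only [sum_apply, smul_apply, smul_eq_mul,
      zero_apply] at this
    rw [← this]
    refine Finset.sum_congr rfl fun j _ => ?_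
    rw [← hT, hσ]
  intro i
  exact mul_self_eq_zero.1
    ((Finset.sum_eq_zero_iff_of_nonneg fun j _ => mul_self_nonneg (c j)).1 h1 i (Finset.mem_univ i))

theorem fderiv_snd_eq {n : ℕ} {F : (Fin n → ℝ) × (Fin n → ℝ) → ℝ} {z : (Fin n → ℝ) × (Fin n → ℝ)}
    (hF : DifferentiableAt ℝ F z) {σ : Fin n → ℝ} {d : ℝ}
    (h : HasDerivAt (fun ε : ℝ => F (z.1, z.2 + ε • σ)) d 0) : fderiv ℝ F z (0, σ) = d := by
  have hl : HasDerivAt (fun ε : ℝ => (z.1, z.2 + ε • σ)) (0, σ) 0 := by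
    have := ((hasDerivAt_id (0 : ℝ)).smul_const σ).const_add z.2
    exact (hasDerivAt_const (0 : ℝ) z.1).prodMk (by simpa using this)
  have hf' : HasFDerivAt F (fderiv ℝ F z) (z.1, z.2 + (0 : ℝ) • σ) := by
    simpa using hF.hasFDerivAt
  exact (hf'.comp_hasDerivAt (0 : ℝ) hl).unique h

/-- The variation of `B^λ(v, v)` with respect to `v_x` and `v_{xx}`. -/
theorem hasCoeffDerivAt_genBv_of_const {n : ℕ} (a : ℕ → ℝ) (v : Fin n → ℝ) {vx vxx : ℝ → Fin n → ℝ}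
    {g η : Fin n → ℝ} {x : ℝ} (hvx : HasDerivAt vx g x) (hvxx : HasDerivAt vxx η x) :
    HasCoeffDerivAt (fun y => genBv a v (vx y) (vxx y))
      (C 2 * (X * (pser n 1 v * pser n 0 η - pser n 0 (vx x) * pser n 0 g))) x := by
  have h2 := HasCoeffDerivAt.pser hvx n 0
  have h3 := HasCoeffDerivAt.pser hvxx n 0
  have h := (((h3.const_mul (2 * pser n 1 v)).sub h2.sq).const_mul X).add
    (HasCoeffDerivAt.const ((C (4 * uOf a v) * X - 1) * pser n 1 v ^ 2) x)
  have h' : HasCoeffDerivAt (fun y => genBv a v (vx y) (vxx y)) _ x := h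
  convert h' using 1
  rw [map_ofNat]
  ring

/-- If along a variation of `v_x` and `v_{xx}` the derivatives of all the coefficients of
`B^λ(v, v)` from `λ^{-1}` to `λ^{-2n}` vanish, and `v(λ)`, `v_x(λ)` are coprime, then the variation
of `v_x` vanishes. -/
theorem eq_zero_of_genBv_variation {n : ℕ} (hn : 1 ≤ n) (a : ℕ → ℝ) (v : Fin n → ℝ)
    {vx vxx : ℝ → Fin n → ℝ} {g η : Fin n → ℝ} {x : ℝ} (hvx : HasDerivAt vx g x)
    (hvxx : HasDerivAt vxx η x) (hc : IsCoprime (lamPoly 1 v) (lamPoly 0 (vx x)))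
    (h : ∀ k, 2 ≤ k → k ≤ 2 * n + 1 →
      HasDerivAt (fun y => coeff k (genBv a v (vx y) (vxx y))) 0 x) : g = 0 := by
  have hd := hasCoeffDerivAt_genBv_of_const a v hvx hvxx
  refine eq_zero_of_isCoprime hc (η := η) ?_
  rw [← sub_eq_zero]
  set D := pser n 1 v * pser n 0 η - pser n 0 (vx x) * pser n 0 g with hD
  ext k
  rw [map_zero]
  have hz : HasDerivAt (fun y => coeff (k + 1) (genBv a v (vx y) (vxx y))) 0 x → coeff k D = 0 := by
    intro h0
    have := (hd (k + 1)).unique h0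
    rw [coeff_C_mul, coeff_succ_X_mul] at this
    linarith
  rcases Nat.eq_zero_or_pos k with rfl | hk
  · refine hz ?_
    simp only [zero_add, coeff_one_genBv hn]
    exact hasDerivAt_const _ _
  rcases le_or_gt k (2 * n) with h1 | h1
  · exact hz (h (k + 1) (by omega) (by omega))
  · rw [hD, map_sub, coeff_mul_pser_above h1 (fun j hj => coeff_pser_of_lt 1 v hj)
      (fun j hj => coeff_pser_of_lt 0 η hj), coeff_mul_pser_above h1
      (fun j hj => coeff_pser_of_lt 0 (vx x) hj) (fun j hj => coeff_pser_of_lt 0 g hj), sub_zero]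

theorem hasDerivAt_add_smul {n : ℕ} (s σ : Fin n → ℝ) :
    HasDerivAt (fun ε : ℝ => s + ε • σ) σ 0 := by
  simpa using ((hasDerivAt_id (0 : ℝ)).smul_const σ).const_add s

theorem contDiff_add_smul {n : ℕ} (s σ : Fin n → ℝ) :
    ContDiff ℝ ∞ (fun ε : ℝ => s + ε • σ) :=
  contDiff_const.add (contDiff_id.smul contDiff_const)

theorem vxOfR_injective {n : ℕ} (r : Fin n → ℝ) : Function.Injective (vxOfR r) := by
  intro w z h
  have h0 : constantCoeff (2 * pser n 1 r) ≠ 0 := by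
    rw [map_mul, map_ofNat, constantCoeff_pser]
    norm_num
  have h1 : ∀ k < n + 1, coeff k (2 * pser n 1 r * pser n 0 w) =
      coeff k (2 * pser n 1 r * pser n 0 z) := by
    intro k hk
    rw [mul_assoc, mul_assoc, ← coeff_pser_vxOfR r w k hk, ← coeff_pser_vxOfR r z k hk, h]
  refine fun_eq_of_comp fun k hk => ?_
  rw [Finset.mem_Icc] at hk
  have := coeff_eq_of_mul h0 h1 k (by omega)
  rwa [coeff_pser, coeff_pser, if_neg (by omega), if_pos hk.2, if_neg (by omega), if_pos hk.2]
    at this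

theorem vxOfR_zero {n : ℕ} (r : Fin n → ℝ) : vxOfR r 0 = 0 := by
  refine fun_eq_of_comp fun k hk => ?_
  rw [Finset.mem_Icc] at hk
  have h0 : pser n 0 (0 : Fin n → ℝ) = 0 := by
    ext j
    simp [comp]
  rw [comp_vxOfR _ _ hk.1 hk.2, h0]
  simp [comp]

theorem hasDerivAt_vxOfR_snd {n : ℕ} (r : Fin n → ℝ) {w : ℝ → Fin n → ℝ} {w' : Fin n → ℝ} {x : ℝ}
    (hw : HasDerivAt w w' x) : HasDerivAt (fun y => vxOfR r (w y)) (vxOfR r w') x := by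
  refine hasDerivAt_of_comp fun k h1 h2 => ?_
  simp only [comp_vxOfR _ _ h1 h2]
  exact (((HasCoeffDerivAt.pser hw n 0).const_mul (pser n 1 r)).const_mul 2) k

/-- Where `v(λ)` and `v_x(λ)` are coprime, the differentials of the `K_j` are independent already on
variations of the momenta. -/
theorem mem_independentY {n : ℕ} (hn : 1 ≤ n) (a : ℕ → ℝ) (α : ℝ) {r s : Fin n → ℝ}
    (hc : IsCoprime (lamPoly 1 (vOfR r)) (lamPoly 0 (vxOfR r (mom0 s)))) :
    (r, s) ∈ independentY n a α := by
  refine linearIndependent_of_injective_snd _ fun σ hσ => ?_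
  set vx : ℝ → Fin n → ℝ := fun ε => vxOfR r (mom0 (s + ε • σ)) with hvx
  set vxx : ℝ → Fin n → ℝ := fun ε =>
    vxxOfR r (mom0 (s + ε • σ)) (accel0 n a α r (s + ε • σ)) with hvxx
  have hline := contDiff_add_smul s σ
  have h1 : HasDerivAt vx (vxOfR r (mom0 σ)) 0 := by
    refine hasDerivAt_vxOfR_snd r ?_
    rw [hasDerivAt_pi]
    exact fun i => hasDerivAt_pi.1 (hasDerivAt_add_smul s σ) i.rev
  have h2 : HasDerivAt vxx (deriv vxx 0) 0 := by
    have : ContDiff ℝ ∞ vxx := contDiffOn_univ.1 (contDiffOn_vxxOfR contDiffOn_const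
      (contDiffOn_mom0 hline.contDiffOn) (contDiffOn_accel0 n a contDiffOn_const contDiffOn_const))
    exact (this.differentiable (by simp) 0).hasDerivAt
  have hg : vxOfR r (mom0 σ) = 0 := by
    refine eq_zero_of_genBv_variation hn a (vOfR r) h1 h2 ?_ fun k hk2 hk => ?_
    · simpa [hvx] using hc
    · rcases le_or_gt k (n + 1) with hkn | hkn
      · have : (fun y => coeff k (genBv a (vOfR r) (vx y) (vxx y))) =
            fun _ => coeff k (aPow0 a n α) := by
          funext y
          exact (isP0Jet_accel0 hn a α r (s + y • σ) _).coeff_eq hn hkn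
        rw [this]
        exact hasDerivAt_const _ _
      · have hdiff : DifferentiableAt ℝ (fun y : (Fin n → ℝ) × (Fin n → ℝ) =>
            redY n a α (k - (n + 2) + 1) y.1 y.2) (r, s) :=
          (contDiffOn_univ.1 (contDiffOn_redY n a _ contDiffOn_const contDiffOn_fst
            contDiffOn_snd)).differentiable (by simp) _
        have hd : HasDerivAt (fun y => coeff k (genBv a (vOfR r) (vx y) (vxx y))) _ 0 :=
          hasCoeffDerivAt_genBv_of_const a (vOfR r) h1 h2 k
        have h3 := fderiv_snd_eq hdiff (σ := σ)
          ((hd.const_mul (-1 / 8)).congr_of_eventuallyEq (Filter.Eventually.of_forall fun ε => by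
            simp only [redY_eq]
            rw [show k - (n + 2) + 1 + n + 1 = k by omega]))
        have h4 := hσ ⟨k - (n + 2), by omega⟩
        rw [h3] at h4
        convert hd using 1
        linarith
  have := vxOfR_injective r (hg.trans (vxOfR_zero r).symm)
  rw [← mom0_mom0 σ, this]
  rfl

theorem isOpen_independentY (n : ℕ) (a : ℕ → ℝ) (α : ℝ) : IsOpen (independentY n a α) := by
  refine isOpen_setOfPred_linearIndependent.preimage (continuous_pi fun j => ?_)
  exact (contDiffOn_univ.1 (contDiffOn_redY n a (j.val + 1) contDiffOn_const contDiffOn_fst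
    contDiffOn_snd)).continuous_fderiv (by simp)

/-- A shift of the last component is a shift of the constant term of the polynomial in `λ`. -/
theorem lamPoly_add_last {n : ℕ} {x y : Fin n → ℝ} {c : ℝ} (hn : 1 ≤ n)
    (h : ∀ k, 1 ≤ k → k < n → comp y k = comp x k) (hl : comp y n = comp x n + c) :
    lamPoly 0 y = lamPoly 0 x + Polynomial.C c := by
  ext j
  rw [Polynomial.coeff_add, Polynomial.coeff_C]
  rcases le_or_gt j n with hj | hj
  · rw [coeff_lamPoly _ _ hj, coeff_lamPoly _ _ hj, coeff_pser, coeff_pser]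
    rcases Nat.eq_zero_or_pos j with rfl | h0
    · rw [if_neg (by omega), if_pos (by omega), if_neg (by omega), if_pos (by omega), if_pos rfl,
        Nat.sub_zero, hl]
    · rw [if_neg (by omega : ¬ j = 0), add_zero]
      split_ifs
      · rfl
      · exact h _ (by omega) (by omega)
      · rfl
  · rw [coeff_lamPoly_of_lt _ _ hj, coeff_lamPoly_of_lt _ _ hj, if_neg (by omega), add_zero]

/-- A shift of `r_{nx}` by `ε` shifts `v_{nx}` by `2 ε` and leaves the other `v_{kx}` unchanged. -/
theorem comp_vxOfR_add_last {n : ℕ} (r w : Fin n → ℝ) (i : Fin n) (hi : i.val + 1 = n) (ε : ℝ) :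
    (∀ k, 1 ≤ k → k < n → comp (vxOfR r (w + ε • Pi.single i 1)) k = comp (vxOfR r w) k) ∧
      comp (vxOfR r (w + ε • Pi.single i 1)) n = comp (vxOfR r w) n + 2 * ε := by
  have key : ∀ k, 1 ≤ k → k ≤ n → comp (vxOfR r (w + ε • Pi.single i 1)) k =
      comp (vxOfR r w) k + coeff k (X ^ n * (C (2 * ε) * pser n 1 r)) := by
    intro k h1 h2
    rw [comp_vxOfR _ _ h1 h2, comp_vxOfR _ _ h1 h2, pser_add_single n 0 ε w i (by omega), hi,
      ← map_add, map_mul C, map_ofNat]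
    congr 1
    ring
  constructor
  · intro k h1 h2
    rw [key k h1 h2.le, coeff_X_pow_mul', if_neg (by omega), add_zero]
  · rw [key n (by omega) le_rfl, coeff_X_pow_mul', if_pos le_rfl, Nat.sub_self, coeff_C_mul]
    simp

/-- An arbitrarily small shift of the momentum `s_1 = r_{nx}` makes `v(λ)` and `v_x(λ)` coprime. -/
theorem dense_independentY {n : ℕ} (hn : 1 ≤ n) (a : ℕ → ℝ) (α : ℝ) :
    Dense (independentY n a α) := by
  rintro ⟨r, s⟩
  let i : Fin n := ⟨0, by omega⟩
  have hrev : (i.rev).val + 1 = n := by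
    rw [Fin.val_rev]
    simp only [i]
    omega
  have hmom : ∀ ε : ℝ, mom0 (s + ε • Pi.single i 1) = mom0 s + ε • Pi.single i.rev 1 := by
    intro ε
    ext j
    simp only [mom0, Pi.add_apply, Pi.smul_apply, Pi.single_apply, Fin.rev_eq_iff]
  have hev := eventually_isCoprime (lamPoly 1 (vOfR r)) (lamPoly 0 (vxOfR r (mom0 s)))
    (lamPoly_one_ne_zero _) (two_ne_zero (α := ℝ))
  have ht : Filter.Tendsto (fun ε : ℝ => (r, s + ε • Pi.single i 1)) (nhdsWithin 0 {0}ᶜ)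
      (nhds (r, s)) := by
    have hcont : Continuous fun ε : ℝ => (r, s + ε • (Pi.single i 1 : Fin n → ℝ)) := by fun_prop
    have := hcont.tendsto 0
    simp only [zero_smul, add_zero] at this
    exact this.mono_left nhdsWithin_le_nhds
  refine mem_closure_of_tendsto ht ?_
  filter_upwards [hev] with ε hε
  refine mem_independentY hn a α ?_
  obtain ⟨h1, h2⟩ := comp_vxOfR_add_last r (mom0 s) i.rev hrev ε
  rw [hmom, lamPoly_add_last hn h1 h2]
  exact hε

theorem hasDerivAt_vxOfQ_snd {n : ℕ} (q : Fin n → ℝ) {w : ℝ → Fin n → ℝ} {w' : Fin n → ℝ} {x : ℝ}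
    (hw : HasDerivAt w w' x) : HasDerivAt (fun y => vxOfQ q (w y)) (vxOfQ q w') x := by
  refine hasDerivAt_of_comp fun k h1 h2 => ?_
  rcases h2.lt_or_eq with h2 | rfl
  · simp only [comp_vxOfQ _ _ h1 h2]
    exact (((HasCoeffDerivAt.pser hw (n - 1) 0).const_mul (pser (n - 1) 1 q)).const_mul 2) k
  · simp only [comp_vxOfQ_last h1]
    exact (((hasDerivAt_comp hw k).const_mul (comp q k)).const_mul 2).fun_neg

theorem vxOfQ_injective {n : ℕ} {q : Fin n → ℝ} (hq : comp q n ≠ 0) :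
    Function.Injective (vxOfQ q) := by
  intro w z h
  have h0 : constantCoeff (2 * pser (n - 1) 1 q) ≠ 0 := by
    rw [map_mul, map_ofNat, constantCoeff_pser]
    norm_num
  have h1 : ∀ k < n - 1 + 1, coeff k (2 * pser (n - 1) 1 q * pser (n - 1) 0 w) =
      coeff k (2 * pser (n - 1) 1 q * pser (n - 1) 0 z) := by
    intro k hk
    rw [mul_assoc, mul_assoc, ← coeff_pser_vxOfQ q w k hk, ← coeff_pser_vxOfQ q z k hk, h]
  refine fun_eq_of_comp fun k hk => ?_
  rw [Finset.mem_Icc] at hk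
  rcases hk.2.lt_or_eq with hlt | rfl
  · have := coeff_eq_of_mul h0 h1 k (by omega)
    rwa [coeff_pser, coeff_pser, if_neg (by omega), if_pos (by omega), if_neg (by omega),
      if_pos (by omega)] at this
  · have h2 := comp_vxOfQ_last hk.1 q w
    rw [h, comp_vxOfQ_last hk.1] at h2
    exact mul_left_cancel₀ hq (by linarith)

theorem vxOfQ_zero {n : ℕ} (q : Fin n → ℝ) : vxOfQ q 0 = 0 := by
  refine fun_eq_of_comp fun k hk => ?_
  rw [Finset.mem_Icc] at hk
  rcases hk.2.lt_or_eq with hlt | rfl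
  · have h0 : pser (n - 1) 0 (0 : Fin n → ℝ) = 0 := by
      ext j
      simp [comp]
    rw [comp_vxOfQ _ _ hk.1 hlt, h0]
    simp [comp]
  · rw [comp_vxOfQ_last hk.1]
    simp [comp]

theorem isOpen_comp_fst_ne (n : ℕ) : IsOpen {z : (Fin n → ℝ) × (Fin n → ℝ) | comp z.1 n ≠ 0} :=
  (isOpen_comp_ne n).preimage continuous_fst

/-- Where `v(λ)` and `v_x(λ)` are coprime and `q_n ≠ 0`, the differentials of the `H_j` are independent
already on variations of the momenta. -/
theorem mem_independentX {n : ℕ} (hn : 2 ≤ n) (a : ℕ → ℝ) (β : ℝ) {q p : Fin n → ℝ}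
    (hq : comp q n ≠ 0) (hc : IsCoprime (lamPoly 1 (vOfQ q)) (lamPoly 0 (vxOfQ q (mom1 p)))) :
    (q, p) ∈ independentX n a β := by
  refine ⟨hq, linearIndependent_of_injective_snd _ fun σ hσ => ?_⟩
  set vx : ℝ → Fin n → ℝ := fun ε => vxOfQ q (mom1 (p + ε • σ)) with hvx
  set vxx : ℝ → Fin n → ℝ := fun ε =>
    vxxOfQ q (mom1 (p + ε • σ)) (accel1 n a β q (p + ε • σ)) with hvxx
  have hline := contDiff_add_smul p σ
  have h1 : HasDerivAt vx (vxOfQ q (mom1 σ)) 0 := by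
    refine hasDerivAt_vxOfQ_snd q ?_
    rw [hasDerivAt_pi]
    intro i
    simp only [mom1_apply]
    exact hasDerivAt_pi.1 (hasDerivAt_add_smul p σ) (rev1 i)
  have h2 : HasDerivAt vxx (deriv vxx 0) 0 := by
    have : ContDiff ℝ ∞ vxx := contDiffOn_univ.1 (contDiffOn_vxxOfQ contDiffOn_const
      (contDiffOn_mom1 hline.contDiffOn)
      (contDiffOn_accel1 hn a contDiffOn_const contDiffOn_const fun _ _ => hq))
    exact (this.differentiable (by simp) 0).hasDerivAt
  have hg : vxOfQ q (mom1 σ) = 0 := by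
    refine eq_zero_of_genBv_variation (by omega) a (vOfQ q) h1 h2 ?_ fun k hk2 hk => ?_
    · simpa [hvx] using hc
    · rcases le_or_gt k n with hkn | hkn
      · have : (fun y => coeff k (genBv a (vOfQ q) (vx y) (vxx y))) =
            fun _ => coeff k (aPow a n) := by
          funext y
          exact (isP1Jet_accel1 hn a β hq (p + y • σ) _).coeff_eq hn hkn
        rw [this]
        exact hasDerivAt_const _ _
      rcases hk.lt_or_eq with hkt | rfl
      · have hdiff : DifferentiableAt ℝ (fun y : (Fin n → ℝ) × (Fin n → ℝ) =>
            redX n a β (k - (n + 1)) y.1 y.2) (q, p) :=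
          ((contDiffOn_redX hn a _ contDiffOn_const contDiffOn_fst contDiffOn_snd
            fun _ hz => hz).differentiableOn (by simp)).differentiableAt
            ((isOpen_comp_fst_ne n).mem_nhds hq)
        have hd : HasDerivAt (fun y => coeff k (genBv a (vOfQ q) (vx y) (vxx y))) _ 0 :=
          hasCoeffDerivAt_genBv_of_const a (vOfQ q) h1 h2 k
        have h3 := fderiv_snd_eq hdiff (σ := σ)
          ((hd.const_mul (-1 / 8)).congr_of_eventuallyEq (Filter.Eventually.of_forall fun ε => by
            simp only [redX_eq]
            rw [show k - (n + 1) + n + 1 = k by omega]))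
        have h4 := hσ ⟨k - (n + 1), by omega⟩
        rw [h3] at h4
        convert hd using 1
        linarith
      · have : (fun y => coeff (2 * n + 1) (genBv a (vOfQ q) (vx y) (vxx y))) = fun _ => β := by
          funext y
          exact (isP1Jet_accel1 hn a β hq (p + y • σ) _).2
        rw [this]
        exact hasDerivAt_const _ _
  have := vxOfQ_injective hq (hg.trans (vxOfQ_zero q).symm)
  rw [← mom1_mom1 σ, this]
  ext i
  rw [mom1_apply]
  rfl

theorem isOpen_independentX {n : ℕ} (hn : 2 ≤ n) (a : ℕ → ℝ) (β : ℝ) :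
    IsOpen (independentX n a β) := by
  have hcont : ContinuousOn (fun (z : (Fin n → ℝ) × (Fin n → ℝ)) (j : Fin n) =>
      fderiv ℝ (fun y : (Fin n → ℝ) × (Fin n → ℝ) => redX n a β j.val y.1 y.2) z)
      {z | comp z.1 n ≠ 0} := by
    refine continuousOn_pi.2 fun j => ?_
    exact (contDiffOn_redX hn a j.val contDiffOn_const contDiffOn_fst contDiffOn_snd
      fun _ hz => hz).continuousOn_fderiv_of_isOpen (isOpen_comp_fst_ne n) (by simp)
  exact hcont.isOpen_inter_preimage (isOpen_comp_fst_ne n) isOpen_setOfPred_linearIndependent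

/-- A shift of `q_{nx}` by `ε` shifts `v_{nx}` by `-2 q_n ε` and leaves the other `v_{kx}` unchanged. -/
theorem comp_vxOfQ_add_last {n : ℕ} (q w : Fin n → ℝ) (i : Fin n) (hi : i.val + 1 = n) (ε : ℝ) :
    (∀ k, 1 ≤ k → k < n → comp (vxOfQ q (w + ε • Pi.single i 1)) k = comp (vxOfQ q w) k) ∧
      comp (vxOfQ q (w + ε • Pi.single i 1)) n = comp (vxOfQ q w) n + -2 * comp q n * ε := by
  constructor
  · intro k h1 h2
    rw [comp_vxOfQ _ _ h1 h2, comp_vxOfQ _ _ h1 h2,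
      pser_add_single_of_lt (n - 1) 0 ε w i (by omega)]
  · rw [comp_vxOfQ_last (by omega), comp_vxOfQ_last (by omega), comp_add, comp_smul, comp_single,
      if_pos hi.symm]
    ring

/-- An arbitrarily small shift of the momentum `p_n = q_{nx}` makes `v(λ)` and `v_x(λ)` coprime. -/
theorem subset_closure_independentX {n : ℕ} (hn : 2 ≤ n) (a : ℕ → ℝ) (β : ℝ) :
    {z : (Fin n → ℝ) × (Fin n → ℝ) | comp z.1 n ≠ 0} ⊆ closure (independentX n a β) := by
  rintro ⟨q, p⟩ (hq : comp q n ≠ 0)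
  let i : Fin n := ⟨n - 1, by omega⟩
  have hi : i.val + 1 = n := by
    simp only [i]
    omega
  have hmom : ∀ ε : ℝ, mom1 (p + ε • Pi.single i 1) = mom1 p + ε • Pi.single i 1 := by
    intro ε
    ext j
    have : rev1 j = i ↔ j = i := by
      constructor
      · intro h
        rw [← rev1_rev1 j, h, rev1_last hi]
      · rintro rfl
        exact rev1_last hi
    simp only [mom1_apply, Pi.add_apply, Pi.smul_apply, Pi.single_apply, this]
  have hev := eventually_isCoprime (lamPoly 1 (vOfQ q)) (lamPoly 0 (vxOfQ q (mom1 p)))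
    (lamPoly_one_ne_zero _) (κ := -2 * comp q n) (mul_ne_zero (by norm_num) hq)
  have ht : Filter.Tendsto (fun ε : ℝ => (q, p + ε • Pi.single i 1)) (nhdsWithin 0 {0}ᶜ)
      (nhds (q, p)) := by
    have hcont : Continuous fun ε : ℝ => (q, p + ε • (Pi.single i 1 : Fin n → ℝ)) := by fun_prop
    have := hcont.tendsto 0
    simp only [zero_smul, add_zero] at this
    exact this.mono_left nhdsWithin_le_nhds
  refine mem_closure_of_tendsto ht ?_
  filter_upwards [hev] with ε hε
  refine mem_independentX hn a β hq ?_
  obtain ⟨h1, h2⟩ := comp_vxOfQ_add_last q (mom1 p) i hi ε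
  rw [hmom, lamPoly_add_last (by omega) h1 h2]
  exact hε

/-! ### The stationary flow -/

/-- `c(λ) = 1 + ∑_{j=1}^n c_j λ^{-j}` as a power series in `t`. -/
def cPow (n : ℕ) (c : ℕ → ℝ) : ℝ⟦X⟧ := pser n 1 fun i : Fin n => c (i.val + 1)

theorem coeff_cPow (n : ℕ) (c : ℕ → ℝ) (k : ℕ) :
    coeff k (cPow n c) = if k = 0 then 1 else if k ≤ n then c k else 0 := by
  rw [cPow, coeff_pser]
  split_ifs with h1 h2
  · rfl
  · rw [comp_eq _ (by omega) h2]
    congr 1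
    simp only
    omega
  · rfl

theorem constantCoeff_cPow (n : ℕ) (c : ℕ → ℝ) : constantCoeff (cPow n c) = 1 :=
  constantCoeff_pser _ _ _

theorem aOfC_eq (n : ℕ) (c : ℕ → ℝ) (k : ℕ) : aOfC n c k = -coeff (k + 1) (cPow n c ^ 2) := by
  have h : (1 + ∑ j ∈ Finset.Icc 1 n, HahnSeries.single (j : ℤ) (c j) : LaurentSeries ℝ) =
      toL (cPow n c) := by
    rw [cPow, ← serTo_eq, serTo, cst_eq, map_one, map_one]
    congr 1
    refine Finset.sum_congr rfl fun j hj => ?_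
    rw [Finset.mem_Icc] at hj
    rw [comp_eq _ hj.1 hj.2]
    simp only [Nat.sub_add_cancel hj.1]
  have e : -lam * toL (cPow n c ^ 2) = lam * toL (-cPow n c ^ 2) := by
    rw [map_neg]
    ring
  rw [aOfC, h, ← map_pow, e, Del_lam_toL, map_neg]

theorem coeff_mul_range (f g : ℝ⟦X⟧) (m : ℕ) :
    coeff m (f * g) = ∑ i ∈ Finset.range (m + 1), coeff i f * coeff (m - i) g := by
  rw [coeff_mul]
  exact Finset.Nat.sum_antidiagonal_eq_sum_range_succ (fun i j => coeff i f * coeff j g) m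

theorem coeff_cPow_mul (n : ℕ) (c : ℕ → ℝ) (f : ℝ⟦X⟧) :
    coeff (n + 1) (cPow n c * f) =
      coeff (n + 1) f + ∑ j ∈ Finset.Icc 1 n, c j * coeff (n - j + 1) f := by
  rw [coeff_mul_range, Finset.sum_range_succ, Finset.sum_range_succ', coeff_cPow, if_pos rfl,
    coeff_cPow, if_neg (by omega), if_neg (by omega), Finset.range_eq_Ico,
    Finset.sum_Ico_add' (fun i => coeff i (cPow n c) * coeff (n + 1 - i) f) 0 n 1, zero_mul, add_zero,
    one_mul, Nat.sub_zero, add_comm, zero_add, Finset.Ico_add_one_right_eq_Icc]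
  congr 1
  refine Finset.sum_congr rfl fun j hj => ?_
  rw [Finset.mem_Icc] at hj
  rw [coeff_cPow, if_neg (by omega), if_pos hj.2, Nat.sub_add_comm hj.2]

theorem bilB_toL_eq_iff (u : ℝ) (f f' f'' : ℝ⟦X⟧) :
    bilB u ⟨toL f, toL f', toL f''⟩ ⟨toL f, toL f', toL f''⟩ = -lam ↔ genB u f f' f'' = -1 := by
  rw [bilB_toL]
  have h : lam ≠ 0 := left_ne_zero_of_mul (a := lam) (b := toL X) (by
    rw [lam_mul_X]
    exact one_ne_zero)
  rw [show -lam = lam * toL (-1) by rw [map_neg, map_one]; ring, mul_right_inj' h]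
  exact toL_injective.eq_iff

theorem genB_mul (u : ℝ) (γ f f' f'' : ℝ⟦X⟧) :
    genB u (γ * f) (γ * f') (γ * f'') = γ ^ 2 * genB u f f' f'' := by
  rw [genB, genB]
  ring

/-- The terms of `f` of order `t^{m+1}` contribute to `t B^λ(f, f)` in orders `≤ m + 1` only through
`-f²`. -/
theorem coeff_genB_congr {m : ℕ} (u : ℝ) {f f' f'' g g' g'' : ℝ⟦X⟧} (h0 : constantCoeff g = 1)
    (h : ∀ k < m + 1, coeff k f = coeff k g) (h' : ∀ k < m + 1, coeff k f' = coeff k g')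
    (h'' : ∀ k < m + 1, coeff k f'' = coeff k g'') {k : ℕ} (hk : k ≤ m) :
    coeff (k + 1) (genB u f f' f'') = coeff (k + 1) (genB u g g' g'')
      - if k = m then 2 * (coeff (m + 1) f - coeff (m + 1) g) else 0 := by
  rw [← X_pow_dvd_sub_iff] at h h' h''
  obtain ⟨w, hw⟩ := h
  obtain ⟨w', hw'⟩ := h'
  obtain ⟨w'', hw''⟩ := h''
  have hw0 : constantCoeff w = coeff (m + 1) f - coeff (m + 1) g := by
    rw [← map_sub, hw, coeff_X_pow_mul', if_pos le_rfl, Nat.sub_self,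
      coeff_zero_eq_constantCoeff_apply]
  have e : genB u f f' f'' = genB u g g' g'' + X ^ (m + 1) * (X * (2 * w * (g'' + X ^ (m + 1) * w'')
      + 2 * g * w'' - 2 * g' * w' - X ^ (m + 1) * w' ^ 2 + C (4 * u) * (2 * g * w
      + X ^ (m + 1) * w ^ 2) - X ^ m * w ^ 2) - 2 * g * w) := by
    rw [genB, genB, sub_eq_iff_eq_add.1 hw, sub_eq_iff_eq_add.1 hw', sub_eq_iff_eq_add.1 hw'']
    ring
  rw [e, map_add, coeff_X_pow_mul']
  rcases hk.lt_or_eq with hk | rfl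
  · rw [if_neg (by omega), if_neg (by omega), add_zero, sub_zero]
  · rw [if_pos le_rfl, if_pos rfl, Nat.sub_self, coeff_zero_eq_constantCoeff_apply]
    simp only [map_sub, map_mul, constantCoeff_X, h0, hw0, map_ofNat]
    ring

theorem coeff_one_genB (u : ℝ) {f f' f'' : ℝ⟦X⟧} (h : constantCoeff f = 1)
    (h' : constantCoeff f' = 0) (h'' : constantCoeff f'' = 0) :
    coeff 1 (genB u f f' f'') = 4 * u - 2 * coeff 1 f := by
  rw [genB, map_add, sub_mul, map_sub, mul_assoc, mul_assoc]
  simp only [one_mul, coeff_C_mul, pow_two, coeff_one_mul]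
  simp [h, h', h'']
  ring

theorem hasCoeffDerivAt_mk {I : Set ℝ} (hI : IsOpen I) {w : ℕ → ℝ → ℝ}
    (hw : ∀ k, ContDiffOn ℝ ∞ (w k) I) {x : ℝ} (hx : x ∈ I) :
    HasCoeffDerivAt (fun y => PowerSeries.mk fun k => w k y)
      (PowerSeries.mk fun k => deriv (w k) x) x := fun k => by
  simp only [coeff_mk]
  exact (((hw k).differentiableOn (by simp)).differentiableAt (hI.mem_nhds hx)).hasDerivAt

/-- A solution of the Lax--Novikov equation gives a solution of the `P₀`-system: `v(λ)` is the
truncation of `c(λ) v̄(λ)`. -/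
theorem exists_p0System_of_laxNovikov {n : ℕ} (hn : 1 ≤ n) {c : ℕ → ℝ} {I : Set ℝ} {u : ℝ → ℝ}
    (hI : IsOpen I) (hc : IsPreconnected I) (h : u ∈ LaxNovikov n c I) :
    ∃ (α : ℝ) (v : ℝ → Fin n → ℝ), ContDiffOn ℝ ∞ v I ∧ P0System (aOfC n c) α I v ∧
      ∀ x ∈ I, u x = uOf (aOfC n c) (v x) := by
  obtain ⟨-, w, ⟨hw, hw0, hB⟩, hLN⟩ := h
  have hw1 : ∀ k, ContDiffOn ℝ ∞ (deriv (w k)) I := fun k => (hw k).deriv_of_isOpen hI (by simp)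
  set γ := cPow n c with hγ
  set F : ℝ → ℝ⟦X⟧ := fun x => γ * PowerSeries.mk fun k => w k x with hF
  set F' : ℝ → ℝ⟦X⟧ := fun x => γ * PowerSeries.mk fun k => deriv (w k) x with hF'
  set F'' : ℝ → ℝ⟦X⟧ := fun x => γ * PowerSeries.mk fun k => deriv (deriv (w k)) x with hF''
  have hd : ∀ x ∈ I, HasCoeffDerivAt F (F' x) x := fun x hx =>
    (hasCoeffDerivAt_mk hI hw hx).const_mul γ
  have hd' : ∀ x ∈ I, HasCoeffDerivAt F' (F'' x) x := fun x hx =>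
    (hasCoeffDerivAt_mk hI hw1 hx).const_mul γ
  have hG : ∀ x ∈ I, genB (u x) (F x) (F' x) (F'' x) = -γ ^ 2 := fun x hx => by
    rw [hF, hF', hF'']
    simp only
    rw [genB_mul, (bilB_toL_eq_iff _ _ _ _).1 (hB x hx)]
    ring
  -- the Lax--Novikov equation is the conservation of the coefficient of `λ^{-(n+1)}` in `c v̄`
  obtain ⟨κ, hκ⟩ : ∃ κ, ∀ x ∈ I, coeff (n + 1) (F x) = κ := by
    refine hI.exists_is_const_of_deriv_eq_zero hc
      (fun x hx => (hd x hx (n + 1)).differentiableAt.differentiableWithinAt) fun x hx => ?_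
    rw [(hd x hx (n + 1)).deriv, hF', coeff_cPow_mul]
    simpa only [coeff_mk, Pi.zero_apply] using hLN x hx
  set v : ℝ → Fin n → ℝ := fun x i => coeff (i.val + 1) (F x) with hv
  have hcomp : ∀ (G : ℝ⟦X⟧) (z : ℝ), constantCoeff G = z →
      ∀ k < n + 1, coeff k G = coeff k (pser n z fun i : Fin n => coeff (i.val + 1) G) := by
    intro G z hz k hk
    refine (coeff_pser_eq le_rfl hz (fun k h1 h2 => ?_) k hk).symm
    rw [comp_eq _ h1 h2]
    simp only [Nat.sub_add_cancel h1]
  have hv1 : ∀ x ∈ I, HasDerivAt v (fun i => coeff (i.val + 1) (F' x)) x := fun x hx =>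
    hasDerivAt_pi.2 fun i => hd x hx _
  have hv2 : ∀ x ∈ I, HasDerivAt (deriv v) (fun i => coeff (i.val + 1) (F'' x)) x := fun x hx => by
    have e : deriv v =ᶠ[nhds x] fun y i => coeff (i.val + 1) (F' y) := by
      filter_upwards [hI.mem_nhds hx] with y hy using (hv1 y hy).deriv
    exact (hasDerivAt_pi.2 fun i => hd' x hx _).congr_of_eventuallyEq e
  have h0 : ∀ x ∈ I, constantCoeff (F x) = 1 := fun x hx => by
    rw [hF, map_mul, constantCoeff_cPow, ← coeff_zero_eq_constantCoeff_apply, coeff_mk, hw0 x hx,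
      one_mul]
  have h0' : ∀ x ∈ I, constantCoeff (F' x) = 0 := fun x hx => by
    have e : (fun y => coeff 0 (F y)) =ᶠ[nhds x] fun _ => (1 : ℝ) := by
      filter_upwards [hI.mem_nhds hx] with y hy
      rw [coeff_zero_eq_constantCoeff_apply, h0 y hy]
    rw [← coeff_zero_eq_constantCoeff_apply]
    exact (hd x hx 0).unique ((hasDerivAt_const x (1 : ℝ)).congr_of_eventuallyEq e)
  have h0'' : ∀ x ∈ I, constantCoeff (F'' x) = 0 := fun x hx => by
    have e : (fun y => coeff 0 (F' y)) =ᶠ[nhds x] fun _ => (0 : ℝ) := by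
      filter_upwards [hI.mem_nhds hx] with y hy
      rw [coeff_zero_eq_constantCoeff_apply, h0' y hy]
    rw [← coeff_zero_eq_constantCoeff_apply]
    exact (hd' x hx 0).unique ((hasDerivAt_const x (0 : ℝ)).congr_of_eventuallyEq e)
  have hu : ∀ x ∈ I, u x = uOf (aOfC n c) (v x) := fun x hx => by
    have h1 := coeff_one_genB (u x) (h0 x hx) (h0' x hx) (h0'' x hx)
    rw [hG x hx, map_neg] at h1
    rw [uOf, comp_eq _ le_rfl hn, aOfC_eq]
    simp only [hv]
    linarith
  refine ⟨2 * κ + aOfC n c n, v, ?_, ?_, hu⟩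
  · refine contDiffOn_pi.2 fun i => ?_
    exact (CoeffSmoothOn.const γ I).mul (fun k => by simpa only [coeff_mk] using hw k) (i.val + 1)
  · rw [p0System_iff hn]
    intro x hx k hk
    rw [Finset.mem_Icc] at hk
    have h1 := coeff_genB_congr (u x) (constantCoeff_pser n 1 (v x)) (hcomp (F x) 1 (h0 x hx))
      (hcomp (F' x) 0 (h0' x hx)) (hcomp (F'' x) 0 (h0'' x hx)) hk.2
    rw [hG x hx, map_neg, hκ x hx, coeff_pser_of_lt 1 (v x) (by omega), ← aOfC_eq] at h1
    rw [genBv, ← hu x hx, (hv1 x hx).deriv, (hv2 x hx).deriv]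
    split_ifs at h1 ⊢ with hkn
    · rw [hkn] at h1 ⊢
      linarith
    · linarith

/-- A solution of the `P₀`-system gives a solution of the Lax--Novikov equation: `B^λ(v, v)` is
constant along the solution, so `v(λ)` is a multiple of the basis solution by a constant series, and
that series agrees with `c(λ)` up to order `λ^{-n}`. -/
theorem laxNovikov_of_p0System {n : ℕ} (hn : 1 ≤ n) {c : ℕ → ℝ} {I : Set ℝ} {u : ℝ → ℝ}
    (hI : IsOpen I) (hc : IsPreconnected I) {α : ℝ} {v : ℝ → Fin n → ℝ} (hv : ContDiffOn ℝ ∞ v I)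
    (hP : P0System (aOfC n c) α I v) (hu : ∀ x ∈ I, u x = uOf (aOfC n c) (v x)) :
    u ∈ LaxNovikov n c I := by
  set a := aOfC n c with ha
  rcases I.eq_empty_or_nonempty with rfl | ⟨x₀, hx₀⟩
  · exact ⟨contDiffOn_empty, fun _ _ => 0, ⟨fun _ => contDiffOn_empty, by simp, by simp⟩, by simp⟩
  have hv2 : ContDiffOn ℝ 2 v I := hv.of_le (by norm_cast)
  have hJ := (p0System_iff hn a α I v).1 hP
  have hconst : ∀ k, ∃ A, ∀ x ∈ I, coeff k (genBv a (v x) (deriv v x) (deriv (deriv v) x)) = A := by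
    intro k
    rcases le_or_gt k (n + 1) with hk | hk
    · exact ⟨_, fun x hx => (hJ x hx).coeff_eq hn hk⟩
    · obtain ⟨A, hA⟩ := hamiltonEqs0_integrals hn a α hI hc
        ((p0System_equiv hn a α hI hv2).2.1 hP) (k - (n + 1))
      refine ⟨A, fun x hx => ?_⟩
      have := (hA x hx).1
      simp only [vOfR_rCoord] at this
      rwa [gdAlong_top, show k - (n + 1) + n + 1 = k by omega] at this
  choose A hA using hconst
  have hA0 : A 0 = -1 := by rw [← hA 0 x₀ hx₀, coeff_zero_genBv]
  set γ : ℝ⟦X⟧ := PowerSeries.mk (sqrtCoeff fun k => -A k) with hγ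
  have hγ2 : γ ^ 2 = PowerSeries.mk fun k => -A k := sqrtCoeff_sq _ (by rw [hA0]; norm_num)
  have hγ0 : constantCoeff γ = 1 := by
    rw [hγ, ← coeff_zero_eq_constantCoeff_apply, coeff_mk, sqrtCoeff]
  have hγi : γ * γ⁻¹ = 1 := PowerSeries.mul_inv_cancel _ (by rw [hγ0]; norm_num)
  have hcγ : X ^ (n + 1) ∣ cPow n c - γ := by
    rw [X_pow_dvd_sub_iff]
    refine coeff_eq_of_sq (constantCoeff_cPow n c) hγ0 fun k hk => ?_
    rw [hγ2, coeff_mk, ← hA k x₀ hx₀, (hJ x₀ hx₀).coeff_eq hn hk.le]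
    cases k with
    | zero =>
      rw [aPow0, map_add, coeff_C_mul, coeff_X_pow, coeff_aPow]
      simp [constantCoeff_cPow]
    | succ k =>
      rw [coeff_aPow0 a n α (by omega), if_neg (by omega), ha, aOfC_eq, neg_neg]
  obtain ⟨h1, h2⟩ := hasDerivAt_deriv_of_contDiffOn hI hv2
  have hw1 : ∀ x ∈ I, HasCoeffDerivAt (fun y => γ⁻¹ * pser n 1 (v y)) (γ⁻¹ * pser n 0 (deriv v x)) x :=
    fun x hx => (HasCoeffDerivAt.pser (h1 x hx) n 1).const_mul _
  have hw2 : ∀ x ∈ I, HasCoeffDerivAt (fun y => γ⁻¹ * pser n 0 (deriv v y))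
      (γ⁻¹ * pser n 0 (deriv (deriv v) x)) x :=
    fun x hx => (HasCoeffDerivAt.pser (h2 x hx) n 0).const_mul _
  set w : ℕ → ℝ → ℝ := fun k x => coeff k (γ⁻¹ * pser n 1 (v x)) with hw
  have hd1 : ∀ k, ∀ x ∈ I, deriv (w k) x = coeff k (γ⁻¹ * pser n 0 (deriv v x)) := fun k x hx =>
    (hw1 x hx k).deriv
  have hd2 : ∀ k, ∀ x ∈ I, deriv (deriv (w k)) x =
      coeff k (γ⁻¹ * pser n 0 (deriv (deriv v) x)) := fun k x hx => by
    have e : deriv (w k) =ᶠ[nhds x] fun y => coeff k (γ⁻¹ * pser n 0 (deriv v y)) := by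
      filter_upwards [hI.mem_nhds hx] with y hy using hd1 k y hy
    rw [e.deriv_eq, (hw2 x hx k).deriv]
  have hmk : ∀ f : ℝ⟦X⟧, (PowerSeries.mk fun k => coeff k f) = f := fun f => by
    ext k
    rw [coeff_mk]
  refine ⟨?_, w, ⟨fun k => ?_, fun x hx => ?_, fun x hx => ?_⟩, fun x hx => ?_⟩
  · refine ContDiffOn.congr ?_ hu
    exact ((contDiffOn_comp hv 1).div_const 2).add contDiffOn_const
  · exact (CoeffSmoothOn.const γ⁻¹ I).mul (CoeffSmoothOn.pser hv n 1) k
  · simp only [hw]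
    rw [coeff_zero_eq_constantCoeff_apply, map_mul, constantCoeff_inv, hγ0, constantCoeff_pser]
    norm_num
  · have hB : genBv a (v x) (deriv v x) (deriv (deriv v) x) = -γ ^ 2 := by
      ext k
      rw [hγ2, hA k x hx, map_neg, coeff_mk, neg_neg]
    simp only [fullJet, hd1 _ x hx, hd2 _ x hx]
    simp only [hw, hmk]
    rw [bilB_toL_eq_iff, genB_mul, hu x hx, ← genBv, hB]
    linear_combination (-(γ * γ⁻¹) - 1) * hγi
  · obtain ⟨η, hη⟩ := hcγ
    have e : cPow n c * (γ⁻¹ * pser n 0 (deriv v x)) = pser n 0 (deriv v x) +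
        X ^ (n + 1) * (η * γ⁻¹ * pser n 0 (deriv v x)) := by
      linear_combination γ⁻¹ * pser n 0 (deriv v x) * hη + pser n 0 (deriv v x) * hγi
    simp only [hd1 _ x hx]
    rw [← coeff_cPow_mul, e, map_add, coeff_pser_of_lt 0 _ (by omega), coeff_X_pow_mul',
      if_pos le_rfl, Nat.sub_self, coeff_zero_eq_constantCoeff_apply, map_mul, constantCoeff_pser]
    ring

/-- The solutions `u` of the Lax--Novikov equation are those obtained from the `P₀`-system. -/
theorem mem_laxNovikov_iff {n : ℕ} (hn : 1 ≤ n) (c : ℕ → ℝ) {I : Set ℝ} (u : ℝ → ℝ)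
    (hI : IsOpen I) (hc : IsPreconnected I) :
    u ∈ LaxNovikov n c I ↔ ∃ (α : ℝ) (v : ℝ → Fin n → ℝ), ContDiffOn ℝ ∞ v I ∧
      P0System (aOfC n c) α I v ∧ ∀ x ∈ I, u x = uOf (aOfC n c) (v x) :=
  ⟨exists_p0System_of_laxNovikov hn hI hc,
    fun ⟨_, _, hv, hP, hu⟩ => laxNovikov_of_p0System hn hI hc hv hP hu⟩

/-! ### The common jets of the two systems -/

/-- For given `v` and `v_x`, the coefficients of `B^λ(v, v)` determine `v_{xx}`, order by order, as they
are affine in it with leading part `2 v v_{xx}`. -/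
theorem coeff_pser_eq_of_genBv {n N : ℕ} {a : ℕ → ℝ} {v vx y z : Fin n → ℝ}
    (h : ∀ k < N, coeff (k + 1) (genBv a v vx y) = coeff (k + 1) (genBv a v vx z)) :
    ∀ k < N, coeff k (pser n 0 y) = coeff k (pser n 0 z) := by
  have h0 : constantCoeff (2 * pser n 1 v) ≠ 0 := by
    rw [map_mul, map_ofNat, constantCoeff_pser]
    norm_num
  refine coeff_eq_of_mul h0 fun k hk => ?_
  have := h k hk
  simp only [genBv, genB, mul_sub, map_add, map_sub, coeff_succ_X_mul] at this
  linarith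

/-- The two systems share their first `n - 1` equations. -/
theorem IsP0Jet.isP1Jet {n : ℕ} {a : ℕ → ℝ} {α : ℝ} {v vx vxx : Fin n → ℝ}
    (h : IsP0Jet a α v vx vxx) : IsP1Jet a (coeff (2 * n + 1) (genBv a v vx vxx)) v vx vxx := by
  refine ⟨fun k hk => ?_, rfl⟩
  rw [Finset.mem_Icc] at hk
  rw [h k (Finset.mem_Icc.2 ⟨hk.1, by omega⟩), if_neg (by omega)]

theorem IsP1Jet.isP0Jet {n : ℕ} {a : ℕ → ℝ} {β : ℝ} {v vx vxx : Fin n → ℝ}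
    (h : IsP1Jet a β v vx vxx) : IsP0Jet a (coeff (n + 1) (genBv a v vx vxx)) v vx vxx := by
  intro k hk
  rw [Finset.mem_Icc] at hk
  split_ifs with hkn
  · rw [hkn]
  · exact h.1 k (Finset.mem_Icc.2 ⟨hk.1, by omega⟩)

/-- The `P₀`-equations determine `v_{xx}` from `v` and `v_x`. -/
theorem IsP0Jet.unique {n : ℕ} (hn : 1 ≤ n) {a : ℕ → ℝ} {α : ℝ} {v vx y z : Fin n → ℝ}
    (hy : IsP0Jet a α v vx y) (hz : IsP0Jet a α v vx z) : y = z := by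
  refine fun_eq_of_comp fun k hk => ?_
  rw [Finset.mem_Icc] at hk
  have := coeff_pser_eq_of_genBv (N := n + 1) (y := y) (z := z) (fun j hj => by
    rw [hy.coeff_eq hn (by omega), hz.coeff_eq hn (by omega)]) k (by omega)
  rwa [coeff_pser, coeff_pser, if_neg (by omega), if_pos hk.2, if_neg (by omega), if_pos hk.2]
    at this

/-- Where `v_n ≠ 0`, the `P₁`-equations determine `v_{xx}` from `v` and `v_x`: the first `n - 1` give all
components but the last, which enters `p_{nn}` as `2 v_n v_{nxx}`. -/
theorem IsP1Jet.unique {n : ℕ} (hn : 2 ≤ n) {a : ℕ → ℝ} {β : ℝ} {v vx y z : Fin n → ℝ}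
    (hv : comp v n ≠ 0) (hy : IsP1Jet a β v vx y) (hz : IsP1Jet a β v vx z) : y = z := by
  refine fun_eq_of_comp fun k hk => ?_
  rw [Finset.mem_Icc] at hk
  rcases hk.2.lt_or_eq with hlt | rfl
  · have := coeff_pser_eq_of_genBv (N := n) (y := y) (z := z) (fun j hj => by
      rw [hy.coeff_eq hn (by omega), hz.coeff_eq hn (by omega)]) k hlt
    rwa [coeff_pser, coeff_pser, if_neg (by omega), if_pos hk.2, if_neg (by omega), if_pos hk.2]
      at this
  · have h1 := hy.2.trans hz.2.symm
    rw [coeff_top_genBv hk.1, coeff_top_genBv hk.1] at h1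
    exact mul_left_cancel₀ hv (by linarith)

section Charts

variable {n : ℕ} {a : ℕ → ℝ} {r s q p : Fin n → ℝ} {α β : ℝ}

theorem comp_vOfQ_neg (hn : 1 ≤ n) (hq : comp q n ≠ 0) : comp (vOfQ q) n < 0 := by
  rw [comp_vOfQ_last hn, neg_lt_zero]
  positivity

/-- At points of the two charts with the same `v` and `v_x` the accelerations agree as soon as `a_{2n}`
is the value of `p_{nn}` in the first chart. -/
theorem vxx_eq_of_redY (hn : 2 ≤ n) (hq : comp q n ≠ 0) (hv : vOfQ q = vOfR r)
    (hvx : vxOfQ q (mom1 p) = vxOfR r (mom0 s)) (h : β = -8 * redY n a α n r s) :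
    vxxOfQ q (mom1 p) (accel1 n a β q p) = vxxOfR r (mom0 s) (accel0 n a α r s) := by
  have hX := isP1Jet_accel1 hn a β hq p (mom1 p)
  have hY := (isP0Jet_accel0 (by omega) a α r s (mom0 s)).isP1Jet
  have hβ : coeff (2 * n + 1) (genBv a (vOfR r) (vxOfR r (mom0 s))
      (vxxOfR r (mom0 s) (accel0 n a α r s))) = β := by
    rw [h, redY_eq, two_mul]
    ring
  rw [hβ] at hY
  have hvn := (comp_vOfQ_neg (by omega) hq).ne
  rw [hv] at hvn
  rw [hv, hvx] at hX
  exact hX.unique hn hvn hY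

/-- At points of the two charts with the same `v` and `v_x` the accelerations agree as soon as `a_n`
is the value of `p_{0n}` in the second chart. -/
theorem vxx_eq_of_redX (hn : 2 ≤ n) (hq : comp q n ≠ 0) (hv : vOfQ q = vOfR r)
    (hvx : vxOfQ q (mom1 p) = vxOfR r (mom0 s)) (h : α = -8 * redX n a β 0 q p) :
    vxxOfQ q (mom1 p) (accel1 n a β q p) = vxxOfR r (mom0 s) (accel0 n a α r s) := by
  have hX := (isP1Jet_accel1 hn a β hq p (mom1 p)).isP0Jet
  have hY := isP0Jet_accel0 (by omega : 1 ≤ n) a α r s (mom0 s)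
  have hα : coeff (n + 1) (genBv a (vOfQ q) (vxOfQ q (mom1 p))
      (vxxOfQ q (mom1 p) (accel1 n a β q p))) = α := by
    rw [h, redX_eq, zero_add]
    ring
  rw [hα, hv, hvx] at hX
  exact hX.unique (by omega) hY

theorem redX_eq_redY (hv : vOfQ q = vOfR r) (hvx : vxOfQ q (mom1 p) = vxOfR r (mom0 s))
    (hvxx : vxxOfQ q (mom1 p) (accel1 n a β q p) = vxxOfR r (mom0 s) (accel0 n a α r s)) (j : ℕ) :
    redX n a β j q p = redY n a α j r s := by
  rw [redX_eq, redY_eq, hvxx, hv, hvx]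

theorem redY_zero (hn : 1 ≤ n) (a : ℕ → ℝ) (α : ℝ) (r s : Fin n → ℝ) :
    redY n a α 0 r s = -1 / 8 * α := by
  rw [redY_eq, zero_add, isP0Jet_accel0 hn a α r s _ n (Finset.mem_Icc.2 ⟨hn, le_rfl⟩), if_pos rfl]

theorem redX_top (hn : 2 ≤ n) (a : ℕ → ℝ) (β : ℝ) (hq : comp q n ≠ 0) (p : Fin n → ℝ) :
    redX n a β n q p = -1 / 8 * β := by
  rw [redX_eq, ← two_mul, (isP1Jet_accel1 hn a β hq p _).2]

end Charts

/-! ### The map `Φ` and its inverse -/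

/-- `q_x` in terms of `r` and `r_x`: the last component comes from `v_n = -q_n²`. -/
def qxOfR {n : ℕ} (r rx : Fin n → ℝ) : Fin n → ℝ := fun i =>
  if i.val + 1 = n then -(vxOfR r rx i) / (2 * qCoord (vOfR r) i) else rx i

theorem Phi_eq (n : ℕ) (a : ℕ → ℝ) (m : Ext n) :
    Phi n a m = (qCoord (vOfR m.1), mom1 (qxOfR m.1 (mom0 m.2.1)),
      -8 * redY n a m.2.2 n m.1 m.2.1) := rfl

theorem vxOfQ_qxOfR {n : ℕ} {r : Fin n → ℝ} (hr : comp (vOfR r) n < 0) (rx : Fin n → ℝ) :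
    vxOfQ (qCoord (vOfR r)) (qxOfR r rx) = vxOfR r rx := by
  refine fun_eq_of_comp fun k hk => ?_
  rw [Finset.mem_Icc] at hk
  rcases hk.2.lt_or_eq with hlt | rfl
  · rw [comp_vxOfQ _ _ hk.1 hlt, comp_vxOfR _ _ hk.1 hk.2]
    have h1 : ∀ j < n - 1 + 1, coeff j (pser (n - 1) 1 (qCoord (vOfR r))) = coeff j (pser n 1 r) := by
      refine coeff_pser_eq le_rfl (constantCoeff_pser _ _ _) fun i h1 h2 => ?_
      rw [comp_qCoord _ h1 (by omega), rCoord_vOfR, coeff_pser, if_neg (by omega),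
        if_pos (by omega)]
    have h2 : ∀ j < n - 1 + 1, coeff j (pser (n - 1) 0 (qxOfR r rx)) = coeff j (pser n 0 rx) := by
      refine coeff_pser_eq le_rfl (constantCoeff_pser _ _ _) fun i h1 h2 => ?_
      rw [comp_eq _ h1 (by omega), qxOfR, if_neg (by simp only; omega), coeff_pser,
        if_neg (by omega), if_pos (by omega), comp_eq _ h1 (by omega)]
    exact coeff_mul_congr (fun _ _ => rfl) fun j hj =>
      coeff_mul_congr (fun i hi => h1 i (by omega)) fun i hi => h2 i (by omega)
  · have hq := comp_qCoord_pos hk.1 hr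
    rw [comp_vxOfQ_last hk.1, comp_eq (qxOfR r rx) hk.1 le_rfl, qxOfR]
    simp only [Nat.sub_add_cancel hk.1]
    rw [if_true, ← comp_eq (vxOfR r rx) hk.1 le_rfl, ← comp_eq (qCoord _) hk.1 le_rfl]
    field_simp

/-- `r_x` in terms of `r` and `v_x`: the coefficients of `v_x / (2 r)`. -/
def rxOfV {n : ℕ} (r vx : Fin n → ℝ) : Fin n → ℝ := fun i =>
  coeff (i.val + 1) (C (1 / 2) * ((pser n 1 r)⁻¹ * pser n 0 vx))

theorem vxOfR_rxOfV {n : ℕ} (r vx : Fin n → ℝ) : vxOfR r (rxOfV r vx) = vx := by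
  refine fun_eq_of_comp fun k hk => ?_
  rw [Finset.mem_Icc] at hk
  have h1 : pser n 1 r * (pser n 1 r)⁻¹ = 1 :=
    PowerSeries.mul_inv_cancel _ (by rw [constantCoeff_pser]; norm_num)
  have h2 : ∀ j < n + 1, coeff j (pser n 0 (rxOfV r vx)) =
      coeff j (C (1 / 2) * ((pser n 1 r)⁻¹ * pser n 0 vx)) := by
    refine coeff_pser_eq le_rfl (by simp [constantCoeff_pser]) fun i h1 h2 => ?_
    rw [comp_eq _ h1 h2, rxOfV]
    simp only [Nat.sub_add_cancel h1]
  have h3 : 2 * (pser n 1 r * (C (1 / 2) * ((pser n 1 r)⁻¹ * pser n 0 vx))) = pser n 0 vx := by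
    have h4 : C (1 / 2) * 2 = (1 : ℝ⟦X⟧) := by
      rw [← map_ofNat (C : ℝ →+* ℝ⟦X⟧) 2, ← map_mul]
      norm_num
    linear_combination C (1 / 2) * 2 * pser n 0 vx * h1 + pser n 0 vx * h4
  rw [comp_vxOfR _ _ hk.1 hk.2, coeff_mul_congr (fun _ _ => rfl) fun j hj =>
      coeff_mul_congr (fun _ _ => rfl) fun i hi => h2 i (by omega), h3, coeff_pser,
    if_neg (by omega), if_pos hk.2]

/-- The inverse of `Φ`: `a_n` is recovered as the value of `p_{0n}`. -/
def PhiInv (n : ℕ) (a : ℕ → ℝ) (m : Ext n) : Ext n :=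
  (rCoord (vOfQ m.1), mom0 (rxOfV (rCoord (vOfQ m.1)) (vxOfQ m.1 (mom1 m.2.1))),
    -8 * redX n a m.2.2 0 m.1 m.2.1)

section Phi

variable {n : ℕ} {a : ℕ → ℝ} {m : Ext n}

theorem Phi_fst_ne (hn : 1 ≤ n) (a : ℕ → ℝ) (hm : m ∈ dom0 n) : comp (Phi n a m).1 n ≠ 0 :=
  (comp_qCoord_pos hn hm).ne'

theorem vOfQ_Phi (a : ℕ → ℝ) (hm : m ∈ dom0 n) : vOfQ (Phi n a m).1 = vOfR m.1 := vOfQ_qCoord hm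

theorem vxOfQ_Phi (a : ℕ → ℝ) (hm : m ∈ dom0 n) :
    vxOfQ (Phi n a m).1 (mom1 (Phi n a m).2.1) = vxOfR m.1 (mom0 m.2.1) := by
  rw [Phi_eq, mom1_mom1]
  exact vxOfQ_qxOfR hm _

theorem vxxOfQ_Phi (hn : 2 ≤ n) (a : ℕ → ℝ) (hm : m ∈ dom0 n) :
    vxxOfQ (Phi n a m).1 (mom1 (Phi n a m).2.1)
        (accel1 n a (Phi n a m).2.2 (Phi n a m).1 (Phi n a m).2.1) =
      vxxOfR m.1 (mom0 m.2.1) (accel0 n a m.2.2 m.1 m.2.1) :=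
  vxx_eq_of_redY hn (Phi_fst_ne (by omega) a hm) (vOfQ_Phi a hm) (vxOfQ_Phi a hm) rfl

/-- `Φ` carries the integrals of one system to those of the other, because both are `-p_{jn}/8` at the
same jet of `v`. -/
theorem Hext_Phi (hn : 2 ≤ n) (hm : m ∈ dom0 n) (j : ℕ) :
    Hext n a j (Phi n a m) = Kext n a j m :=
  redX_eq_redY (vOfQ_Phi a hm) (vxOfQ_Phi a hm) (vxxOfQ_Phi hn a hm) j

theorem mapsTo_Phi (hn : 1 ≤ n) (a : ℕ → ℝ) : MapsTo (Phi n a) (dom0 n) (dom1 n) := fun _ hm =>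
  comp_qCoord_pos hn hm

theorem mapsTo_PhiInv (hn : 1 ≤ n) (a : ℕ → ℝ) : MapsTo (PhiInv n a) (dom1 n) (dom0 n) := by
  intro m (hm : 0 < comp m.1 n)
  change comp (vOfR (rCoord (vOfQ m.1))) n < 0
  rw [vOfR_rCoord]
  exact comp_vOfQ_neg hn hm.ne'

theorem leftInvOn_PhiInv (hn : 2 ≤ n) (a : ℕ → ℝ) : LeftInvOn (PhiInv n a) (Phi n a) (dom0 n) := by
  intro m hm
  have h := Hext_Phi (a := a) hn hm 0
  rw [Hext, Kext, redY_zero (by omega)] at h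
  rw [PhiInv, vOfQ_Phi a hm, vxOfQ_Phi a hm, rCoord_vOfR, h,
    vxOfR_injective _ (vxOfR_rxOfV m.1 (vxOfR m.1 (mom0 m.2.1))), mom0_mom0]
  refine Prod.ext rfl (Prod.ext rfl ?_)
  simp only
  ring

theorem rightInvOn_PhiInv (hn : 2 ≤ n) (a : ℕ → ℝ) : RightInvOn (PhiInv n a) (Phi n a) (dom1 n) := by
  intro m (hm : 0 < comp m.1 n)
  have hv : vOfQ m.1 = vOfR (PhiInv n a m).1 := by
    rw [PhiInv, vOfR_rCoord]
  have hvx : vxOfQ m.1 (mom1 m.2.1) = vxOfR (PhiInv n a m).1 (mom0 (PhiInv n a m).2.1) := by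
    rw [PhiInv, mom0_mom0, vxOfR_rxOfV]
  have hq : qCoord (vOfR (PhiInv n a m).1) = m.1 := by
    rw [← hv, qCoord_vOfQ hm]
  have hneg : comp (vOfR (PhiInv n a m).1) n < 0 := mapsTo_PhiInv (by omega) a hm
  have hqx : qxOfR (PhiInv n a m).1 (mom0 (PhiInv n a m).2.1) = mom1 m.2.1 := by
    refine vxOfQ_injective hm.ne' ?_
    rw [hvx, ← vxOfQ_qxOfR hneg, hq]
  have hred := redX_eq_redY hv hvx (vxx_eq_of_redX (α := (PhiInv n a m).2.2) (a := a) (β := m.2.2)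
    hn hm.ne' hv hvx rfl) n
  rw [redX_top hn a _ hm.ne'] at hred
  rw [Phi_eq, hq, hqx, mom1_mom1, ← hred]
  refine Prod.ext rfl (Prod.ext rfl ?_)
  simp only
  ring

theorem isOpen_dom0 (n : ℕ) : IsOpen (dom0 n) := by
  have h : Continuous fun m : Ext n => comp (vOfR m.1) n :=
    ((contDiff_comp n).comp (contDiffOn_univ.1 (contDiffOn_vOfR contDiffOn_fst))).continuous
  exact isOpen_lt h continuous_const

theorem isOpen_dom1 (n : ℕ) : IsOpen (dom1 n) :=
  isOpen_lt continuous_const ((contDiff_comp n).continuous.comp continuous_fst)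

theorem contDiffOn_Phi (hn : 1 ≤ n) (a : ℕ → ℝ) : ContDiffOn ℝ ∞ (Phi n a) (dom0 n) := by
  have hs : ContDiffOn ℝ ∞ (fun m : Ext n => m.2.1) (dom0 n) := contDiff_snd.fst.contDiffOn
  have hα : ContDiffOn ℝ ∞ (fun m : Ext n => m.2.2) (dom0 n) := contDiff_snd.snd.contDiffOn
  have hv : ContDiffOn ℝ ∞ (fun m : Ext n => vOfR m.1) (dom0 n) := contDiffOn_vOfR contDiffOn_fst
  have hq : ContDiffOn ℝ ∞ (fun m : Ext n => qCoord (vOfR m.1)) (dom0 n) :=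
    (contDiffOn_qCoord hn).comp hv fun _ hm => hm
  have hvx : ContDiffOn ℝ ∞ (fun m : Ext n => vxOfR m.1 (mom0 m.2.1)) (dom0 n) :=
    contDiffOn_vxOfR contDiffOn_fst (contDiffOn_mom0 hs)
  refine hq.prodMk (ContDiffOn.prodMk (contDiffOn_mom1 (w := fun m : Ext n => qxOfR m.1 (mom0 m.2.1))
    (contDiffOn_pi.2 fun i => ?_))
    (contDiffOn_const.mul (contDiffOn_redY n a n hα contDiffOn_fst hs)))
  unfold qxOfR
  split_ifs with hi
  · refine (contDiffOn_pi.1 hvx i).neg.div (contDiffOn_const.mul (contDiffOn_pi.1 hq i)) fun m hm => ?_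
    have h := comp_qCoord_pos hn hm
    rw [← comp_succ (qCoord (vOfR m.1)) i, hi]
    exact mul_ne_zero two_ne_zero h.ne'
  · exact contDiffOn_pi.1 (contDiffOn_mom0 hs) i

theorem contDiffOn_PhiInv (hn : 2 ≤ n) (a : ℕ → ℝ) : ContDiffOn ℝ ∞ (PhiInv n a) (dom1 n) := by
  have hp : ContDiffOn ℝ ∞ (fun m : Ext n => m.2.1) (dom1 n) := contDiff_snd.fst.contDiffOn
  have hβ : ContDiffOn ℝ ∞ (fun m : Ext n => m.2.2) (dom1 n) := contDiff_snd.snd.contDiffOn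
  have hr : ContDiffOn ℝ ∞ (fun m : Ext n => rCoord (vOfQ m.1)) (dom1 n) :=
    contDiff_rCoord.comp_contDiffOn (contDiffOn_vOfQ contDiffOn_fst)
  have hvx : ContDiffOn ℝ ∞ (fun m : Ext n => vxOfQ m.1 (mom1 m.2.1)) (dom1 n) :=
    contDiffOn_vxOfQ contDiffOn_fst (contDiffOn_mom1 hp)
  refine hr.prodMk (ContDiffOn.prodMk (contDiffOn_mom0
    (w := fun m : Ext n => rxOfV (rCoord (vOfQ m.1)) (vxOfQ m.1 (mom1 m.2.1)))
    (contDiffOn_pi.2 fun i => ?_)) (contDiffOn_const.mul (contDiffOn_redX hn a 0 hβ contDiffOn_fst hp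
      fun m (hm : 0 < comp m.1 n) => hm.ne')))
  exact (CoeffSmoothOn.const _ _).mul (((CoeffSmoothOn.pser hr n 1).inv
    fun _ => constantCoeff_pser _ _ _).mul (CoeffSmoothOn.pser hvx n 0)) _

/-- `Φ` identifies the solutions of the two systems. -/
theorem exists_p1System {n : ℕ} (hn : 2 ≤ n) (a : ℕ → ℝ) (α : ℝ) {I : Set ℝ} {v : ℝ → Fin n → ℝ}
    (hI : IsOpen I) (hc : IsPreconnected I) (hv : ContDiffOn ℝ 2 v I)
    (hneg : ∀ x ∈ I, comp (v x) n < 0) (hP : P0System a α I v) :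
    ∃ β : ℝ, P1System a β I v ∧ ∀ x ∈ I,
      Phi n a (rCoord (v x), mom0 (deriv (fun y => rCoord (v y)) x), α) =
        (qCoord (v x), mom1 (deriv (fun y => qCoord (v y)) x), β) := by
  obtain ⟨A, hA⟩ := hamiltonEqs0_integrals (by omega) a α hI hc
    ((p0System_equiv (by omega) a α hI hv).2.1 hP) n
  simp only [vOfR_rCoord] at hA
  refine ⟨A, fun x hx => ⟨(hP x hx).1, (hA x hx).1⟩, fun x hx => ?_⟩
  obtain ⟨hr, -⟩ := hasDerivAt_deriv_of_contDiffOn hI (r := fun y => rCoord (v y))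
    ((contDiff_rCoord.of_le (by norm_cast)).comp_contDiffOn hv)
  obtain ⟨hq, -⟩ := hasDerivAt_deriv_of_contDiffOn hI (contDiffOn_qCoord_comp (by omega) hv hneg)
  have h1 := hasDerivAt_vOfR (hr x hx)
  simp only [vOfR_rCoord] at h1
  have h2 : HasDerivAt v _ x := (hasDerivAt_vOfQ (hq x hx)).congr_of_eventuallyEq (by
    filter_upwards [hI.mem_nhds hx] with y hy using (vOfQ_qCoord (hneg y hy)).symm)
  have h3 : qxOfR (rCoord (v x)) (deriv (fun y => rCoord (v y)) x) =
      deriv (fun y => qCoord (v y)) x := by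
    refine vxOfQ_injective (comp_qCoord_pos (by omega) (hneg x hx)).ne' ?_
    have := vxOfQ_qxOfR (r := rCoord (v x)) (by rw [vOfR_rCoord]; exact hneg x hx)
      (deriv (fun y => rCoord (v y)) x)
    rw [vOfR_rCoord] at this
    rw [this]
    exact h1.unique h2
  rw [Phi_eq]
  simp only
  rw [mom0_mom0, vOfR_rCoord, h3, (hA x hx).2]
  refine Prod.ext rfl (Prod.ext rfl ?_)
  simp only
  ring

end Phi

/-! ### The Hamiltonian vector fields -/

section VectorFields

variable {n : ℕ} {a : ℕ → ℝ} {m : Ext n}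

theorem fderiv_apply_snd {F : Ext n → ℝ} (hF : DifferentiableAt ℝ F m) (k : Fin n) :
    fderiv ℝ F m (0, Pi.single k 1, 0) = pd (fun y => F (m.1, y, m.2.2)) m.2.1 k := by
  have hF' : HasFDerivAt F (fderiv ℝ F m) (m.1, m.2.1, m.2.2) := hF.hasFDerivAt
  have hi : HasFDerivAt (fun y : Fin n → ℝ => ((m.1, y, m.2.2) : Ext n))
      ((0 : (Fin n → ℝ) →L[ℝ] (Fin n → ℝ)).prod ((ContinuousLinearMap.id ℝ (Fin n → ℝ)).prod 0))
      m.2.1 :=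
    (hasFDerivAt_const _ _).prodMk ((hasFDerivAt_id _).prodMk (hasFDerivAt_const _ _))
  have h := hF'.comp m.2.1 hi
  rw [pd]
  have h' : HasFDerivAt (fun y => F (m.1, y, m.2.2)) _ m.2.1 := h
  rw [h'.fderiv]
  rfl

theorem fderiv_apply_fst {F : Ext n → ℝ} (hF : DifferentiableAt ℝ F m) (k : Fin n) :
    fderiv ℝ F m (Pi.single k 1, 0, 0) = pd (fun y => F (y, m.2.1, m.2.2)) m.1 k := by
  have hF' : HasFDerivAt F (fderiv ℝ F m) (m.1, m.2.1, m.2.2) := hF.hasFDerivAt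
  have hi : HasFDerivAt (fun y : Fin n → ℝ => ((y, m.2.1, m.2.2) : Ext n))
      ((ContinuousLinearMap.id ℝ (Fin n → ℝ)).prod ((0 : (Fin n → ℝ) →L[ℝ] (Fin n → ℝ)).prod 0))
      m.1 :=
    (hasFDerivAt_id _).prodMk ((hasFDerivAt_const _ _).prodMk (hasFDerivAt_const _ _))
  have h := hF'.comp m.1 hi
  rw [pd]
  have h' : HasFDerivAt (fun y => F (y, m.2.1, m.2.2)) _ m.1 := h
  rw [h'.fderiv]
  rfl

theorem canTensor_fderiv {F : Ext n → ℝ} (hF : DifferentiableAt ℝ F m) :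
    canTensor n (fderiv ℝ F m) = (fun k => pd (fun y => F (m.1, y, m.2.2)) m.2.1 k,
      fun k => -pd (fun y => F (y, m.2.1, m.2.2)) m.1 k, 0) := by
  refine Prod.ext ?_ (Prod.ext ?_ rfl)
  · exact funext fun k => fderiv_apply_snd hF k
  · exact funext fun k => congrArg Neg.neg (fderiv_apply_fst hF k)

theorem contDiff_H0ext (n : ℕ) (a : ℕ → ℝ) : ContDiff ℝ ∞ (H0ext n a) := by
  have h : H0ext n a = fun m => 1 / 2 * coeff (n + 1) (pser n 0 m.2.1 ^ 2)
      + pot (a 0) (aPow0 a n m.2.2) (n + 2) 0 (pser n 1 m.1) :=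
    funext fun m => H0_eq n a m.2.2 m.1 m.2.1
  rw [h]
  exact ((contDiff_kinetic n n (n + 1)).comp contDiff_snd.fst).add (contDiffOn_univ.1
    (contDiffOn_pot0 n a contDiff_snd.snd.contDiffOn contDiffOn_fst))

theorem contDiffOn_H1ext (hn : 2 ≤ n) (a : ℕ → ℝ) :
    ContDiffOn ℝ ∞ (H1ext n a) {m | comp m.1 n ≠ 0} := by
  have h : H1ext n a = fun m => kin1 m.2.1 + pot1 n a m.2.2 m.1 :=
    funext fun m => H1_eq hn a m.2.2 m.1 m.2.1
  rw [h]
  refine ContDiffOn.add ?_ (contDiffOn_pot1 n a contDiff_snd.snd.contDiffOn contDiffOn_fst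
    fun _ hm => hm)
  exact ((contDiff_kinetic n (n - 1) n).comp contDiff_snd.fst).contDiffOn.add
    (contDiffOn_const.mul ((contDiffOn_comp contDiff_snd.fst.contDiffOn n).pow 2))

theorem isOpen_ext_ne (n : ℕ) : IsOpen {m : Ext n | comp m.1 n ≠ 0} :=
  (isOpen_comp_ne n).preimage continuous_fst

theorem canTensor_H0ext (n : ℕ) (a : ℕ → ℝ) (m : Ext n) :
    canTensor n (fderiv ℝ (H0ext n a) m) =
      (mom0 m.2.1, mom0 (accel0 n a m.2.2 m.1 m.2.1), 0) := by
  rw [canTensor_fderiv ((contDiff_H0ext n a).differentiable (by simp) m), accel0, mom0_mom0]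
  refine Prod.ext (funext fun k => ?_) rfl
  exact pd_H0_snd n a m.2.2 m.1 m.2.1 k

theorem canTensor_H1ext (hn : 2 ≤ n) (a : ℕ → ℝ) (hm : comp m.1 n ≠ 0) :
    canTensor n (fderiv ℝ (H1ext n a) m) =
      (mom1 m.2.1, mom1 (accel1 n a m.2.2 m.1 m.2.1), 0) := by
  rw [canTensor_fderiv (((contDiffOn_H1ext hn a).differentiableOn (by simp)).differentiableAt
    ((isOpen_ext_ne n).mem_nhds hm)), accel1, mom1_mom1]
  refine Prod.ext (funext fun k => ?_) rfl
  exact pd_H1_snd hn a m.2.2 m.1 m.2.1 k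

/-- `Φ_*` maps the first Hamiltonian vector field to the second one. Both are determined by
`v`, `v_x` and `v_{xx}`, which the charts share, and the last component vanishes because `p_{nn}` is
conserved. -/
theorem fderiv_Phi_canTensor (hn : 2 ≤ n) (a : ℕ → ℝ) (hm : m ∈ dom0 n) :
    fderiv ℝ (Phi n a) m (canTensor n (fderiv ℝ (H0ext n a) m)) =
      canTensor n (fderiv ℝ (H1ext n a) (Phi n a m)) := by
  rw [canTensor_H0ext, canTensor_H1ext hn a (Phi_fst_ne (by omega) a hm)]
  set r := m.1 with hr
  set s := m.2.1 with hs
  set α := m.2.2 with hα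
  set q := (Phi n a m).1 with hq
  set p := (Phi n a m).2.1 with hp
  have hqn : comp q n ≠ 0 := Phi_fst_ne (by omega) a hm
  -- both sides are compared along the straight line `z` in the direction of the first vector field,
  -- on which `v_x` and `v_{xx}` are to first order the derivatives of `v` and `v_x`
  set ξ : Ext n := (mom0 s, mom0 (accel0 n a α r s), 0) with hξ
  let z : ℝ → Ext n := fun t => m + t • ξ
  have hz0 : z 0 = m := by simp [z]
  have hz : HasDerivAt z ξ 0 := by
    have := ((hasDerivAt_id (0 : ℝ)).smul_const ξ).const_add m
    rw [one_smul] at this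
    exact this
  have hdom : ∀ᶠ t in nhds (0 : ℝ), z t ∈ dom0 n :=
    hz.continuousAt.eventually ((isOpen_dom0 n).mem_nhds (by rw [hz0]; exact hm))
  have hΦ : HasDerivAt (fun t => Phi n a (z t)) (fderiv ℝ (Phi n a) m ξ) 0 := by
    have h : HasFDerivAt (Phi n a) (fderiv ℝ (Phi n a) m) (z 0) := by
      rw [hz0]
      exact (((contDiffOn_Phi (by omega) a).differentiableOn (by simp)).differentiableAt
        ((isOpen_dom0 n).mem_nhds hm)).hasFDerivAt
    exact h.comp_hasDerivAt (0 : ℝ) hz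
  set η := fderiv ℝ (Phi n a) m ξ
  have hz1 : HasDerivAt (fun t => (z t).1) (mom0 s) 0 := hz.fst
  have hz2 : HasDerivAt (fun t => mom0 (z t).2.1) (accel0 n a α r s) 0 := by
    have h : HasDerivAt (fun t => (z t).2.1) (mom0 (accel0 n a α r s)) 0 := hz.snd.fst
    rw [hasDerivAt_pi] at h ⊢
    intro i
    have := h i.rev
    simpa only [mom0, Fin.rev_rev] using this
  have hz3 : ∀ t, (z t).2.2 = α := fun t => by simp [z, hξ, hα]
  have hq1 : HasDerivAt (fun t => (Phi n a (z t)).1) η.1 0 := hΦ.fst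
  have hq2 : HasDerivAt (fun t => mom1 (Phi n a (z t)).2.1) (mom1 η.2.1) 0 := by
    have h : HasDerivAt (fun t => (Phi n a (z t)).2.1) η.2.1 0 := hΦ.snd.fst
    rw [hasDerivAt_pi] at h ⊢
    intro i
    simp only [mom1_apply]
    exact h (rev1 i)
  have hv : HasDerivAt (fun t => vOfR (z t).1) (vxOfR r (mom0 s)) 0 := by
    have := hasDerivAt_vOfR hz1
    rwa [hz0] at this
  have hvx : HasDerivAt (fun t => vxOfR (z t).1 (mom0 (z t).2.1))
      (vxxOfR r (mom0 s) (accel0 n a α r s)) 0 := by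
    have := hasDerivAt_vxOfR (r := fun t => (z t).1) (w := fun t => mom0 (z t).2.1) (x := 0)
      (w' := accel0 n a α r s) (by rw [hz0]; exact hz1) hz2
    rwa [hz0] at this
  have e1 : η.1 = mom1 p := by
    refine vxOfQ_injective hqn ?_
    rw [hq, hp, vxOfQ_Phi a hm]
    refine HasDerivAt.unique ?_ hv
    have h := hasDerivAt_vOfQ hq1
    rw [hz0] at h
    refine h.congr_of_eventuallyEq ?_
    filter_upwards [hdom] with t ht using (vOfQ_Phi a ht).symm
  have e2 : mom1 η.2.1 = accel1 n a (Phi n a m).2.2 q p := by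
    have h := hasDerivAt_vxOfQ (q := fun t => (Phi n a (z t)).1)
      (w := fun t => mom1 (Phi n a (z t)).2.1) (x := 0) (w' := mom1 η.2.1)
      (by rw [hz0, ← hp, ← e1]; exact hq1) hq2
    rw [hz0] at h
    have h2 := (h.congr_of_eventuallyEq (by
      filter_upwards [hdom] with t ht using (vxOfQ_Phi a ht).symm)).unique hvx
    have h3 := (isP1Jet_iff hn a (Phi n a m).2.2 hqn (mom1 p) (mom1 η.2.1)).1 (by
      have h4 := isP1Jet_accel1 hn a (Phi n a m).2.2 hqn p (mom1 p)
      rw [vxxOfQ_Phi hn a hm] at h4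
      rwa [h2])
    funext i
    rw [h3, accel1_eq hn a _ hqn]
  have e3 : η.2.2 = 0 := by
    have h : HasDerivAt (fun t => (Phi n a (z t)).2.2) η.2.2 0 := hΦ.snd.snd
    refine h.unique ?_
    let vxx : ℝ → Fin n → ℝ := fun t =>
      vxxOfR (z t).1 (mom0 (z t).2.1) (accel0 n a α (z t).1 (z t).2.1)
    have hvxx : DifferentiableAt ℝ vxx 0 := by
      have h : ContDiff ℝ ∞ vxx := by
        have hz : ContDiff ℝ ∞ z := contDiff_const.add (contDiff_id.smul contDiff_const)
        exact contDiffOn_univ.1 (contDiffOn_vxxOfR hz.fst.contDiffOn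
          (contDiffOn_mom0 hz.snd.fst.contDiffOn)
          (contDiffOn_accel0 n a contDiffOn_const hz.fst.contDiffOn))
      exact h.differentiable (by simp) 0
    have hjet : ∀ k ≤ n + 1, HasDerivAt (fun t => coeff k (genBv a (vOfR (z t).1)
        (vxOfR (z t).1 (mom0 (z t).2.1)) (vxx t))) 0 0 := fun k hk => by
      have : (fun t => coeff k (genBv a (vOfR (z t).1) (vxOfR (z t).1 (mom0 (z t).2.1)) (vxx t))) =
          fun _ => coeff k (aPow0 a n α) := funext fun t =>
        (isP0Jet_accel0 (by omega) a α (z t).1 (z t).2.1 _).coeff_eq (by omega) hk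
      rw [this]
      exact hasDerivAt_const _ _
    have h2 := hasDerivAt_coeff_genBv_zero a (v := fun t => vOfR (z t).1)
      (vx := fun t => vxOfR (z t).1 (mom0 (z t).2.1)) (vxx := vxx) (x := 0)
      (by rw [hz0]; exact hv)
      (hvx.congr_deriv (by simp only [vxx]; rw [hz0])) hvxx
      (fun k hk => hjet k (by omega)) (Or.inl (hjet _ le_rfl)) (n + n + 1)
    have h3 : (fun t => (Phi n a (z t)).2.2) = fun t => coeff (n + n + 1) (genBv a (vOfR (z t).1)
        (vxOfR (z t).1 (mom0 (z t).2.1)) (vxx t)) := by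
      funext t
      rw [Phi_eq]
      simp only
      rw [redY_eq, hz3]
      ring
    rw [h3]
    exact h2
  refine Prod.ext e1 (Prod.ext ?_ e3)
  simp only
  rw [← e2, mom1_mom1]

end VectorFields

/-! ### Poisson tensors -/

section Poisson

/-- The derivative of the bracket of a constant tensor. -/
theorem fderiv_bracket_const {X : Type*} [NormedAddCommGroup X] [NormedSpace ℝ X]
    (J : (X →L[ℝ] ℝ) →L[ℝ] X) {g h : X → ℝ} {x : X}
    (hg : ContDiffAt ℝ ∞ g x) (hh : ContDiffAt ℝ ∞ h x) (w : X) :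
    fderiv ℝ (bracket (fun _ => J.toLinearMap) g h) x w =
      fderiv ℝ (fderiv ℝ g) x w (J (fderiv ℝ h x)) +
        fderiv ℝ g x (J (fderiv ℝ (fderiv ℝ h) x w)) := by
  have h1 : HasFDerivAt (fderiv ℝ g) (fderiv ℝ (fderiv ℝ g) x) x :=
    ((hg.fderiv_right (m := 1) (by norm_cast)).differentiableAt (by simp)).hasFDerivAt
  have h2 : HasFDerivAt (fderiv ℝ h) (fderiv ℝ (fderiv ℝ h) x) x :=
    ((hh.fderiv_right (m := 1) (by norm_cast)).differentiableAt (by simp)).hasFDerivAt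
  have h3 := h1.clm_apply (J.hasFDerivAt.comp x h2)
  have h4 : HasFDerivAt (bracket (fun _ => J.toLinearMap) g h) _ x := h3
  rw [h4.fderiv]
  simp [add_comm]

/-- A constant skew-symmetric tensor satisfies the Jacobi identity. -/
theorem jacobi_const {X : Type*} [NormedAddCommGroup X] [NormedSpace ℝ X]
    (J : (X →L[ℝ] ℝ) →L[ℝ] X) (hJ : ∀ φ ψ : X →L[ℝ] ℝ, φ (J ψ) = -ψ (J φ)) {f g h : X → ℝ} {x : X}
    (hf : ContDiffAt ℝ ∞ f x) (hg : ContDiffAt ℝ ∞ g x) (hh : ContDiffAt ℝ ∞ h x) :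
    bracket (fun _ => J.toLinearMap) f (bracket (fun _ => J.toLinearMap) g h) x +
      bracket (fun _ => J.toLinearMap) g (bracket (fun _ => J.toLinearMap) h f) x +
      bracket (fun _ => J.toLinearMap) h (bracket (fun _ => J.toLinearMap) f g) x = 0 := by
  have hs : ∀ {k : X → ℝ}, ContDiffAt ℝ ∞ k x → ∀ v w,
      fderiv ℝ (fderiv ℝ k) x v w = fderiv ℝ (fderiv ℝ k) x w v := fun hk v w =>
    (hk.isSymmSndFDerivAt (by rw [minSmoothness_of_isRCLikeNormedField]; norm_cast)) v w
  have key : ∀ {f g h : X → ℝ}, ContDiffAt ℝ ∞ f x → ContDiffAt ℝ ∞ g x → ContDiffAt ℝ ∞ h x →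
      bracket (fun _ => J.toLinearMap) f (bracket (fun _ => J.toLinearMap) g h) x =
        fderiv ℝ (fderiv ℝ h) x (J (fderiv ℝ f x)) (J (fderiv ℝ g x)) -
          fderiv ℝ (fderiv ℝ g) x (J (fderiv ℝ f x)) (J (fderiv ℝ h x)) := by
    intro f g h hf hg hh
    have h1 : bracket (fun _ => J.toLinearMap) f (bracket (fun _ => J.toLinearMap) g h) x =
        fderiv ℝ f x (J (fderiv ℝ (bracket (fun _ => J.toLinearMap) g h) x)) := rfl
    rw [h1, hJ, fderiv_bracket_const J hg hh, hJ (fderiv ℝ g x)]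
    ring
  rw [key hf hg hh, key hg hh hf, key hh hf hg, hs hf (J (fderiv ℝ g x)), hs hg (J (fderiv ℝ h x)),
    hs hh (J (fderiv ℝ f x))]
  ring

variable {X Y : Type*} [NormedAddCommGroup X] [NormedSpace ℝ X] [NormedAddCommGroup Y]
  [NormedSpace ℝ Y]

/-- The image under `F`, with inverse `G`, of a constant tensor `J`. -/
def pushTensor (J : (X →L[ℝ] ℝ) →ₗ[ℝ] X) (F : X → Y) (G : Y → X) (y : Y) :
    (Y →L[ℝ] ℝ) →ₗ[ℝ] Y where
  toFun φ := fderiv ℝ F (G y) (J (φ.comp (fderiv ℝ F (G y))))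
  map_add' φ ψ := by rw [ContinuousLinearMap.add_comp, map_add, map_add]
  map_smul' c φ := by rw [ContinuousLinearMap.smul_comp, map_smul, map_smul, RingHom.id_apply]

/-- The image of a constant skew-symmetric tensor under a diffeomorphism is a Poisson tensor. -/
theorem isPoissonTensorOn_pushTensor (J : (X →L[ℝ] ℝ) →L[ℝ] X)
    (hJ : ∀ φ ψ : X →L[ℝ] ℝ, φ (J ψ) = -ψ (J φ)) {F : X → Y} {G : Y → X} {U : Set X} {V : Set Y}
    (hU : IsOpen U) (hV : IsOpen V) (hF : ContDiffOn ℝ ∞ F U) (hG : ContDiffOn ℝ ∞ G V)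
    (hFU : MapsTo F U V) (hGV : MapsTo G V U) (hl : LeftInvOn G F U) (hr : RightInvOn G F V) :
    IsPoissonTensorOn V (pushTensor J.toLinearMap F G) := by
  have hF1 : ContDiffOn ℝ ∞ (fderiv ℝ F) U := hF.fderiv_of_isOpen hU (by simp)
  have hFd : ∀ y ∈ V, DifferentiableAt ℝ F (G y) := fun y hy =>
    (hF.differentiableOn (by simp)).differentiableAt (hU.mem_nhds (hGV hy))
  have hbr : ∀ {f g : Y → ℝ} {y}, y ∈ V → DifferentiableAt ℝ f y → DifferentiableAt ℝ g y →
      bracket (pushTensor J.toLinearMap F G) f g y =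
        bracket (fun _ => J.toLinearMap) (f ∘ F) (g ∘ F) (G y) := by
    intro f g y hy hf hg
    have hd : ∀ {f : Y → ℝ}, DifferentiableAt ℝ f y →
        fderiv ℝ (f ∘ F) (G y) = (fderiv ℝ f y).comp (fderiv ℝ F (G y)) := by
      intro f hf
      have hf' : DifferentiableAt ℝ f (F (G y)) := by rwa [hr hy]
      rw [fderiv_comp _ hf' (hFd y hy), hr hy]
    rw [bracket, bracket, hd hf, hd hg]
    rfl
  have hcomp : ∀ {f : Y → ℝ}, ContDiffOn ℝ ∞ f V → ContDiffOn ℝ ∞ (f ∘ F) U := fun hf =>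
    hf.comp hF hFU
  have hat : ∀ {f : X → ℝ}, ContDiffOn ℝ ∞ f U → ∀ y ∈ V, ContDiffAt ℝ ∞ f (G y) :=
    fun hf y hy => hf.contDiffAt (hU.mem_nhds (hGV hy))
  have hdV : ∀ {f : Y → ℝ}, ContDiffOn ℝ ∞ f V → ∀ y ∈ V, DifferentiableAt ℝ f y :=
    fun hf y hy => (hf.differentiableOn (by simp)).differentiableAt (hV.mem_nhds hy)
  refine ⟨fun φ => ?_, fun y _ φ ψ =>
    hJ (φ.comp (fderiv ℝ F (G y))) (ψ.comp (fderiv ℝ F (G y))), fun f g h hf hg hh y hy => ?_⟩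
  · have hD : ContDiffOn ℝ ∞ (fun y => fderiv ℝ F (G y)) V := hF1.comp hG hGV
    exact hD.clm_apply (J.contDiff.comp_contDiffOn (contDiffOn_const.clm_comp hD))
  · have hB : ∀ {g h : Y → ℝ}, ContDiffOn ℝ ∞ g V → ContDiffOn ℝ ∞ h V →
        ContDiffOn ℝ ∞ (bracket (pushTensor J.toLinearMap F G) g h) V := by
      intro g h hg hh
      have h1 : ContDiffOn ℝ ∞ (bracket (fun _ => J.toLinearMap) (g ∘ F) (h ∘ F)) U :=
        ((hcomp hg).fderiv_of_isOpen hU (by simp)).clm_apply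
          (J.contDiff.comp_contDiffOn ((hcomp hh).fderiv_of_isOpen hU (by simp)))
      exact (h1.comp hG hGV).congr fun y hy => hbr hy (hdV hg y hy) (hdV hh y hy)
    have hBB : ∀ {f g h : Y → ℝ}, ContDiffOn ℝ ∞ f V → ContDiffOn ℝ ∞ g V → ContDiffOn ℝ ∞ h V →
        bracket (pushTensor J.toLinearMap F G) f (bracket (pushTensor J.toLinearMap F G) g h) y =
          bracket (fun _ => J.toLinearMap) (f ∘ F)
            (bracket (fun _ => J.toLinearMap) (g ∘ F) (h ∘ F)) (G y) := by
      intro f g h hf hg hh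
      rw [hbr hy (hdV hf y hy) (hdV (hB hg hh) y hy)]
      have he : bracket (pushTensor J.toLinearMap F G) g h ∘ F =ᶠ[nhds (G y)]
          bracket (fun _ => J.toLinearMap) (g ∘ F) (h ∘ F) := by
        filter_upwards [hU.mem_nhds (hGV hy)] with x hx
        have hx' := hFU hx
        rw [Function.comp_apply, hbr hx' (hdV hg _ hx') (hdV hh _ hx'), hl hx]
      rw [bracket, he.fderiv_eq]
      rfl
    rw [hBB hf hg hh, hBB hg hh hf, hBB hh hf hg]
    exact jacobi_const J hJ (hat (hcomp hf) y hy) (hat (hcomp hg) y hy) (hat (hcomp hh) y hy)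

end Poisson

section SecondTensor

variable {n : ℕ}

theorem apply_eq_sum (φ : Ext n →L[ℝ] ℝ) (x y : Fin n → ℝ) :
    φ (x, y, 0) = ∑ k, (x k * φ (Pi.single k 1, 0, 0) + y k * φ (0, Pi.single k 1, 0)) := by
  have h : ((x, y, 0) : Ext n) = ∑ k, (x k • ((Pi.single k 1, 0, 0) : Ext n) +
      y k • ((0, Pi.single k 1, 0) : Ext n)) := by
    have hx : ∀ x : Fin n → ℝ, x = ∑ k, x k • (Pi.single k 1 : Fin n → ℝ) := fun x => by
      conv_lhs => rw [← Finset.univ_sum_single x]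
      refine Finset.sum_congr rfl fun k _ => ?_
      rw [← Pi.single_smul, smul_eq_mul, mul_one]
    refine Prod.ext ?_ (Prod.ext ?_ ?_)
    · simp only [Prod.fst_sum, Prod.fst_add, Prod.smul_fst, smul_zero, add_zero]
      exact hx x
    · simp only [Prod.snd_sum, Prod.fst_sum, Prod.snd_add, Prod.fst_add, Prod.smul_snd, Prod.smul_fst,
        smul_zero, zero_add]
      exact hx y
    · simp only [Prod.snd_sum, Prod.snd_add, Prod.smul_snd, smul_zero, add_zero,
        Finset.sum_const_zero]
  rw [h, map_sum]
  refine Finset.sum_congr rfl fun k _ => ?_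
  rw [map_add, map_smul, map_smul, smul_eq_mul, smul_eq_mul]

theorem canTensor_skew (φ ψ : Ext n →L[ℝ] ℝ) : φ (canTensor n ψ) = -ψ (canTensor n φ) := by
  have h : ∀ φ : Ext n →L[ℝ] ℝ, canTensor n φ =
      (fun k => φ (0, Pi.single k 1, 0), fun k => -φ (Pi.single k 1, 0, 0), 0) := fun _ => rfl
  rw [h, h, apply_eq_sum, apply_eq_sum, ← Finset.sum_neg_distrib]
  refine Finset.sum_congr rfl fun k _ => ?_
  ring

/-- The transported tensor annihilates `dH_0`, because `K_0` is, up to a factor, the parameter `a_n`;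
where the restriction of `dH_0` to the leaves `a_{2n} = const` does not vanish, the canonical tensor
does not. -/
theorem pushTensor_ne {a : ℕ → ℝ} (hn : 2 ≤ n) {y : Ext n} (hy : y ∈ dom1 n)
    (hi : (y.1, y.2.1) ∈ independentX n a y.2.2) :
    pushTensor (canTensor n) (Phi n a) (PhiInv n a) y ≠ canTensor n := by
  intro h
  have hm : PhiInv n a y ∈ dom0 n := mapsTo_PhiInv (by omega) a hy
  have hr : Phi n a (PhiInv n a y) = y := rightInvOn_PhiInv hn a hy
  have hyn : comp y.1 n ≠ 0 := ne_of_gt hy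
  have hHd : DifferentiableAt ℝ (Hext n a 0) y := by
    have h1 : ContDiffOn ℝ ∞ (Hext n a 0) {m | comp m.1 n ≠ 0} :=
      contDiffOn_redX hn a 0 contDiff_snd.snd.contDiffOn contDiffOn_fst contDiff_snd.fst.contDiffOn
        fun _ hm => hm
    exact (h1.differentiableOn (by simp)).differentiableAt ((isOpen_ext_ne n).mem_nhds hyn)
  have hΦd : DifferentiableAt ℝ (Phi n a) (PhiInv n a y) :=
    ((contDiffOn_Phi (by omega) a).differentiableOn (by simp)).differentiableAt
      ((isOpen_dom0 n).mem_nhds hm)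
  set φ := fderiv ℝ (Hext n a 0) y with hφ
  have h1 : φ.comp (fderiv ℝ (Phi n a) (PhiInv n a y)) = (-1 / 8 : ℝ) •
      (ContinuousLinearMap.snd ℝ (Fin n → ℝ) ℝ).comp
        (ContinuousLinearMap.snd ℝ (Fin n → ℝ) ((Fin n → ℝ) × ℝ)) := by
    have hc : Hext n a 0 ∘ Phi n a =ᶠ[nhds (PhiInv n a y)] fun m : Ext n => (-1 / 8 : ℝ) *
        ((ContinuousLinearMap.snd ℝ (Fin n → ℝ) ℝ).comp
        (ContinuousLinearMap.snd ℝ (Fin n → ℝ) ((Fin n → ℝ) × ℝ))) m := by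
      filter_upwards [(isOpen_dom0 n).mem_nhds hm] with m hm
      rw [Function.comp_apply, Hext_Phi hn hm, Kext, redY_zero (by omega)]
      rfl
    have hd : DifferentiableAt ℝ (Hext n a 0) (Phi n a (PhiInv n a y)) := by rwa [hr]
    have h2 := fderiv_comp (PhiInv n a y) hd hΦd
    rw [hr, ← hφ] at h2
    rw [← h2, hc.fderiv_eq]
    exact ((ContinuousLinearMap.hasFDerivAt _).const_mul (-1 / 8 : ℝ)).fderiv
  -- `φ ∘ dΦ` is a multiple of `d a_n`, which the extended canonical tensor annihilates
  have h2 : canTensor n φ = 0 := by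
    rw [← h]
    change fderiv ℝ (Phi n a) (PhiInv n a y) (canTensor n (φ.comp _)) = 0
    have h3 : canTensor n (φ.comp (fderiv ℝ (Phi n a) (PhiInv n a y))) = 0 := by
      rw [h1]
      ext k <;> simp [canTensor]
    rw [h3, map_zero]
  have h3 : ∀ w : (Fin n → ℝ) × (Fin n → ℝ), φ (w.1, w.2, 0) = 0 := by
    intro w
    rw [apply_eq_sum]
    refine Finset.sum_eq_zero fun k _ => ?_
    have e1 : φ (0, Pi.single k 1, 0) = 0 := congrFun (congrArg Prod.fst h2) k
    have e2 : φ (Pi.single k 1, 0, 0) = 0 :=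
      neg_eq_zero.1 (congrFun (congrArg (fun z : Ext n => z.2.1) h2) k)
    rw [e1, e2]
    ring
  refine hi.2.ne_zero (⟨0, by omega⟩ : Fin n) ?_
  refine ContinuousLinearMap.ext fun w => ?_
  have hι : HasFDerivAt (fun z : (Fin n → ℝ) × (Fin n → ℝ) => ((z.1, z.2, y.2.2) : Ext n))
      ((ContinuousLinearMap.fst ℝ (Fin n → ℝ) (Fin n → ℝ)).prod
        ((ContinuousLinearMap.snd ℝ (Fin n → ℝ) (Fin n → ℝ)).prod 0)) (y.1, y.2.1) :=
    hasFDerivAt_fst.prodMk (hasFDerivAt_snd.prodMk (hasFDerivAt_const _ _))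
  have hH : HasFDerivAt (Hext n a 0) φ (y.1, y.2.1, y.2.2) := hHd.hasFDerivAt
  have hHι := hH.comp (y.1, y.2.1) hι
  have h4 : HasFDerivAt (fun z : (Fin n → ℝ) × (Fin n → ℝ) => redX n a y.2.2 0 z.1 z.2) _
      (y.1, y.2.1) := hHι
  rw [h4.fderiv]
  exact h3 w

theorem subset_closure_pushTensor_ne (hn : 2 ≤ n) (a : ℕ → ℝ) :
    dom1 n ⊆ closure {y ∈ dom1 n |
      pushTensor (canTensor n) (Phi n a) (PhiInv n a) y ≠ canTensor n} := by
  intro y hy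
  let ι : (Fin n → ℝ) × (Fin n → ℝ) → Ext n := fun z => (z.1, z.2, y.2.2)
  have hι : Continuous ι := by fun_prop
  have h1 := mem_closure_iff_frequently.1
    (subset_closure_independentX hn a y.2.2 (show (y.1, y.2.1) ∈ _ from ne_of_gt hy))
  have h2 : ∀ᶠ z in nhds (y.1, y.2.1), ι z ∈ dom1 n :=
    hι.continuousAt.eventually ((isOpen_dom1 n).mem_nhds hy)
  rw [mem_closure_iff_frequently]
  refine (hι.tendsto (y.1, y.2.1)).frequently ((h1.and_eventually h2).mono ?_)
  rintro z ⟨hz1, hz2⟩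
  exact ⟨hz2, pushTensor_ne hn hz2 hz1⟩

end SecondTensor

end

end StationaryKdV

open StationaryKdV in
theorem proposition2p1 (n : ℕ) (hn : 1 ≤ n) (a : ℕ → ℝ) :
    -- the stationary flow: its solutions are given by the systems in `v₁, …, v_n`
    (∀ (c : ℕ → ℝ) (I : Set ℝ) (u : ℝ → ℝ), IsOpen I → IsPreconnected I →
      (u ∈ LaxNovikov n c I ↔ ∃ (α : ℝ) (v : ℝ → Fin n → ℝ), ContDiffOn ℝ ∞ v I ∧
        P0System (aOfC n c) α I v ∧ ∀ x ∈ I, u x = uOf (aOfC n c) (v x))) ∧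
    -- the `P₀`-system
    (∀ α : ℝ,
      IsNaturalLagrangian (L0 n a α) univ ∧
      IsCanonicalForm (L0 n a α) (H0 n a α) mom0 univ ∧
      (∀ (I : Set ℝ) (v : ℝ → Fin n → ℝ), IsOpen I → ContDiffOn ℝ 2 v I →
        (P0System a α I v ↔ EulerLagrange (L0 n a α) I (fun x => rCoord (v x))) ∧
        (P0System a α I v ↔ HamiltonEqs (H0 n a α) I (fun x => rCoord (v x))
          (fun x => mom0 (deriv (fun y => rCoord (v y)) x)))) ∧
      (∀ (I : Set ℝ) (r s : ℝ → Fin n → ℝ), IsOpen I → IsPreconnected I →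
        HamiltonEqs (H0 n a α) I r s →
        ∀ j ∈ Finset.Icc 1 n, ∃ A : ℝ, ∀ x ∈ I,
          gdAlong a (fun y => vOfR (r y)) x j n = A ∧ redY n a α j (r x) (s x) = -A / 8) ∧
      IsOpen (independentY n a α) ∧ Dense (independentY n a α)) ∧
    (2 ≤ n →
      -- the `P₁`-system
      (∀ β : ℝ,
        IsNaturalLagrangian (L1 n a β) {q | comp q n ≠ 0} ∧
        IsCanonicalForm (L1 n a β) (H1 n a β) mom1 {q | comp q n ≠ 0} ∧
        (∀ (I : Set ℝ) (v : ℝ → Fin n → ℝ), IsOpen I → ContDiffOn ℝ 2 v I →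
          (∀ x ∈ I, comp (v x) n < 0) →
          (P1System a β I v ↔ EulerLagrange (L1 n a β) I (fun x => qCoord (v x))) ∧
          (P1System a β I v ↔ HamiltonEqs (H1 n a β) I (fun x => qCoord (v x))
            (fun x => mom1 (deriv (fun y => qCoord (v y)) x)))) ∧
        (∀ (I : Set ℝ) (q p : ℝ → Fin n → ℝ), IsOpen I → IsPreconnected I →
          (∀ x ∈ I, comp (q x) n ≠ 0) → HamiltonEqs (H1 n a β) I q p →
          ∀ j ∈ Finset.range n, ∃ A : ℝ, ∀ x ∈ I,
            gdAlong a (fun y => vOfQ (q y)) x j n = A ∧ redX n a β j (q x) (p x) = -A / 8) ∧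
        IsOpen (independentX n a β) ∧
        {z : (Fin n → ℝ) × (Fin n → ℝ) | comp z.1 n ≠ 0} ⊆ closure (independentX n a β)) ∧
      -- the map `Φ`: a change of coordinates that identifies the two systems
      (MapsTo (Phi n a) (dom0 n) (dom1 n) ∧ ContDiffOn ℝ ∞ (Phi n a) (dom0 n) ∧
        ∃ Psi : Ext n → Ext n, MapsTo Psi (dom1 n) (dom0 n) ∧ ContDiffOn ℝ ∞ Psi (dom1 n) ∧
          LeftInvOn Psi (Phi n a) (dom0 n) ∧ RightInvOn Psi (Phi n a) (dom1 n)) ∧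
      (∀ (α : ℝ) (I : Set ℝ) (v : ℝ → Fin n → ℝ), IsOpen I → IsPreconnected I →
        ContDiffOn ℝ 2 v I → (∀ x ∈ I, comp (v x) n < 0) → P0System a α I v →
        ∃ β : ℝ, P1System a β I v ∧ ∀ x ∈ I,
          Phi n a (rCoord (v x), mom0 (deriv (fun y => rCoord (v y)) x), α) =
            (qCoord (v x), mom1 (deriv (fun y => qCoord (v y)) x), β)) ∧
      (∀ m ∈ dom0 n, (∀ j ≤ n, Hext n a j (Phi n a m) = Kext n a j m) ∧
        fderiv ℝ (Phi n a) m (canTensor n (fderiv ℝ (H0ext n a) m)) =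
          canTensor n (fderiv ℝ (H1ext n a) (Phi n a m))) ∧
      -- the image under `Φ` of the extended canonical Poisson tensor
      (∃ P : Ext n → ((Ext n →L[ℝ] ℝ) →ₗ[ℝ] Ext n),
        (∀ m ∈ dom0 n, ∀ φ : Ext n →L[ℝ] ℝ,
          P (Phi n a m) φ = fderiv ℝ (Phi n a) m (canTensor n (φ.comp (fderiv ℝ (Phi n a) m)))) ∧
        IsPoissonTensorOn (dom1 n) P ∧
        dom1 n ⊆ closure {y ∈ dom1 n | P y ≠ canTensor n})) := by
  refine ⟨fun c I u hI hc => mem_laxNovikov_iff hn c u hI hc, fun α => ⟨isNaturalLagrangian_L0 n a α,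
    isCanonicalForm_L0 n a α, fun I v hI hv => p0System_equiv hn a α hI hv,
    fun I r s hI hc h j _ => hamiltonEqs0_integrals hn a α hI hc h j, isOpen_independentY n a α,
    dense_independentY hn a α⟩, fun hn2 => ⟨fun β => ⟨isNaturalLagrangian_L1 hn2 a β,
    isCanonicalForm_L1 hn2 a β, fun I v hI hv hneg => p1System_equiv hn2 a β hI hv hneg,
    fun I q p hI hc hq h j _ => hamiltonEqs1_integrals hn2 a β hI hc hq h j,
    isOpen_independentX hn2 a β, subset_closure_independentX hn2 a β⟩,
    ⟨mapsTo_Phi hn a, contDiffOn_Phi hn a, PhiInv n a, mapsTo_PhiInv hn a, contDiffOn_PhiInv hn2 a,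
      leftInvOn_PhiInv hn2 a, rightInvOn_PhiInv hn2 a⟩,
    fun α I v hI hc hv hneg hP => exists_p1System hn2 a α hI hc hv hneg hP,
    fun m hm => ⟨fun j _ => Hext_Phi hn2 hm j, fderiv_Phi_canTensor hn2 a hm⟩,
    pushTensor (canTensor n) (Phi n a) (PhiInv n a), fun m hm φ => ?_, ?_,
    subset_closure_pushTensor_ne hn2 a⟩⟩
  · rw [pushTensor, LinearMap.coe_mk, AddHom.coe_mk, leftInvOn_PhiInv hn2 a hm]
  · exact isPoissonTensorOn_pushTensor (LinearMap.toContinuousLinearMap (canTensor n)) canTensor_skew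
      (isOpen_dom0 n) (isOpen_dom1 n) (contDiffOn_Phi hn a) (contDiffOn_PhiInv hn2 a)
      (mapsTo_Phi hn a) (mapsTo_PhiInv hn a) (leftInvOn_PhiInv hn2 a) (rightInvOn_PhiInv hn2 a)
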